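/- Let $k$ be an algebraically closed field of characteristic zero. **Conventions.** For $Z\subseteq\mathbb P^n$ let $I_Z$ be its homogeneous ideal in the coordinate ring $S$ of $\mathbb P^n$ (with $I_\emptyset$ the irrelevant ideal), and let $\beta_{i,j}(Z)$ be the graded Betti numbers of $S/I_Z$, i.e. the minimal free resolution of $S/I_Z$ has terms $F_i=\bigoplus_j S(-i-j)^{\beta_{i,j}(Z)}$; $\beta_{i,j}=0$ for $i<0$. For $q\ge 1$ the $q$-secant variety $S^q(X)$ is the Zariski closure of the union of the spans of all $q$-tuples of linearly independent points of $X$, and $S^0(X)=\emptyset$. For a linear subspace $\Lambda$, $X_\Lambda$ is the closure of the image of $X\setminus\Lambda$ under the linear projection from $\Lambda$, and $\mathbb T_zX$ is the projective tangent space to $X$ at $z$. For a homogeneous ideal $I\subseteq S=k[x_0,\dots,x_r]$ and a point $z\in\mathbb P^r$, choose homogeneous coordinates with $z=(1:0:\cdots:0)$, put $S_z=k[x_1,\dots,x_r]$, and let $K_i(z,I)\subseteq S_z$ be the ideal of the coefficients of $x_0^i$ in those $f\in I$ with $\deg_{x_0}f\le i$. The chain $K_0(z,I)\subseteq K_1(z,I)\subseteq\cdots$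 is eventually constant; $s(z,I)$ is the least index from which it is constant, and $K_\infty(z,I)=K_{s(z,I)}(z,I)$. A subvariety $Z$ has *simple tangent cone* at $z$ if $s(z,I_Z)=1$ and $K_\infty(z,I_Z)$ is prime. For a graded module $M$ over a polynomial ring with space of linear forms $V$, $K_{i,j}(M,V)$ denotes the cohomology of the Koszul complex $\bigwedge^{i+1}V\otimes M_{j-1}\to\bigwedge^iV\otimes M_j\to\bigwedge^{i-1}V\otimes M_{j+1}$ at the middle term. **Theorem.** (a) Let $X\subseteq\mathbb P^r$ be a nondegenerate irreducible reduced projective variety and $q\ge 1$. Then for a general point $z$ of $X$ (that is, for all $z$ in some nonempty Zariski-open subset of $X$ depending only on $X$ and $q$) and all integers $i,j$ the following holds. If $S^q(X)$ has simple tangent cone at $z$, $\beta_{i,j-1}(S^{q-1}(X_{\mathbb T_zX}))=0$, and $\beta_{i-1,j}(S^q(X_z))=\beta_{i,j}(S^q(X_z))=0$, then $\beta_{i,j}(S^q(X))=0$. (b) Let $I\subseteq S=k[x_0,\dots,x_r]$ be a homogeneous ideal with space of linear forms $V=S_1$, let $z\in\mathbb P^r$ be any point with $s(z,I)=1$, and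 let $V_z=(S_z)_1$. For all integers $i,j$: if $K_{i,j-1}(K_\infty(z,I),V_z)=0$ and $K_{i-1,j}(K_0(z,I),V_z)=K_{i,j}(K_0(z,I),V_z)=0$, then $K_{i,j}(I,V)=0$. -/

import Mathlib

open scoped LinearAlgebra.Projectivization

namespace SecantBetti

noncomputable section

/-! ### Projective space, the Zariski topology and homogeneous ideals

`ℙ k (Fin n → k)` is the projective space of lines in `k ^ n`; it has dimension `n - 1`. -/

/-- The common zeros in projective space of a set of homogeneous polynomials. -/
def projZeroLocus {k : Type*} [Field k] {n : ℕ} (F : Set (MvPolynomial (Fin n) k)) :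
    Set (ℙ k (Fin n → k)) :=
  {p | ∀ f ∈ F, MvPolynomial.eval p.rep f = 0}

/-- The Zariski topology: the closed sets are the common zeros of sets of homogeneous
polynomials. -/
instance zariskiTopology {k : Type*} [Field k] {n : ℕ} : TopologicalSpace (ℙ k (Fin n → k)) :=
  TopologicalSpace.ofClosed
    {Z | ∃ F : Set (MvPolynomial (Fin n) k),
      (∀ f ∈ F, ∃ d : ℕ, f.IsHomogeneous d) ∧ Z = projZeroLocus F}
    ⟨{1}, by
      rintro f rfl
      exact ⟨0, MvPolynomial.isHomogeneous_one _ _⟩, by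
      ext p
      simp [projZeroLocus]⟩
    (by
      intro A hA
      refine ⟨{f | (∃ d : ℕ, f.IsHomogeneous d) ∧
        ∃ Z ∈ A, ∀ p ∈ Z, MvPolynomial.eval p.rep f = 0}, fun f hf => hf.1, ?_⟩
      ext p
      constructor
      · rintro hp f ⟨-, Z, hZ, hf⟩
        exact hf p (hp Z hZ)
      · intro hp Z hZ
        obtain ⟨F, hF, rfl⟩ := hA hZ
        intro f hf
        exact hp f ⟨hF f hf, _, hZ, fun p' hp' => hp' f hf⟩)
    (by
      rintro _ ⟨F, hF, rfl⟩ _ ⟨G, hG, rfl⟩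
      refine ⟨{h | ∃ f ∈ F, ∃ g ∈ G, h = f * g}, ?_, ?_⟩
      · rintro _ ⟨f, hf, g, hg, rfl⟩
        obtain ⟨d, hd⟩ := hF f hf
        obtain ⟨e, he⟩ := hG g hg
        exact ⟨d + e, hd.mul he⟩
      · ext p
        constructor
        · rintro (hp | hp) _ ⟨f, hf, g, hg, rfl⟩
          · simp [hp f hf]
          · simp [hp g hg]
        · intro hp
          by_contra hcon
          simp only [Set.mem_union, not_or, projZeroLocus, Set.mem_ofPred_eq, not_forall] at hcon
          obtain ⟨⟨f, hf, hf'⟩, g, hg, hg'⟩ := hcon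
          have := hp (f * g) ⟨f, hf, g, hg, rfl⟩
          rw [map_mul] at this
          exact (mul_ne_zero hf' hg') this)

/-- The affine cone over a set of points of projective space; it contains the origin. -/
def affineCone {k : Type*} [Field k] {n : ℕ} (Z : Set (ℙ k (Fin n → k))) : Set (Fin n → k) :=
  {w | ∀ hw : w ≠ 0, Projectivization.mk k w hw ∈ Z}

/-- The homogeneous ideal `I_Z` of `Z`: the polynomials vanishing on the affine cone over `Z`.
For `Z = ∅` this is the irrelevant ideal. -/
def homogeneousIdeal {k : Type*} [Field k] {n : ℕ} (Z : Set (ℙ k (Fin n → k))) :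
    Ideal (MvPolynomial (Fin n) k) :=
  MvPolynomial.vanishingIdeal k (affineCone Z)

/-- `Z` is not contained in any hyperplane. -/
def IsNondegenerate {k : Type*} [Field k] {n : ℕ} (Z : Set (ℙ k (Fin n → k))) : Prop :=
  ⨆ p ∈ Z, p.submodule = ⊤

/-- The `q`-secant variety `S^q(X)`: the closure of the union of the spans of `q` linearly
independent points of `X`. For `q = 0` it is empty. -/
def secantVariety {k : Type*} [Field k] {n : ℕ} (q : ℕ) (X : Set (ℙ k (Fin n → k))) :
    Set (ℙ k (Fin n → k)) :=
  closure {p | ∃ z : Fin q → ℙ k (Fin n → k), (∀ a, z a ∈ X) ∧ Projectivization.Independent z ∧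
    p.submodule ≤ ⨆ a, (z a).submodule}

/-- The linear subspace of `k ^ n` whose projectivization is the projective tangent space
`𝕋_z X`. -/
def tangentSpace {k : Type*} [Field k] {n : ℕ} (X : Set (ℙ k (Fin n → k)))
    (z : ℙ k (Fin n → k)) : Submodule k (Fin n → k) where
  carrier := {w | ∀ f ∈ homogeneousIdeal X,
    ∑ a, MvPolynomial.eval z.rep (MvPolynomial.pderiv a f) * w a = 0}
  zero_mem' := by
    intro f _
    simp
  add_mem' := by
    intro v w hv hw f hf
    simp only [Pi.add_apply, mul_add, Finset.sum_add_distrib, hv f hf, hw f hf, add_zero]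
  smul_mem' := by
    intro c w hw f hf
    have h : ∀ a, MvPolynomial.eval z.rep (MvPolynomial.pderiv a f) * (c • w) a =
        c * (MvPolynomial.eval z.rep (MvPolynomial.pderiv a f) * w a) := by
      intro a
      simp only [Pi.smul_apply, smul_eq_mul]
      ring
    simp only [h, ← Finset.mul_sum, hw f hf, mul_zero]

/-- `φ : k ^ n → k ^ m` induces the linear projection away from the projectivization of `Λ`,
in some choice of homogeneous coordinates on the target. -/
def IsProjectionFrom {k : Type*} [Field k] {n m : ℕ} (φ : (Fin n → k) →ₗ[k] (Fin m → k))
    (Λ : Submodule k (Fin n → k)) : Prop :=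
  Function.Surjective φ ∧ LinearMap.ker φ = Λ

/-- The projection of `Z`: the closure of the image of the points of `Z` outside the centre. -/
def projectedVariety {k : Type*} [Field k] {n m : ℕ} (φ : (Fin n → k) →ₗ[k] (Fin m → k))
    (Z : Set (ℙ k (Fin n → k))) : Set (ℙ k (Fin m → k)) :=
  closure {p | ∃ z ∈ Z, ∃ h : φ z.rep ≠ 0, p = Projectivization.mk k (φ z.rep) h}

/-! ### Partial elimination ideals and simple tangent cones -/

/-- The linear automorphism `g` of `k ^ (r + 1)`, seen as a change of homogeneous coordinates,
makes `z` the point `(1 : 0 : ⋯ : 0)`. -/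
def IsCoordinateSystemAt {k : Type*} [Field k] {r : ℕ}
    (g : (Fin (r + 1) → k) ≃ₗ[k] (Fin (r + 1) → k)) (z : ℙ k (Fin (r + 1) → k)) : Prop :=
  z.submodule.map (g : (Fin (r + 1) → k) →ₗ[k] (Fin (r + 1) → k)) =
    Submodule.span k {Pi.single 0 1}

/-- The ideal `I` written in the coordinates `y = g x`: the polynomials `f` with
`f(g x) ∈ I`. -/
def inCoordinates {k : Type*} [Field k] {n : ℕ} (g : (Fin n → k) ≃ₗ[k] (Fin n → k))
    (I : Ideal (MvPolynomial (Fin n) k)) : Ideal (MvPolynomial (Fin n) k) :=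
  I.comap (MvPolynomial.aeval (R := k) (fun a =>
    LinearMap.toMvPolynomial (Pi.basisFun k (Fin n)) (Pi.basisFun k (Fin n))
      (g : (Fin n → k) →ₗ[k] (Fin n → k)) a))

/-- The `i`-th partial elimination ideal `K_i(z, I)` at `z = (1 : 0 : ⋯ : 0)`: the coefficients
of `x₀ ^ i` in the elements of `I` of degree at most `i` in `x₀`. -/
def partialElim {k : Type*} [Field k] {r : ℕ} (I : Ideal (MvPolynomial (Fin (r + 1)) k)) (i : ℕ) :
    Ideal (MvPolynomial (Fin r) k) where
  carrier := {c | ∃ f ∈ I, (MvPolynomial.finSuccEquiv k r f).natDegree ≤ i ∧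
    (MvPolynomial.finSuccEquiv k r f).coeff i = c}
  zero_mem' := ⟨0, I.zero_mem, by simp, by simp⟩
  add_mem' := by
    rintro _ _ ⟨f, hf, hd, rfl⟩ ⟨g, hg, he, rfl⟩
    refine ⟨f + g, I.add_mem hf hg, ?_, by simp⟩
    rw [map_add]
    exact Polynomial.natDegree_add_le_of_degree_le hd he
  smul_mem' := by
    rintro c _ ⟨f, hf, hd, rfl⟩
    refine ⟨(MvPolynomial.finSuccEquiv k r).symm (Polynomial.C c) * f, I.mul_mem_left _ hf, ?_, ?_⟩
    · rw [map_mul, AlgEquiv.apply_symm_apply]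
      exact (Polynomial.natDegree_C_mul_le _ _).trans hd
    · rw [map_mul, AlgEquiv.apply_symm_apply, Polynomial.coeff_C_mul, smul_eq_mul]

/-- The stabilization number `s(z, I)` at `z = (1 : 0 : ⋯ : 0)`: the least index from which on
the ascending chain of partial elimination ideals is constant. -/
def stabilizationNumber {k : Type*} [Field k] {r : ℕ}
    (I : Ideal (MvPolynomial (Fin (r + 1)) k)) : ℕ :=
  sInf {s | ∀ i, s ≤ i → partialElim I i = partialElim I s}

/-- The ideal `K_∞(z, I)` at `z = (1 : 0 : ⋯ : 0)`. -/
def partialElimInfty {k : Type*} [Field k] {r : ℕ}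
    (I : Ideal (MvPolynomial (Fin (r + 1)) k)) : Ideal (MvPolynomial (Fin r) k) :=
  partialElim I (stabilizationNumber I)

/-- `Z` has simple tangent cone at `z`: `s(z, I_Z) = 1` and `K_∞(z, I_Z)` is prime. -/
def HasSimpleTangentCone {k : Type*} [Field k] {r : ℕ} (Z : Set (ℙ k (Fin (r + 1) → k)))
    (z : ℙ k (Fin (r + 1) → k)) : Prop :=
  ∃ g : (Fin (r + 1) → k) ≃ₗ[k] (Fin (r + 1) → k), IsCoordinateSystemAt g z ∧
    stabilizationNumber (inCoordinates g (homogeneousIdeal Z)) = 1 ∧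
    (partialElimInfty (inCoordinates g (homogeneousIdeal Z))).IsPrime

/-! ### Graded modules, minimal free resolutions, Betti numbers, Koszul cohomology -/

/-- The homogeneous polynomials of degree `j : ℤ` (none but `0` for `j < 0`). -/
def homogeneousPart (k : Type*) [Field k] (n : ℕ) : ℤ → Submodule k (MvPolynomial (Fin n) k)
  | Int.ofNat d => MvPolynomial.homogeneousSubmodule (Fin n) k d
  | Int.negSucc _ => ⊥

/-- The grading of the quotient ring `S / I`. -/
def quotientGrading {k : Type*} [Field k] {n : ℕ} (I : Ideal (MvPolynomial (Fin n) k)) (j : ℤ) :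
    Submodule k (MvPolynomial (Fin n) k ⧸ I) :=
  (homogeneousPart k n j).map (Ideal.Quotient.mkₐ k I).toLinearMap

/-- The grading of the ideal `I`. -/
def idealGrading {k : Type*} [Field k] {n : ℕ} (I : Ideal (MvPolynomial (Fin n) k)) (j : ℤ) :
    Submodule k I :=
  (homogeneousPart k n j).comap (I.subtype.restrictScalars k)

/-- A minimal graded free resolution `⋯ → F₁ → F₀ → M → 0` of a graded module `M` over
`S = k[x₁, …, x_n]`. The basis element `a` of `F_i` has degree `deg i a`. -/
structure MinimalFreeResolution {k : Type*} [Field k] {n : ℕ} {M : Type*} [AddCommGroup M]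
    [Module k M] [Module (MvPolynomial (Fin n) k) M] (ℳ : ℤ → Submodule k M) where
  /-- the rank of `F_i` -/
  rank : ℕ → ℕ
  /-- the degrees of the basis elements of `F_i` -/
  deg : (i : ℕ) → Fin (rank i) → ℤ
  /-- the map `F_{i+1} → F_i` -/
  d : (i : ℕ) → (Fin (rank (i + 1)) → MvPolynomial (Fin n) k) →ₗ[MvPolynomial (Fin n) k]
    (Fin (rank i) → MvPolynomial (Fin n) k)
  /-- the augmentation `F₀ → M` -/
  aug : (Fin (rank 0) → MvPolynomial (Fin n) k) →ₗ[MvPolynomial (Fin n) k] M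
  d_graded : ∀ i a b, d i (Pi.single a 1) b ∈ homogeneousPart k n (deg (i + 1) a - deg i b)
  aug_graded : ∀ a, aug (Pi.single a 1) ∈ ℳ (deg 0 a)
  aug_surjective : Function.Surjective aug
  exact_zero : LinearMap.ker aug = LinearMap.range (d 0)
  exact_succ : ∀ i, LinearMap.ker (d i) = LinearMap.range (d (i + 1))
  /-- minimality: the image of `F_{i+1}` lies in `(x₁, …, x_n) F_i` -/
  minimal : ∀ i a b, MvPolynomial.constantCoeff (d i (Pi.single a 1) b) = 0

/-- A minimal free resolution of the homogeneous coordinate ring `S_Z = S / I_Z` of `Z`. -/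
abbrev ResolutionOf {k : Type*} [Field k] {n : ℕ} (Z : Set (ℙ k (Fin n → k))) :=
  MinimalFreeResolution (n := n) (quotientGrading (homogeneousIdeal Z))

/-- The graded Betti number `β_{i,j}`, the number of summands `S(-i-j)` of `F_i`; it does not
depend on the minimal free resolution. It is `0` for `i < 0`. -/
def MinimalFreeResolution.betti {k : Type*} [Field k] {n : ℕ} {M : Type*} [AddCommGroup M]
    [Module k M] [Module (MvPolynomial (Fin n) k) M] {ℳ : ℤ → Submodule k M}
    (F : MinimalFreeResolution (n := n) ℳ) : ℤ → ℤ → ℕ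
  | Int.ofNat i, j => Fintype.card {a : Fin (F.rank i) // F.deg i a = i + j}
  | Int.negSucc _, _ => 0

/-- The Koszul differential `⋀^{i+1} V ⊗ M → ⋀^i V ⊗ M`. Here `V` is the space of linear forms
on `k ^ n`, and `⋀^i V ⊗ M` is the space of alternating `i`-linear maps from `k ^ n` to `M`, with
`v₁ ∧ ⋯ ∧ v_i ⊗ m` the map `(w₁, …, w_i) ↦ det (v_a (w_b)) m`. In these terms the differential
sends `ω` to `∑ a, x_a ω(e_a, ⋯)`. -/
def koszulDifferential (k : Type*) [Field k] (n : ℕ) (M : Type*) [AddCommGroup M]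
    [Module k M] [Module (MvPolynomial (Fin n) k) M] [IsScalarTower k (MvPolynomial (Fin n) k) M]
    (i : ℕ) :
    ((Fin n → k) [⋀^Fin (i + 1)]→ₗ[k] M) →ₗ[k] ((Fin n → k) [⋀^Fin i]→ₗ[k] M) where
  toFun ω := ∑ a, (Algebra.lsmul k k M (MvPolynomial.X a : MvPolynomial (Fin n) k)).compAlternatingMap
    (ω.curryLeft (Pi.single a 1))
  map_add' ω η := by
    rw [← Finset.sum_add_distrib]
    refine Finset.sum_congr rfl fun a _ => ?_
    ext v
    simp
  map_smul' c ω := by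
    rw [RingHom.id_apply, Finset.smul_sum]
    refine Finset.sum_congr rfl fun a _ => ?_
    ext v
    simp only [AlternatingMap.curryLeft_smul, LinearMap.smul_apply, AlternatingMap.smul_apply,
      LinearMap.compAlternatingMap_apply, map_smul]

/-- The space `⋀^i V ⊗ M_j`. -/
def koszulTerm {k : Type*} [Field k] (n : ℕ) {M : Type*} [AddCommGroup M] [Module k M]
    (ℳ : ℤ → Submodule k M) (i : ℕ) (j : ℤ) : Submodule k ((Fin n → k) [⋀^Fin i]→ₗ[k] M) where
  carrier := {ω | ∀ v, ω v ∈ ℳ j}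
  zero_mem' _ := (ℳ j).zero_mem
  add_mem' hω hη v := (ℳ j).add_mem (hω v) (hη v)
  smul_mem' c _ hω v := (ℳ j).smul_mem c (hω v)

/-- The kernel of `⋀^i V ⊗ M_j → ⋀^{i-1} V ⊗ M_{j+1}`. -/
def koszulCycles {k : Type*} [Field k] (n : ℕ) {M : Type*} [AddCommGroup M] [Module k M]
    [Module (MvPolynomial (Fin n) k) M] [IsScalarTower k (MvPolynomial (Fin n) k) M]
    (ℳ : ℤ → Submodule k M) : (i : ℕ) → ℤ → Submodule k ((Fin n → k) [⋀^Fin i]→ₗ[k] M)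
  | 0, j => koszulTerm n ℳ 0 j
  | i + 1, j => koszulTerm n ℳ (i + 1) j ⊓ LinearMap.ker (koszulDifferential k n M i)

/-- The image of `⋀^{i+1} V ⊗ M_{j-1} → ⋀^i V ⊗ M_j`. -/
def koszulBoundaries {k : Type*} [Field k] (n : ℕ) {M : Type*} [AddCommGroup M] [Module k M]
    [Module (MvPolynomial (Fin n) k) M] [IsScalarTower k (MvPolynomial (Fin n) k) M]
    (ℳ : ℤ → Submodule k M) (i : ℕ) (j : ℤ) : Submodule k ((Fin n → k) [⋀^Fin i]→ₗ[k] M) :=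
  (koszulTerm n ℳ (i + 1) (j - 1)).map (koszulDifferential k n M i)

/-- The Koszul cohomology group `K_{i,j}(M, V)`, for `i ≥ 0`. -/
abbrev KoszulCohomology {k : Type*} [Field k] (n : ℕ) {M : Type*} [AddCommGroup M] [Module k M]
    [Module (MvPolynomial (Fin n) k) M] [IsScalarTower k (MvPolynomial (Fin n) k) M]
    (ℳ : ℤ → Submodule k M) (i : ℕ) (j : ℤ) : Type _ :=
  koszulCycles n ℳ i j ⧸ (koszulBoundaries n ℳ i j).comap (koszulCycles n ℳ i j).subtype

/-- `K_{i,j}(I, V) = 0` for an ideal `I`; this always holds for `i < 0`. -/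
def KoszulVanishes {k : Type*} [Field k] {n : ℕ} (I : Ideal (MvPolynomial (Fin n) k)) :
    ℤ → ℤ → Prop
  | Int.ofNat i, j => Subsingleton (KoszulCohomology n (idealGrading I) i j)
  | Int.negSucc _, _ => True

end

end SecantBetti

/-! Algebraic part. Take coordinates with `z = (1:0:...:0)` and write `K₀ = K_0(z,I)`, `K = K_1(z,I)
= K_∞(z,I)`. The ideal `I` contains `K₀[x₀]`, and Koszul cohomology is computed from the sequence `0
→ K₀[x₀] → I → I/K₀[x₀] → 0`. On both ends `x₀` is a nonzerodivisor, so it may be divided out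
together with the variable (`RelVanishes.of_regular`). The left end becomes `K₀` over `S_z`
(`relVanishes_extFam`). Since the chain of partial elimination ideals is constant from index 1,
modulo `x₀ I` every element of `I` has degree at most one in `x₀`; reading off the coefficient of
`x₀` turns the right end into `K/K₀` shifted by one degree (`relVanishes_idealFam_extFam`). The
group `K_{i,j-1}(K/K₀)` lies between `K_{i,j-1}(K)` and `K_{i-1,j}(K₀)`, which gives
`koszulVanishes_of_partialElim`.

From Koszul cohomology to Betti numbers. Free modules are Koszul acyclic in positive exterior
degree. Dimension shifting along a minimal resolution therefore identifies the vanishing of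
`β_{i,j}` with that of `K_{i,j}(S/I)`, and one further shift replaces `S/I` by `I`
(`betti_succ_eq_zero_iff`).

Geometric part. Let `V` be the affine cone over `X` and `W` the set of sums of `q-1` elements of
`V`. Outside extreme values of `q`, the ideal of `S^q(X)` is the ideal of `V + W`. Its `K₀` is the
ideal of `S^q(X_z)` up to coordinates. What remains is to identify the prime ideal `K` with the
ideal of the projection from `z` of `T_zV + W`; this projection is a cylinder over the image of `W`
under projection from `T_zV`, and cylinders do not change the vanishing of Koszul groups
(`koszulVanishes_preimage`).

One inclusion is a statement about tangent cones. At a general point every tangent vector extends to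
a polynomial vector field preserving the ideal of `V`, whose flow is a formal arc; moving along the
arc while adding a multiple of a point of `W` stays in the join, so elements of the partial
elimination ideals vanish in all directions of `T_zV + W` (`exists_partialElim_le`). Equality of the
two primes is a dimension count (`exists_partialElim_eq`). Passing from `S/I` to `S_z/K` lowers the
transcendence degree by at least one, projecting `T_zV + W` from `z` lowers it by at most one, and
`T_zV + W` is at least as large as `V + W`. The last fact is a form of Terracini's lemma, proved
with derivations of the function field of `V × W` (`exists_independent_tangent_join`). -/

namespace SecantBetti
noncomputable section

/-! ### Koszul complexes of families of subspaces -/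

section KoszulPairs

variable {k : Type*} [Field k] {n : ℕ} {E E' : Type*} [AddCommGroup E] [Module k E]
  [AddCommGroup E'] [Module k E']

/-- The Koszul differential attached to a family of operators. -/
def koszulD (X : Fin n → Module.End k E) (i : ℕ) :
    ((Fin n → k) [⋀^Fin (i + 1)]→ₗ[k] E) →ₗ[k] ((Fin n → k) [⋀^Fin i]→ₗ[k] E) where
  toFun ω := ∑ a, (X a).compAlternatingMap (ω.curryLeft (Pi.single a 1))
  map_add' ω η := by
    rw [← Finset.sum_add_distrib]
    refine Finset.sum_congr rfl fun a _ => ?_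
    ext v
    simp
  map_smul' c ω := by
    rw [RingHom.id_apply, Finset.smul_sum]
    refine Finset.sum_congr rfl fun a _ => ?_
    ext v
    simp

lemma koszulD_apply (X : Fin n → Module.End k E) (i : ℕ)
    (ω : (Fin n → k) [⋀^Fin (i + 1)]→ₗ[k] E) (v : Fin i → Fin n → k) :
    koszulD X i ω v = ∑ a, X a (ω (Matrix.vecCons (Pi.single a 1) v)) := by
  let ev : ((Fin n → k) [⋀^Fin i]→ₗ[k] E) →+ E :=
    { toFun := fun η => η v, map_zero' := rfl, map_add' := fun _ _ => rfl }
  exact map_sum ev (fun a => (X a).compAlternatingMap (ω.curryLeft (Pi.single a 1))) Finset.univ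

/-- The boundary of `ω` takes values in `N (j + 1)`; no condition in exterior degree zero. -/
def IsRelCycle (X : Fin n → Module.End k E) (N : ℤ → Submodule k E) :
    (i : ℕ) → ((Fin n → k) [⋀^Fin i]→ₗ[k] E) → ℤ → Prop
  | 0, _, _ => True
  | i + 1, ω, j => koszulD X i ω ∈ koszulTerm n N i (j + 1)

/-- Vanishing of the Koszul cohomology group `K_{i,j}` of the quotient `M / N`. -/
def RelVanishes (X : Fin n → Module.End k E) (M N : ℤ → Submodule k E) (i : ℕ) (j : ℤ) : Prop :=
  ∀ ω ∈ koszulTerm n M i j, IsRelCycle X N i ω j →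
    ∃ η ∈ koszulTerm n M (i + 1) (j - 1), ω - koszulD X i η ∈ koszulTerm n N i j

lemma mem_koszulTerm {M : ℤ → Submodule k E} {i : ℕ} {j : ℤ}
    {ω : (Fin n → k) [⋀^Fin i]→ₗ[k] E} : ω ∈ koszulTerm n M i j ↔ ∀ v, ω v ∈ M j := Iff.rfl

lemma koszulTerm_mono {M N : ℤ → Submodule k E} {i : ℕ} {j : ℤ} (h : M j ≤ N j) :
    koszulTerm n M i j ≤ koszulTerm n N i j := fun _ hω v => h (hω v)

lemma mem_koszulTerm_bot {i : ℕ} {j : ℤ} {ω : (Fin n → k) [⋀^Fin i]→ₗ[k] E} :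
    ω ∈ koszulTerm n (fun _ => (⊥ : Submodule k E)) i j ↔ ω = 0 := by
  rw [mem_koszulTerm]
  constructor
  · intro h
    ext v
    exact (Submodule.mem_bot k).1 (h v)
  · rintro rfl v
    simp

/-- A family of subspaces stable under operators of degree one. -/
def IsStable (X : Fin n → Module.End k E) (M : ℤ → Submodule k E) : Prop :=
  ∀ a j, ∀ m ∈ M j, X a m ∈ M (j + 1)

lemma IsStable.koszulD_mem {X : Fin n → Module.End k E} {M : ℤ → Submodule k E}
    (hM : IsStable X M) {i : ℕ} {j j' : ℤ} (hj : j' = j + 1)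
    {ω : (Fin n → k) [⋀^Fin (i + 1)]→ₗ[k] E} (hω : ω ∈ koszulTerm n M (i + 1) j) :
    koszulD X i ω ∈ koszulTerm n M i j' := by
  subst hj
  intro v
  rw [koszulD_apply]
  exact Submodule.sum_mem _ fun a _ => hM a j _ (hω _)

lemma isStable_bot (X : Fin n → Module.End k E) : IsStable X (fun _ => ⊥) := by
  intro a j m hm
  simp_all

/-- An alternating map with values in the image of a subspace lifts to the subspace. -/
lemma exists_alternating_lift (θ : E →ₗ[k] E') (P : Submodule k E) {i : ℕ}
    (ω : (Fin n → k) [⋀^Fin i]→ₗ[k] E') (hω : ∀ v, ω v ∈ P.map θ) :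
    ∃ η : (Fin n → k) [⋀^Fin i]→ₗ[k] E, (∀ v, η v ∈ P) ∧ θ.compAlternatingMap η = ω := by
  let θP : P →ₗ[k] P.map θ := (θ.domRestrict P).codRestrict (P.map θ)
    fun p => Submodule.mem_map_of_mem p.2
  have hs : LinearMap.range θP = ⊤ := by
    rw [LinearMap.range_eq_top]
    rintro ⟨_, p, hp, rfl⟩
    exact ⟨⟨p, hp⟩, rfl⟩
  -- Over a field the surjection from `P` to its image has a linear section, and composing an
  -- alternating form with a linear map keeps it alternating.
  obtain ⟨σ, hσ⟩ := θP.exists_rightInverse_of_surjective hs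
  refine ⟨(P.subtype ∘ₗ σ).compAlternatingMap (ω.codRestrict (P.map θ) hω), fun v => ?_, ?_⟩
  · simp
  · ext v
    have := congrArg Subtype.val (LinearMap.congr_fun hσ ⟨ω v, hω v⟩)
    exact this

lemma exists_alternating_split (θ : E →ₗ[k] E') (P : Submodule k E) (N : Submodule k E') {i : ℕ}
    (ω : (Fin n → k) [⋀^Fin i]→ₗ[k] E') (hω : ∀ v, ω v ∈ P.map θ ⊔ N) :
    ∃ (γ : (Fin n → k) [⋀^Fin i]→ₗ[k] E) (ν : (Fin n → k) [⋀^Fin i]→ₗ[k] E'),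
      (∀ v, γ v ∈ P) ∧ (∀ v, ν v ∈ N) ∧ ω = θ.compAlternatingMap γ + ν := by
  obtain ⟨η, hη, hη'⟩ := exists_alternating_lift (LinearMap.coprod θ LinearMap.id) (P.prod N) ω
    (by simpa [LinearMap.map_coprod_prod] using hω)
  refine ⟨(LinearMap.fst k E E').compAlternatingMap η, (LinearMap.snd k E E').compAlternatingMap η,
    fun v => (hη v).1, fun v => (hη v).2, ?_⟩
  rw [← hη']
  ext v
  simp

lemma koszulD_comp {X : Fin n → Module.End k E} {X' : Fin n → Module.End k E'} (θ : E →ₗ[k] E')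
    (hθ : ∀ a m, θ (X a m) = X' a (θ m)) {i : ℕ} (ω : (Fin n → k) [⋀^Fin (i + 1)]→ₗ[k] E) :
    koszulD X' i (θ.compAlternatingMap ω) = θ.compAlternatingMap (koszulD X i ω) := by
  ext v
  simp [koszulD_apply, hθ]

/-- The operators commute while the two inserted basis vectors anticommute, so the double sum equals
its own negative. Dividing by two is the use of characteristic zero. -/
lemma koszulD_koszulD [CharZero k] {X : Fin n → Module.End k E} (hX : ∀ a b m, X a (X b m) = X b (X a m))
    {i : ℕ} (ω : (Fin n → k) [⋀^Fin (i + 2)]→ₗ[k] E) : koszulD X i (koszulD X (i + 1) ω) = 0 := by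
  ext v
  simp only [koszulD_apply, map_sum, AlternatingMap.zero_apply]
  have key : ∀ a b, X a (X b (ω (Matrix.vecCons (Pi.single b 1) (Matrix.vecCons (Pi.single a 1) v))))
      = - X b (X a (ω (Matrix.vecCons (Pi.single a 1) (Matrix.vecCons (Pi.single b 1) v)))) := by
    intro a b
    rw [hX a b, ← map_neg, ← map_neg]
    congr 2
    rw [← ω.map_swap _ (show (0 : Fin (i + 2)) ≠ 1 by simp)]
    congr 1
    ext c d
    refine Fin.cases ?_ (fun c => ?_) c
    · simp
    · refine Fin.cases ?_ (fun c => ?_) c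
      · simp
      · simp [Equiv.swap_apply_of_ne_of_ne, Fin.ext_iff]
  have hS := calc
    ∑ a, ∑ b, X a (X b (ω (Matrix.vecCons (Pi.single b 1) (Matrix.vecCons (Pi.single a 1) v))))
      = ∑ a, ∑ b, - X b (X a (ω (Matrix.vecCons (Pi.single a 1)
          (Matrix.vecCons (Pi.single b 1) v)))) :=
        Finset.sum_congr rfl fun a _ => Finset.sum_congr rfl fun b _ => key a b
    _ = - ∑ b, ∑ a, X b (X a (ω (Matrix.vecCons (Pi.single a 1)
          (Matrix.vecCons (Pi.single b 1) v)))) := by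
        simp only [Finset.sum_neg_distrib]
        rw [Finset.sum_comm]
  rw [← add_eq_zero_iff_eq_neg, ← two_smul k] at hS
  exact (smul_eq_zero.1 hS).resolve_left two_ne_zero

/-! Long exact sequences -/

/-- Exactness of `H(N) → H(M) → H(M/N)` in the middle: a boundary moves the cycle into `N`, where
what is left is again a cycle and bounds. -/
lemma RelVanishes.of_sub_of_quotient [CharZero k] {X : Fin n → Module.End k E}
    (hX : ∀ a b m, X a (X b m) = X b (X a m)) {M N : ℤ → Submodule k E} {i : ℕ} {j : ℤ}
    (hNM : ∀ j, N j ≤ M j) (hN : RelVanishes X N (fun _ => ⊥) i j) (hMN : RelVanishes X M N i j) :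
    RelVanishes X M (fun _ => ⊥) i j := by
  intro ω hω hc
  obtain ⟨η, hη, hη'⟩ := hMN ω hω (by
    cases i with
    | zero => trivial
    | succ i => exact koszulTerm_mono bot_le hc)
  obtain ⟨ζ, hζ, hζ'⟩ := hN _ hη' (by
    cases i with
    | zero => trivial
    | succ i =>
      change _ ∈ koszulTerm _ _ _ _
      rw [map_sub, koszulD_koszulD hX, sub_zero]
      exact hc)
  refine ⟨η + ζ, Submodule.add_mem _ hη (koszulTerm_mono (hNM _) hζ), ?_⟩
  rwa [map_add, ← sub_sub]

/-- Exactness of `H_{i+1}(M) → H_{i+1}(M/N) → H_i(N)`: the boundary of a relative cycle is a cycle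
of `N`, hence the boundary of some `ν` with values in `N`, and subtracting `ν` produces an honest
cycle of `M`. -/
lemma RelVanishes.quotient [CharZero k] {X : Fin n → Module.End k E}
    (hX : ∀ a b m, X a (X b m) = X b (X a m)) {M N : ℤ → Submodule k E} {i : ℕ} {j : ℤ}
    (hNM : ∀ j, N j ≤ M j) (hM : RelVanishes X M (fun _ => ⊥) (i + 1) j)
    (hN : RelVanishes X N (fun _ => ⊥) i (j + 1)) : RelVanishes X M N (i + 1) j := by
  intro ω hω hc
  obtain ⟨ν, hν, hν'⟩ := hN _ hc (by
    cases i with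
    | zero => trivial
    | succ i => exact mem_koszulTerm_bot.2 (koszulD_koszulD hX ω))
  rw [mem_koszulTerm_bot, ← map_sub] at hν'
  rw [add_sub_cancel_right] at hν
  obtain ⟨η, hη, hη'⟩ := hM (ω - ν) (Submodule.sub_mem _ hω (koszulTerm_mono (hNM _) hν))
    (mem_koszulTerm_bot.2 hν')
  refine ⟨η, hη, ?_⟩
  rw [mem_koszulTerm_bot, sub_right_comm, sub_eq_zero] at hη'
  rwa [hη']

/-- In exterior degree zero there is no cycle condition, so the zeroth group is right exact and no
connecting map intervenes. -/
lemma RelVanishes.quotient_zero {X : Fin n → Module.End k E}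
    {M N : ℤ → Submodule k E} {j : ℤ} (hM : RelVanishes X M (fun _ => ⊥) 0 j) :
    RelVanishes X M N 0 j := by
  intro ω hω _
  obtain ⟨η, hη, hη'⟩ := hM ω hω trivial
  exact ⟨η, hη, koszulTerm_mono bot_le hη'⟩

/-- Dimension shifting: in `0 → Z → F → F / Z → 0` the connecting map is surjective as soon as the
cycles of `Z` are boundaries in `F`. -/
lemma RelVanishes.sub [CharZero k] {X : Fin n → Module.End k E}
    (hX : ∀ a b m, X a (X b m) = X b (X a m)) {F Z : ℤ → Submodule k E} {i : ℕ} {j : ℤ}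
    (hF : ∀ ζ ∈ koszulTerm n Z i (j + 1), IsRelCycle X (fun _ => ⊥) i ζ (j + 1) →
      ∃ ω ∈ koszulTerm n F (i + 1) j, koszulD X i ω = ζ)
    (h : RelVanishes X F Z (i + 1) j) : RelVanishes X Z (fun _ => ⊥) i (j + 1) := by
  intro ζ hζ hc
  obtain ⟨ω, hω, rfl⟩ := hF ζ hζ hc
  obtain ⟨η, hη, hη'⟩ := h ω hω hζ
  refine ⟨_, by rwa [add_sub_cancel_right], ?_⟩
  rw [mem_koszulTerm_bot, ← map_sub, sub_sub_cancel, koszulD_koszulD hX]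

/-! Transport -/

/-- The hypotheses say that `θ` identifies `M/N` with the image of `M'` modulo `N'`. Injectivity of
`θ` is not required, so maps such as reading off one coefficient are allowed; primitives are lifted
by sections of vector spaces. -/
lemma RelVanishes.of_map {X : Fin n → Module.End k E} {X' : Fin n → Module.End k E'}
    (θ : E →ₗ[k] E') (hθ : ∀ a m, θ (X a m) = X' a (θ m)) {M N : ℤ → Submodule k E}
    {M' N' : ℤ → Submodule k E'} (hM : IsStable X M) (hMM' : ∀ j, (M j).map θ = M' j)
    (hNN' : ∀ j, ∀ m ∈ M j, θ m ∈ N' j ↔ m ∈ N j) (hNM : ∀ j, N j ≤ M j) {i : ℕ} {j : ℤ}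
    (h : RelVanishes X' M' N' i j) : RelVanishes X M N i j := by
  intro ω hω hc
  obtain ⟨η', hη', hη''⟩ := h (θ.compAlternatingMap ω)
    (fun v => hMM' j ▸ Submodule.mem_map_of_mem (hω v)) (by
      cases i with
      | zero => trivial
      | succ i =>
        intro v
        rw [koszulD_comp θ hθ]
        exact (hNN' _ _ (hNM _ (hc v))).2 (hc v))
  obtain ⟨η, hη, rfl⟩ := exists_alternating_lift θ (M (j - 1)) η' (fun v => hMM' _ ▸ hη' v)
  refine ⟨η, hη, fun v => ?_⟩
  refine (hNN' _ _ (Submodule.sub_mem _ (hω v) (hM.koszulD_mem (by ring) hη v))).1 ?_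
  have := hη'' v
  rw [koszulD_comp θ hθ] at this
  simpa using this

lemma RelVanishes.map {X : Fin n → Module.End k E} {X' : Fin n → Module.End k E'}
    (θ : E →ₗ[k] E') (hθ : ∀ a m, θ (X a m) = X' a (θ m)) {M N : ℤ → Submodule k E}
    {M' N' : ℤ → Submodule k E'} (hM : IsStable X M) (hMM' : ∀ j, (M j).map θ = M' j)
    (hNN' : ∀ j, ∀ m ∈ M j, θ m ∈ N' j ↔ m ∈ N j) {i : ℕ} {j : ℤ}
    (h : RelVanishes X M N i j) : RelVanishes X' M' N' i j := by
  intro ω' hω' hc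
  obtain ⟨ω, hω, rfl⟩ := exists_alternating_lift θ (M j) ω' (fun v => hMM' _ ▸ hω' v)
  obtain ⟨η, hη, hη'⟩ := h ω hω (by
      cases i with
      | zero => trivial
      | succ i =>
        intro v
        have := hc v
        rw [koszulD_comp θ hθ] at this
        exact (hNN' _ _ (hM.koszulD_mem rfl hω v)).1 this)
  refine ⟨θ.compAlternatingMap η, fun v => hMM' _ ▸ Submodule.mem_map_of_mem (hη v), fun v => ?_⟩
  have := (hNN' _ _ (Submodule.sub_mem _ (hω v) (hM.koszulD_mem (by ring) hη v))).2 (hη' v)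
  rw [koszulD_comp θ hθ]
  simpa using this

/-! Adding a variable -/

/-- The inclusion of the hyperplane `x₀ = 0`. -/
def consZero (k : Type*) [Field k] (n : ℕ) : (Fin n → k) →ₗ[k] (Fin (n + 1) → k) :=
  LinearMap.pi fun a => Fin.cases 0 (fun b => LinearMap.proj b) a

/-- The projection forgetting `x₀`. -/
def dropZero (k : Type*) [Field k] (n : ℕ) : (Fin (n + 1) → k) →ₗ[k] (Fin n → k) :=
  LinearMap.funLeft k k Fin.succ

@[simp] lemma consZero_zero (w : Fin n → k) : consZero k n w 0 = 0 := by simp [consZero]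

@[simp] lemma consZero_succ (w : Fin n → k) (a : Fin n) : consZero k n w a.succ = w a := by
  simp [consZero]

@[simp] lemma dropZero_apply (w : Fin (n + 1) → k) (a : Fin n) : dropZero k n w a = w a.succ := rfl

@[simp] lemma dropZero_consZero (w : Fin n → k) : dropZero k n (consZero k n w) = w := by
  ext a; simp

@[simp] lemma dropZero_single_zero : dropZero k n (Pi.single 0 1) = 0 := by
  ext a; simp

@[simp] lemma consZero_single (a : Fin n) :
    consZero k n (Pi.single a 1) = Pi.single a.succ 1 := by
  ext b
  refine Fin.cases ?_ (fun b => ?_) b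
  · simp
  · simp [Pi.single_apply]

/-- Uniqueness in the splitting `ω = ω' + x₀ ∧ ω''`. On a tuple of distinct basis vectors either
`e₀` does not occur, and `ω'` decides, or a transposition brings it to the front, and `ω''` decides.
-/
lemma alternating_ext_consZero {i : ℕ} {ω₁ ω₂ : (Fin (n + 1) → k) [⋀^Fin (i + 1)]→ₗ[k] E}
    (h : ω₁.compLinearMap (consZero k n) = ω₂.compLinearMap (consZero k n))
    (h' : (ω₁.curryLeft (Pi.single 0 1)).compLinearMap (consZero k n) =
      (ω₂.curryLeft (Pi.single 0 1)).compLinearMap (consZero k n)) : ω₁ = ω₂ := by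
  refine Module.Basis.ext_alternating (Pi.basisFun k (Fin (n + 1))) fun v hv => ?_
  simp only [Pi.basisFun_apply]
  by_cases hl : ∃ l, v l = 0
  · obtain ⟨l, hl⟩ := hl
    have hne : ∀ m : Fin i, v (Equiv.swap 0 l m.succ) ≠ 0 := by
      intro m hm
      have := hv (hm.trans hl.symm)
      rw [Equiv.swap_apply_eq_iff, Equiv.swap_apply_right] at this
      exact Fin.succ_ne_zero _ this
    choose u hu using fun m => Fin.exists_succ_eq.2 (hne m)
    have hcons : (fun m => (Pi.single (v m) 1 : Fin (n + 1) → k)) ∘ Equiv.swap 0 l =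
        Matrix.vecCons (Pi.single 0 1) (fun m => consZero k n (Pi.single (u m) 1)) := by
      funext m
      refine Fin.cases ?_ (fun m => ?_) m
      · simp [hl]
      · simp [hu]
    have e : ∀ ω : (Fin (n + 1) → k) [⋀^Fin (i + 1)]→ₗ[k] E,
        ω (fun m => (Pi.single (v m) 1 : Fin (n + 1) → k)) = (Equiv.Perm.sign (Equiv.swap 0 l)) •
          ((ω.curryLeft (Pi.single 0 1)).compLinearMap (consZero k n))
            (fun m => Pi.single (u m) 1) := by
      intro ω
      have h1 : ((ω.curryLeft (Pi.single 0 1)).compLinearMap (consZero k n))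
            (fun m => Pi.single (u m) 1) =
          ω ((fun m => (Pi.single (v m) 1 : Fin (n + 1) → k)) ∘ Equiv.swap 0 l) := by
        rw [hcons]; rfl
      rw [h1, AlternatingMap.map_perm, smul_smul, Int.units_mul_self, one_smul]
    rw [e, e, h']
  · push Not at hl
    choose u hu using fun m => Fin.exists_succ_eq.2 (hl m)
    have := AlternatingMap.congr_fun h (fun m => Pi.single (u m) 1)
    simpa [hu] using this

/-- With `ω = ω' + x₀ ∧ ω''`, the hyperplane part of `dω` is `dω' + X₀ ω''`: the second term is the
summand of index zero. -/
lemma koszulD_compLinearMap_consZero (X : Fin (n + 1) → Module.End k E) {i : ℕ}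
    (ω : (Fin (n + 1) → k) [⋀^Fin (i + 1)]→ₗ[k] E) :
    (koszulD X i ω).compLinearMap (consZero k n) =
      koszulD (fun a => X a.succ) i (ω.compLinearMap (consZero k n)) +
      (X 0).compAlternatingMap ((ω.curryLeft (Pi.single 0 1)).compLinearMap (consZero k n)) := by
  ext v
  simp only [AlternatingMap.compLinearMap_apply, koszulD_apply, Fin.sum_univ_succ,
    AlternatingMap.add_apply, LinearMap.compAlternatingMap_apply,
    AlternatingMap.curryLeft_apply_apply]
  rw [add_comm]
  congr 1
  refine Finset.sum_congr rfl fun a _ => ?_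
  congr 2
  funext m
  refine Fin.cases ?_ (fun m => ?_) m <;> simp

/-- The form `x₀ ∧ γ`. -/
def wedgeZero {i : ℕ} (γ : (Fin n → k) [⋀^Fin i]→ₗ[k] E) :
    (Fin (n + 1) → k) [⋀^Fin (i + 1)]→ₗ[k] E :=
  AlternatingMap.alternatizeUncurryFin
    (LinearMap.toSpanSingleton k _ (γ.compLinearMap (dropZero k n)) ∘ₗ LinearMap.proj 0)

lemma wedgeZero_apply {i : ℕ} (γ : (Fin n → k) [⋀^Fin i]→ₗ[k] E) (v : Fin (i + 1) → _) :
    wedgeZero γ v = ∑ l : Fin (i + 1), (-1) ^ l.val • v l 0 •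
      γ (fun m => dropZero k n (l.removeNth v m)) := by
  simp [wedgeZero, AlternatingMap.alternatizeUncurryFin_apply]

lemma wedgeZero_mem {i : ℕ} {γ : (Fin n → k) [⋀^Fin i]→ₗ[k] E} {P : Submodule k E}
    (h : ∀ v, γ v ∈ P) (v) : wedgeZero γ v ∈ P := by
  rw [wedgeZero_apply]
  exact Submodule.sum_mem _ fun l _ => zsmul_mem (P.smul_mem _ (h _)) _

@[simp] lemma wedgeZero_compLinearMap_consZero {i : ℕ} (γ : (Fin n → k) [⋀^Fin i]→ₗ[k] E) :
    (wedgeZero γ).compLinearMap (consZero k n) = 0 := by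
  ext v
  simp [wedgeZero_apply]

@[simp] lemma curryLeft_wedgeZero_compLinearMap_consZero {i : ℕ}
    (γ : (Fin n → k) [⋀^Fin i]→ₗ[k] E) :
    ((wedgeZero γ).curryLeft (Pi.single 0 1)).compLinearMap (consZero k n) = γ := by
  ext v
  simp [wedgeZero_apply, Fin.sum_univ_succ, Fin.removeNth]

/-- If `x₀` is a nonzerodivisor on `M / N`, then vanishing for `M / (x₀ M + N)` over the remaining
variables implies vanishing for `M / N`. -/
lemma RelVanishes.of_regular [CharZero k] {X : Fin (n + 1) → Module.End k E}
    (hX : ∀ a b m, X a (X b m) = X b (X a m)) {M N : ℤ → Submodule k E} (hM : IsStable X M)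
    (hN : IsStable X N)
    (hreg : ∀ j, ∀ m ∈ M j, X 0 m ∈ N (j + 1) → m ∈ N j) {i : ℕ} {j : ℤ}
    (h : RelVanishes (fun a => X a.succ) M (fun j => (M (j - 1)).map (X 0) ⊔ N j) i j) :
    RelVanishes X M N i j := by
  intro ω hω hc
  have hMz : IsStable (fun a : Fin n => X a.succ) M := fun a => hM a.succ
  have hNz : IsStable (fun a : Fin n => X a.succ) N := fun a => hN a.succ
  obtain ⟨η, hη, hη'⟩ := h (ω.compLinearMap (consZero k n)) (fun v => hω _) (by
    cases i with
    | zero => trivial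
    | succ i =>
      intro v
      have h1 := AlternatingMap.congr_fun (koszulD_compLinearMap_consZero X ω) v
      rw [AlternatingMap.add_apply, ← sub_eq_iff_eq_add] at h1
      rw [← h1]
      refine Submodule.sub_mem _ (Submodule.mem_sup_right (hc _)) (Submodule.mem_sup_left ?_)
      exact Submodule.mem_map_of_mem (by simpa using hω _))
  -- On the hyperplane `ω` is now `dη + X₀ γ + ν`. The form `η + x₀ ∧ γ` is built so that
  -- subtracting its differential from `ω` leaves exactly `ν` there.
  obtain ⟨γ, ν, hγ, hν, hsplit⟩ := exists_alternating_split (X 0) (M (j - 1)) (N j) _ hη'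
  refine ⟨η.compLinearMap (dropZero k n) + wedgeZero γ,
    Submodule.add_mem _ (fun v => hη _) (wedgeZero_mem hγ), ?_⟩
  set ζ := η.compLinearMap (dropZero k n) + wedgeZero γ with hζ
  have hζ1 : ζ.compLinearMap (consZero k n) = η := by
    rw [hζ, AlternatingMap.add_compLinearMap, wedgeZero_compLinearMap_consZero, add_zero]
    ext v
    simp
  have hζ2 : (ζ.curryLeft (Pi.single 0 1)).compLinearMap (consZero k n) = γ := by
    rw [hζ, AlternatingMap.curryLeft_add, LinearMap.add_apply, AlternatingMap.add_compLinearMap,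
      curryLeft_wedgeZero_compLinearMap_consZero]
    convert! zero_add γ
    ext v
    simp only [AlternatingMap.compLinearMap_apply, AlternatingMap.curryLeft_apply_apply,
      AlternatingMap.zero_apply]
    exact η.map_coord_zero 0 (by simp)
  have hν' : (ω - koszulD X i ζ).compLinearMap (consZero k n) = ν := by
    rw [sub_eq_add_neg, AlternatingMap.add_compLinearMap]
    change _ + -((koszulD X i ζ).compLinearMap (consZero k n)) = _
    rw [koszulD_compLinearMap_consZero, hζ1, hζ2, ← sub_eq_add_neg, ← sub_sub,
      hsplit, add_sub_cancel_left]
  have hζM : ζ ∈ koszulTerm (n + 1) M (i + 1) (j - 1) :=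
    Submodule.add_mem _ (fun v => hη _) (wedgeZero_mem hγ)
  have hτM := Submodule.sub_mem _ hω (hM.koszulD_mem (by ring) hζM)
  cases i with
  | zero =>
    intro v
    have := hν 0
    rw [← hν', AlternatingMap.compLinearMap_apply] at this
    convert! this
  | succ i =>
    have hdτ : koszulD X i (ω - koszulD X (i + 1) ζ) = koszulD X i ω := by
      rw [map_sub, koszulD_koszulD hX, sub_zero]
    set τ := ω - koszulD X (i + 1) ζ
    set β := (τ.curryLeft (Pi.single 0 1)).compLinearMap (consZero k n) with hβ
    -- The remaining `e₀`-component is controlled by regularity: `X₀ β` is the hyperplane part of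
    -- `dτ` minus `dν`, both with values in `N`, and `X₀` can be cancelled.
    have hβN : ∀ v, β v ∈ N j := by
      intro v
      refine hreg j _ (hτM _) ?_
      have h1 := AlternatingMap.congr_fun (koszulD_compLinearMap_consZero X τ) v
      rw [AlternatingMap.add_apply, ← sub_eq_iff_eq_add', hν', hdτ] at h1
      change (X 0).compAlternatingMap β v ∈ _
      rw [← h1]
      exact Submodule.sub_mem _ (hc _) (hNz.koszulD_mem rfl hν v)
    have hτ : τ = ν.compLinearMap (dropZero k n) + wedgeZero β := by
      refine alternating_ext_consZero ?_ ?_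
      · rw [hν', AlternatingMap.add_compLinearMap, wedgeZero_compLinearMap_consZero, add_zero]
        ext v
        simp
      · rw [← hβ, AlternatingMap.curryLeft_add, LinearMap.add_apply,
          AlternatingMap.add_compLinearMap, curryLeft_wedgeZero_compLinearMap_consZero]
        convert! (zero_add β).symm
        ext v
        simp only [AlternatingMap.compLinearMap_apply, AlternatingMap.curryLeft_apply_apply,
          AlternatingMap.zero_apply]
        exact ν.map_coord_zero 0 (by simp)
    rw [hτ]
    exact Submodule.add_mem _ (fun v => hν _) (wedgeZero_mem hβN)

end KoszulPairs
end
end SecantBetti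

namespace SecantBetti
noncomputable section

/-! ### Koszul cohomology of ideals -/

section KoszulIdeals

variable {k : Type*} [Field k] {n : ℕ}

/-- Multiplication by the variables. -/
def varOp (k : Type*) [Field k] (n : ℕ) (M : Type*) [AddCommGroup M] [Module k M]
    [Module (MvPolynomial (Fin n) k) M] [IsScalarTower k (MvPolynomial (Fin n) k) M] (a : Fin n) :
    Module.End k M :=
  Algebra.lsmul k k M (MvPolynomial.X a : MvPolynomial (Fin n) k)

section

variable {M : Type*} [AddCommGroup M] [Module k M]
    [Module (MvPolynomial (Fin n) k) M] [IsScalarTower k (MvPolynomial (Fin n) k) M]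

@[simp] lemma varOp_apply (a : Fin n) (m : M) :
    varOp k n M a m = (MvPolynomial.X a : MvPolynomial (Fin n) k) • m := rfl

lemma varOp_comm (a b : Fin n) (m : M) :
    varOp k n M a (varOp k n M b m) = varOp k n M b (varOp k n M a m) := by
  simp only [varOp_apply, smul_smul, mul_comm]

lemma koszulDifferential_eq (i : ℕ) : koszulDifferential k n M i = koszulD (varOp k n M) i := rfl

lemma subsingleton_koszulCohomology_iff (ℳ : ℤ → Submodule k M) (i : ℕ) (j : ℤ) :
    Subsingleton (KoszulCohomology n ℳ i j) ↔
      RelVanishes (varOp k n M) ℳ (fun _ => ⊥) i j := by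
  rw [Submodule.Quotient.subsingleton_iff, Submodule.comap_subtype_eq_top]
  have hb : ∀ ω : (Fin n → k) [⋀^Fin i]→ₗ[k] M, ω ∈ koszulBoundaries n ℳ i j ↔ ∃ η ∈ koszulTerm n ℳ (i + 1) (j - 1),
      ω - koszulD (varOp k n M) i η ∈ koszulTerm n (fun _ => (⊥ : Submodule k M)) i j := by
    intro ω
    simp only [mem_koszulTerm_bot, koszulBoundaries, Submodule.mem_map, koszulDifferential_eq,
      sub_eq_zero]
    exact exists_congr fun _ => and_congr_right fun _ => eq_comm
  constructor
  · intro h ω hω hc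
    refine (hb ω).1 (h ?_)
    cases i with
    | zero => exact hω
    | succ i => exact ⟨hω, mem_koszulTerm_bot.1 hc⟩
  · intro h ω hω
    refine (hb ω).2 ?_
    cases i with
    | zero => exact h ω hω trivial
    | succ i => exact h ω hω.1 (mem_koszulTerm_bot.2 hω.2)

end

/-! ### Integer degrees, homogeneous components and graded pieces of ideals. -/

lemma mem_homogeneousPart {j : ℤ} {f : MvPolynomial (Fin n) k} :
    f ∈ homogeneousPart k n j ↔ ∀ m, f.coeff m ≠ 0 → (m.degree : ℤ) = j := by
  cases j with
  | ofNat d =>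
    change f ∈ MvPolynomial.homogeneousSubmodule (Fin n) k d ↔ _
    rw [MvPolynomial.mem_homogeneousSubmodule]
    constructor
    · intro h m hm
      by_contra hd
      exact hm (h.coeff_eq_zero fun h' => hd (by rw [h']; rfl))
    · intro h m hm
      have := h m hm
      have h2 : m.degree = d := Int.ofNat_inj.1 this
      rwa [Finsupp.degree_eq_weight_one] at h2
  | negSucc d =>
    change f ∈ (⊥ : Submodule k _) ↔ _
    rw [Submodule.mem_bot]
    constructor
    · rintro rfl
      simp
    · intro h
      ext m
      by_contra hm
      have := h m hm
      omega

/-- The homogeneous component of degree `j : ℤ`. -/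
def intComponent (k : Type*) [Field k] (n : ℕ) :
    ℤ → (MvPolynomial (Fin n) k →ₗ[k] MvPolynomial (Fin n) k)
  | Int.ofNat d => MvPolynomial.homogeneousComponent d
  | Int.negSucc _ => 0

lemma coeff_intComponent (j : ℤ) (f : MvPolynomial (Fin n) k) (m) :
    (intComponent k n j f).coeff m = if (m.degree : ℤ) = j then f.coeff m else 0 := by
  cases j with
  | ofNat d =>
    simp only [intComponent, MvPolynomial.coeff_homogeneousComponent, Int.ofNat_eq_natCast,
      Nat.cast_inj]
  | negSucc d =>
    have : ¬ ((m.degree : ℤ) = Int.negSucc d) := by omega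
    simp [intComponent, this]

lemma intComponent_mem (j : ℤ) (f : MvPolynomial (Fin n) k) :
    intComponent k n j f ∈ homogeneousPart k n j := by
  rw [mem_homogeneousPart]
  intro m hm
  rw [coeff_intComponent] at hm
  by_contra h
  simp [h] at hm

lemma intComponent_eq_self {j : ℤ} {f : MvPolynomial (Fin n) k}
    (hf : f ∈ homogeneousPart k n j) : intComponent k n j f = f := by
  ext m
  rw [coeff_intComponent]
  split_ifs with h
  · rfl
  · by_contra h'
    exact h (mem_homogeneousPart.1 hf m (Ne.symm h'))

/-- Homogeneity of an ideal, as in the statement of the main theorem. -/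
def IsHomog (I : Ideal (MvPolynomial (Fin n) k)) : Prop :=
  ∀ f ∈ I, ∀ d : ℕ, MvPolynomial.homogeneousComponent d f ∈ I

lemma IsHomog.intComponent_mem {I : Ideal (MvPolynomial (Fin n) k)} (hI : IsHomog I) {f}
    (hf : f ∈ I) (j : ℤ) : intComponent k n j f ∈ I := by
  cases j with
  | ofNat d => exact hI f hf d
  | negSucc d => exact I.zero_mem

/-- The graded pieces of an ideal, as subspaces of the polynomial ring. -/
def idealFam (I : Ideal (MvPolynomial (Fin n) k)) (j : ℤ) :
    Submodule k (MvPolynomial (Fin n) k) :=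
  homogeneousPart k n j ⊓ I.restrictScalars k

lemma mem_idealFam {I : Ideal (MvPolynomial (Fin n) k)} {j : ℤ} {f} :
    f ∈ idealFam I j ↔ f ∈ homogeneousPart k n j ∧ f ∈ I := Iff.rfl

lemma mul_mem_homogeneousPart {i j : ℤ} {f g : MvPolynomial (Fin n) k}
    (hf : f ∈ homogeneousPart k n i) (hg : g ∈ homogeneousPart k n j) :
    f * g ∈ homogeneousPart k n (i + j) := by
  classical
  rw [mem_homogeneousPart] at *
  intro m hm
  rw [MvPolynomial.coeff_mul] at hm
  obtain ⟨⟨a, b⟩, hab, h⟩ := Finset.exists_ne_zero_of_sum_ne_zero hm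
  rw [Finset.HasAntidiagonal.mem_antidiagonal] at hab
  rw [← hab, map_add, Nat.cast_add, hf a (left_ne_zero_of_mul h), hg b (right_ne_zero_of_mul h)]

lemma X_mem_homogeneousPart (a : Fin n) :
    (MvPolynomial.X a : MvPolynomial (Fin n) k) ∈ homogeneousPart k n 1 :=
  MvPolynomial.isHomogeneous_X k a

lemma X_mul_mem_homogeneousPart {j : ℤ} {f : MvPolynomial (Fin n) k}
    (hf : f ∈ homogeneousPart k n j) (a : Fin n) :
    MvPolynomial.X a * f ∈ homogeneousPart k n (j + 1) := by
  rw [add_comm]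
  exact mul_mem_homogeneousPart (X_mem_homogeneousPart a) hf

lemma X_pow_mem_homogeneousPart (a : Fin n) (d : ℕ) :
    (MvPolynomial.X a ^ d : MvPolynomial (Fin n) k) ∈ homogeneousPart k n d :=
  MvPolynomial.isHomogeneous_X_pow a d

lemma isStable_idealFam (I : Ideal (MvPolynomial (Fin n) k)) :
    IsStable (varOp k n _) (idealFam I) := fun a _ _ hm =>
  ⟨X_mul_mem_homogeneousPart hm.1 a, I.mul_mem_left _ hm.2⟩

/-- Places the graded pieces of the ideal inside the polynomial ring, where those of several ideals
can be compared, added and intersected. -/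
lemma koszulVanishes_iff (I : Ideal (MvPolynomial (Fin n) k)) (i : ℕ) (j : ℤ) :
    KoszulVanishes I i j ↔
      RelVanishes (varOp k n (MvPolynomial (Fin n) k)) (idealFam I) (fun _ => ⊥) i j := by
  change Subsingleton (KoszulCohomology n (idealGrading I) i j) ↔ _
  rw [subsingleton_koszulCohomology_iff]
  have hst : IsStable (varOp k n I) (idealGrading I) := fun a j m hm =>
    X_mul_mem_homogeneousPart hm a
  have hmap : ∀ j, (idealGrading I j).map (I.subtype.restrictScalars k) = idealFam I j := by
    intro j
    ext f
    constructor
    · rintro ⟨m, hm, rfl⟩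
      exact ⟨hm, m.2⟩
    · rintro ⟨h1, h2⟩
      exact ⟨⟨f, h2⟩, h1, rfl⟩
  constructor
  · exact RelVanishes.map (I.subtype.restrictScalars k) (fun _ _ => rfl) hst hmap
      (fun j m _ => by simp)
  · exact RelVanishes.of_map (I.subtype.restrictScalars k) (fun _ _ => rfl) hst hmap
      (fun j m _ => by simp) (fun _ => bot_le)

lemma RelVanishes.shift {E : Type*} [AddCommGroup E] [Module k E] {X : Fin n → Module.End k E}
    {M N : ℤ → Submodule k E} {i : ℕ} {j : ℤ} (h : RelVanishes X M N i (j - 1)) :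
    RelVanishes X (fun j => M (j - 1)) (fun j => N (j - 1)) i j := by
  intro ω hω hc
  obtain ⟨η, hη, hη'⟩ := h ω hω (by
    cases i with
    | zero => trivial
    | succ i =>
      intro v
      have : koszulD X i ω v ∈ N (j + 1 - 1) := hc v
      rwa [add_sub_right_comm] at this)
  exact ⟨η, hη, hη'⟩

/-- The second isomorphism theorem: `L/(L ∩ N)` maps onto `M/N` when `L ⊆ M ⊆ L + N`. It reduces a
quotient to conveniently chosen representatives `L`. -/
lemma RelVanishes.sup {E : Type*} [AddCommGroup E] [Module k E] {X : Fin n → Module.End k E}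
    {M L N : ℤ → Submodule k E} (hL : IsStable X L) (hN : IsStable X N) (hM : ∀ j, M j ≤ L j ⊔ N j)
    (hLM : ∀ j, L j ≤ M j)
    {i : ℕ} {j : ℤ} (h : RelVanishes X L (fun j => L j ⊓ N j) i j) :
    RelVanishes X M N i j := by
  intro ω hω hc
  obtain ⟨l, ν, hl, hν, rfl⟩ := exists_alternating_split (LinearMap.id) (L j) (N j) ω
    (fun v => by simpa using hM j (hω v))
  replace hl : l ∈ koszulTerm n L i j := hl
  have e : LinearMap.id.compAlternatingMap l = l := by ext v; rfl
  rw [e] at *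
  obtain ⟨η, hη, hη'⟩ := h l hl (by
    cases i with
    | zero => trivial
    | succ i =>
      intro v
      have h1 := hc v
      rw [map_add] at h1
      refine ⟨hL.koszulD_mem rfl hl v, ?_⟩
      exact (Submodule.add_mem_iff_left _ (hN.koszulD_mem rfl hν v)).1 h1)
  refine ⟨η, koszulTerm_mono (hLM _) hη, ?_⟩
  rw [add_sub_right_comm]
  exact Submodule.add_mem _ (fun v => (hη' v).2) hν

/-! #### Splitting off the variable `x₀` -/

section XZero

/-- The coefficient of `x₀ ^ l`. -/
def coeffZero (k : Type*) [Field k] (r l : ℕ) :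
    MvPolynomial (Fin (r + 1)) k →ₗ[k] MvPolynomial (Fin r) k :=
  (Polynomial.lcoeff (MvPolynomial (Fin r) k) l).restrictScalars k ∘ₗ
    (MvPolynomial.finSuccEquiv k r).toLinearMap

variable {r : ℕ}

lemma coeffZero_apply (l : ℕ) (f : MvPolynomial (Fin (r + 1)) k) :
    coeffZero k r l f = (MvPolynomial.finSuccEquiv k r f).coeff l := rfl

attribute [irreducible] coeffZero

lemma coeffZero_ext {f g : MvPolynomial (Fin (r + 1)) k}
    (h : ∀ l, coeffZero k r l f = coeffZero k r l g) : f = g :=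
  (MvPolynomial.finSuccEquiv k r).injective
    (Polynomial.ext fun l => by simpa only [coeffZero_apply] using h l)

lemma coeffZero_X_succ_mul (l : ℕ) (a : Fin r) (f : MvPolynomial (Fin (r + 1)) k) :
    coeffZero k r l (MvPolynomial.X a.succ * f) = MvPolynomial.X a * coeffZero k r l f := by
  simp [coeffZero_apply, MvPolynomial.finSuccEquiv_X_succ]

@[simp] lemma coeffZero_X_zero_mul_succ (l : ℕ) (f : MvPolynomial (Fin (r + 1)) k) :
    coeffZero k r (l + 1) (MvPolynomial.X 0 * f) = coeffZero k r l f := by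
  simp [coeffZero_apply, MvPolynomial.finSuccEquiv_X_zero, Polynomial.coeff_X_mul]

@[simp] lemma coeffZero_X_zero_mul_zero (f : MvPolynomial (Fin (r + 1)) k) :
    coeffZero k r 0 (MvPolynomial.X 0 * f) = 0 := by
  simp [coeffZero_apply, MvPolynomial.finSuccEquiv_X_zero]

lemma coeffZero_X_zero_pow_mul (d l : ℕ) (f : MvPolynomial (Fin (r + 1)) k) :
    coeffZero k r (l + d) (MvPolynomial.X 0 ^ d * f) = coeffZero k r l f := by
  simp [coeffZero_apply, MvPolynomial.finSuccEquiv_X_zero, Polynomial.coeff_X_pow_mul]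

lemma finSuccEquiv_rename_succ (c : MvPolynomial (Fin r) k) :
    MvPolynomial.finSuccEquiv k r (MvPolynomial.rename Fin.succ c) = Polynomial.C c := by
  have : ((MvPolynomial.finSuccEquiv k r).toAlgHom.comp
      (MvPolynomial.rename (R := k) (Fin.succ (n := r)))) =
      (Algebra.ofId (MvPolynomial (Fin r) k) _).restrictScalars k := by
    apply MvPolynomial.algHom_ext
    intro a
    simp [MvPolynomial.finSuccEquiv_X_succ, Algebra.ofId_apply]
  exact DFunLike.congr_fun this c

lemma coeffZero_rename_succ (l : ℕ) (c : MvPolynomial (Fin r) k) :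
    coeffZero k r l (MvPolynomial.rename Fin.succ c) = if l = 0 then c else 0 := by
  rw [coeffZero_apply, finSuccEquiv_rename_succ, Polynomial.coeff_C]

lemma exists_X_zero_mul {f : MvPolynomial (Fin (r + 1)) k} (h : coeffZero k r 0 f = 0) :
    ∃ g, f = MvPolynomial.X 0 * g := by
  rw [coeffZero_apply] at h
  obtain ⟨g, hg⟩ := Polynomial.X_dvd_iff.2 h
  refine ⟨(MvPolynomial.finSuccEquiv k r).symm g, ?_⟩
  apply (MvPolynomial.finSuccEquiv k r).injective
  rw [hg, map_mul, AlgEquiv.apply_symm_apply, MvPolynomial.finSuccEquiv_X_zero]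

lemma mem_homogeneousPart_iff_coeffZero {j : ℤ} {f : MvPolynomial (Fin (r + 1)) k} :
    f ∈ homogeneousPart k (r + 1) j ↔ ∀ l : ℕ, coeffZero k r l f ∈ homogeneousPart k r (j - l) := by
  simp only [mem_homogeneousPart, coeffZero_apply, MvPolynomial.finSuccEquiv_coeff_coeff]
  have hd : ∀ (l : ℕ) (m : Fin r →₀ ℕ), (m.cons l).degree = l + m.degree := by
    intro l m
    simp [Finsupp.degree_eq_sum, Fin.sum_univ_succ]
  constructor
  · intro h l m hm
    have := h _ hm
    rw [hd] at this
    push_cast at this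
    omega
  · intro h m hm
    have := h (m 0) m.tail (by rwa [Finsupp.cons_tail])
    rw [← Finsupp.cons_tail m, hd]
    push_cast
    omega

lemma X_zero_mul_mem_homogeneousPart_iff {j : ℤ} {f : MvPolynomial (Fin (r + 1)) k} :
    MvPolynomial.X 0 * f ∈ homogeneousPart k (r + 1) j ↔ f ∈ homogeneousPart k (r + 1) (j - 1) := by
  constructor
  · intro h
    rw [mem_homogeneousPart_iff_coeffZero] at *
    intro l
    have := h (l + 1)
    rw [coeffZero_X_zero_mul_succ] at this
    convert! this using 2
    push_cast
    ring
  · intro h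
    have := X_mul_mem_homogeneousPart h 0
    rwa [sub_add_cancel] at this

lemma coeffZero_intComponent (j : ℤ) (l : ℕ) (f : MvPolynomial (Fin (r + 1)) k) :
    coeffZero k r l (intComponent k (r + 1) j f) = intComponent k r (j - l) (coeffZero k r l f) := by
  ext m
  have hd : (m.cons l).degree = l + m.degree := by
    simp [Finsupp.degree_eq_sum, Fin.sum_univ_succ]
  rw [coeff_intComponent, coeffZero_apply, coeffZero_apply, MvPolynomial.finSuccEquiv_coeff_coeff,
    MvPolynomial.finSuccEquiv_coeff_coeff, coeff_intComponent, hd]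
  push_cast
  congr 1
  rw [eq_iff_iff]
  omega

lemma mem_partialElim {I : Ideal (MvPolynomial (Fin (r + 1)) k)} {i : ℕ}
    {c : MvPolynomial (Fin r) k} : c ∈ partialElim I i ↔
      ∃ f ∈ I, (∀ l, i < l → coeffZero k r l f = 0) ∧ coeffZero k r i f = c := by
  change (∃ f ∈ I, (MvPolynomial.finSuccEquiv k r f).natDegree ≤ i ∧ _) ↔ _
  simp only [Polynomial.natDegree_le_iff_coeff_eq_zero, coeffZero_apply]

lemma mem_partialElim_zero {I : Ideal (MvPolynomial (Fin (r + 1)) k)}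
    {c : MvPolynomial (Fin r) k} :
    c ∈ partialElim I 0 ↔ MvPolynomial.rename Fin.succ c ∈ I := by
  rw [mem_partialElim]
  constructor
  · rintro ⟨f, hf, h0, rfl⟩
    convert! hf
    apply coeffZero_ext
    intro l
    rw [coeffZero_rename_succ]
    split_ifs with h
    · rw [h]
    · rw [h0 l (Nat.pos_of_ne_zero h)]
  · intro h
    refine ⟨_, h, fun l hl => ?_, ?_⟩
    · simp [coeffZero_rename_succ, hl.ne']
    · simp [coeffZero_rename_succ]

/-- The graded pieces of the extension `K[x₀]` of an ideal `K` of `k[x₁, …, x_r]`. -/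
def extFam (K : Ideal (MvPolynomial (Fin r) k)) (j : ℤ) :
    Submodule k (MvPolynomial (Fin (r + 1)) k) :=
  homogeneousPart k (r + 1) j ⊓ ⨅ l, (K.restrictScalars k).comap (coeffZero k r l)

lemma mem_extFam {K : Ideal (MvPolynomial (Fin r) k)} {j : ℤ} {f} :
    f ∈ extFam K j ↔ f ∈ homogeneousPart k (r + 1) j ∧ ∀ l, coeffZero k r l f ∈ K := by
  simp [extFam]

lemma isStable_extFam (K : Ideal (MvPolynomial (Fin r) k)) :
    IsStable (varOp k (r + 1) _) (extFam K) := by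
  intro a j m hm
  rw [mem_extFam] at *
  refine ⟨X_mul_mem_homogeneousPart hm.1 a, fun l => ?_⟩
  rw [varOp_apply, smul_eq_mul]
  refine Fin.cases ?_ (fun a => ?_) a
  · cases l with
    | zero => simp
    | succ l => simpa using hm.2 l
  · rw [coeffZero_X_succ_mul]
    exact K.mul_mem_left _ (hm.2 l)

lemma rename_mem_extFam {K : Ideal (MvPolynomial (Fin r) k)} {j : ℤ} {c}
    (hc : c ∈ idealFam K j) : MvPolynomial.rename Fin.succ c ∈ extFam K j := by
  rw [mem_extFam, mem_homogeneousPart_iff_coeffZero]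
  constructor
  · intro l
    rw [coeffZero_rename_succ]
    split_ifs with h
    · subst h
      simpa using hc.1
    · exact Submodule.zero_mem _
  · intro l
    rw [coeffZero_rename_succ]
    split_ifs with h
    · exact hc.2
    · exact Submodule.zero_mem _

/-- On `K[x₀]` the variable `x₀` is a nonzerodivisor, and setting it to zero gives back `K`. -/
lemma relVanishes_extFam [CharZero k] {K : Ideal (MvPolynomial (Fin r) k)} {i : ℕ} {j : ℤ}
    (h : RelVanishes (varOp k r (MvPolynomial (Fin r) k)) (idealFam K) (fun _ => ⊥) i j) :
    RelVanishes (varOp k (r + 1) (MvPolynomial (Fin (r + 1)) k)) (extFam K) (fun _ => ⊥) i j := by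
  refine RelVanishes.of_regular varOp_comm (isStable_extFam K) (isStable_bot _) ?_ ?_
  · intro j m _ hm
    simpa [MvPolynomial.X_ne_zero] using hm
  refine RelVanishes.of_map (coeffZero k r 0) (fun a m => coeffZero_X_succ_mul 0 a m)
    (fun a => isStable_extFam K a.succ) (M' := idealFam K) (N' := fun _ => ⊥) ?_ ?_ ?_ h
  · intro j
    ext c
    constructor
    · rintro ⟨f, hf, rfl⟩
      have hf' := mem_extFam.1 hf
      have := mem_homogeneousPart_iff_coeffZero.1 hf'.1 0
      exact ⟨by simpa using this, hf'.2 0⟩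
    · intro hc
      exact ⟨_, rename_mem_extFam hc, by simp [coeffZero_rename_succ]⟩
  · intro j m hm
    rw [sup_bot_eq, Submodule.mem_bot]
    constructor
    · intro h0
      obtain ⟨g, rfl⟩ := exists_X_zero_mul h0
      refine ⟨g, mem_extFam.2 ⟨X_zero_mul_mem_homogeneousPart_iff.1 (mem_extFam.1 hm).1,
        fun l => ?_⟩, rfl⟩
      simpa using (mem_extFam.1 hm).2 (l + 1)
    · rintro ⟨g, -, rfl⟩
      simp
  · intro j m hm
    rw [sup_bot_eq] at hm
    obtain ⟨g, hg, rfl⟩ := hm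
    have := isStable_extFam K 0 _ _ hg
    rwa [sub_add_cancel] at this

lemma eq_sum_coeffZero (f : MvPolynomial (Fin (r + 1)) k) :
    f = ∑ l ∈ (MvPolynomial.finSuccEquiv k r f).support,
      MvPolynomial.X 0 ^ l * MvPolynomial.rename Fin.succ (coeffZero k r l f) := by
  apply (MvPolynomial.finSuccEquiv k r).injective
  simp only [map_sum, map_mul, map_pow, MvPolynomial.finSuccEquiv_X_zero,
    finSuccEquiv_rename_succ, coeffZero_apply]
  conv_lhs => rw [(MvPolynomial.finSuccEquiv k r f).as_sum_support_C_mul_X_pow]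
  exact Finset.sum_congr rfl fun l _ => mul_comm _ _

lemma mem_of_coeffZero_mem {I : Ideal (MvPolynomial (Fin (r + 1)) k)}
    {f : MvPolynomial (Fin (r + 1)) k} (hf : ∀ l, coeffZero k r l f ∈ partialElim I 0) : f ∈ I := by
  rw [eq_sum_coeffZero f]
  exact I.sum_mem fun l _ => I.mul_mem_left _ (mem_partialElim_zero.1 (hf l))

lemma extFam_partialElim_zero_le (I : Ideal (MvPolynomial (Fin (r + 1)) k)) (j : ℤ) :
    extFam (partialElim I 0) j ≤ idealFam I j := by
  intro f hf
  rw [mem_extFam] at hf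
  exact ⟨hf.1, mem_of_coeffZero_mem hf.2⟩

/-- Multiplication by `x₀` is injective on `I/K₀[x₀]`, because membership in `K₀[x₀]` is tested
coefficient by coefficient. The quotient by `x₀` is represented by elements `c₁ x₀ + c₀` of `I`, and
the class of such an element is the class of `c₁` in `K/K₀`; the factor `x₀` accounts for the shift
from `j` to `j - 1`. -/
lemma relVanishes_idealFam_extFam [CharZero k] {I : Ideal (MvPolynomial (Fin (r + 1)) k)}
    (hI : IsHomog I) {K₀ K : Ideal (MvPolynomial (Fin r) k)} (hK₀ : partialElim I 0 = K₀)
    (hs : ∀ l, 1 ≤ l → partialElim I l = K) {i : ℕ} {j : ℤ}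
    (h1 : RelVanishes (varOp k r (MvPolynomial (Fin r) k)) (idealFam K) (idealFam K₀) i (j - 1)) :
    RelVanishes (varOp k (r + 1) (MvPolynomial (Fin (r + 1)) k)) (idealFam I) (extFam K₀) i j := by
  have hrec : ∀ f : MvPolynomial (Fin (r + 1)) k, (∀ l, coeffZero k r l f ∈ K₀) → f ∈ I :=
    fun f hf => mem_of_coeffZero_mem (hK₀ ▸ hf)
  have hNM : ∀ j, extFam K₀ j ≤ idealFam I j := hK₀ ▸ extFam_partialElim_zero_le I
  refine RelVanishes.of_regular varOp_comm (isStable_idealFam I) (isStable_extFam K₀) ?_ ?_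
  · intro j m hm hxm
    refine mem_extFam.2 ⟨hm.1, fun l => ?_⟩
    simpa using (mem_extFam.1 hxm).2 (l + 1)
  set N : ℤ → Submodule k (MvPolynomial (Fin (r + 1)) k) := fun j =>
    (idealFam I (j - 1)).map (varOp k (r + 1) (MvPolynomial (Fin (r + 1)) k) 0) ⊔ extFam K₀ j
    with hN
  -- elements of degree at most one in `x₀`
  let L : ℤ → Submodule k (MvPolynomial (Fin (r + 1)) k) := fun j =>
    idealFam I j ⊓ ⨅ l, LinearMap.ker (coeffZero k r (l + 2))
  have mem_L : ∀ {j f}, f ∈ L j ↔ f ∈ idealFam I j ∧ ∀ l, coeffZero k r (l + 2) f = 0 := by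
    intro j f
    simp [L]
  have lift : ∀ {j : ℤ} {c}, c ∈ idealFam K (j - 1) → ∃ f ∈ L j, coeffZero k r 1 f = c := by
    rintro j c ⟨hc, hcK⟩
    rw [← hs 1 le_rfl] at hcK
    obtain ⟨f, hf, hf0, rfl⟩ := mem_partialElim.1 hcK
    refine ⟨intComponent k (r + 1) j f, mem_L.2 ⟨⟨intComponent_mem _ _, hI.intComponent_mem hf j⟩,
      fun l => ?_⟩, ?_⟩
    · rw [coeffZero_intComponent, hf0 _ (by omega), map_zero]
    · rw [coeffZero_intComponent]
      exact intComponent_eq_self hc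
  have hL : IsStable (fun a : Fin r => varOp k (r + 1) (MvPolynomial (Fin (r + 1)) k) a.succ) L := by
    intro a j m hm
    rw [mem_L] at *
    refine ⟨isStable_idealFam I _ _ _ hm.1, fun l => ?_⟩
    rw [varOp_apply, smul_eq_mul, coeffZero_X_succ_mul, hm.2, mul_zero]
  have hNs : IsStable (fun a : Fin r => varOp k (r + 1) (MvPolynomial (Fin (r + 1)) k) a.succ) N := by
    intro a j m hm
    obtain ⟨_, ⟨f, hf, rfl⟩, g, hg, rfl⟩ := Submodule.mem_sup.1 hm
    rw [map_add]
    refine Submodule.add_mem_sup ?_ (isStable_extFam K₀ _ _ _ hg)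
    refine ⟨varOp k (r + 1) (MvPolynomial (Fin (r + 1)) k) a.succ f, ?_, varOp_comm _ _ _⟩
    have := isStable_idealFam I a.succ _ _ hf
    rwa [sub_add_cancel, ← add_sub_cancel_right j 1] at this
  -- Stability from index 1 on is used here: the coefficient of `x₀ ^ (d + 2)` lies in `K`, so it is
  -- also the `x₀`-coefficient of some `g ∈ I` of degree at most one in `x₀`. Subtracting `x₀ ^ (d +
  -- 1) g`, a multiple of `x₀` inside `I`, lowers the degree.
  have hdec : ∀ (d : ℕ) (j : ℤ) (f), f ∈ idealFam I j → (∀ l, d + 1 < l → coeffZero k r l f = 0) →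
      f ∈ L j ⊔ N j := by
    intro d
    induction d with
    | zero =>
      intro j f hf hd
      exact Submodule.mem_sup_left (mem_L.2 ⟨hf, fun l => hd _ (by omega)⟩)
    | succ d ih =>
      intro j f hf hd
      have hc : coeffZero k r (d + 2) f ∈ K := by
        rw [← hs (d + 2) (by omega), mem_partialElim]
        exact ⟨f, hf.2, hd, rfl⟩
      obtain ⟨g, hg, hgc⟩ := lift (j := j - (d + 1)) (c := coeffZero k r (d + 2) f)
        ⟨by
          rw [show (j - (d + 1) - 1 : ℤ) = j - ((d + 2 : ℕ) : ℤ) by push_cast; ring]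
          exact mem_homogeneousPart_iff_coeffZero.1 hf.1 (d + 2), hc⟩
      rw [mem_L] at hg
      have hx : MvPolynomial.X 0 ^ (d + 1) * g ∈ idealFam I j := by
        refine ⟨?_, I.mul_mem_left _ hg.1.2⟩
        have := mul_mem_homogeneousPart (X_pow_mem_homogeneousPart (0 : Fin (r + 1)) (d + 1)) hg.1.1
        rwa [show ((d + 1 : ℕ) : ℤ) + (j - (d + 1)) = j by push_cast; ring] at this
      have h1 := ih j (f - MvPolynomial.X 0 ^ (d + 1) * g) (Submodule.sub_mem _ hf hx) (by
        intro l hl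
        obtain ⟨l, rfl⟩ : ∃ l', l = l' + 1 + (d + 1) := ⟨l - d - 2, by omega⟩
        rw [map_sub, coeffZero_X_zero_pow_mul]
        cases l with
        | zero =>
          rw [show 0 + 1 + (d + 1) = d + 2 by ring, zero_add, hgc, sub_self]
        | succ l =>
          rw [hd _ (by omega), hg.2, sub_zero])
      have h2 : MvPolynomial.X 0 ^ (d + 1) * g ∈ N j := by
        refine Submodule.mem_sup_left ⟨MvPolynomial.X 0 ^ d * g, ⟨?_, I.mul_mem_left _ hg.1.2⟩, ?_⟩
        · refine X_zero_mul_mem_homogeneousPart_iff.1 ?_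
          rw [← mul_assoc, ← pow_succ']
          exact hx.1
        · rw [varOp_apply, smul_eq_mul, ← mul_assoc, ← pow_succ']
      rw [← sub_add_cancel f (MvPolynomial.X 0 ^ (d + 1) * g)]
      exact Submodule.add_mem _ h1 (Submodule.mem_sup_right h2)
  refine RelVanishes.sup hL hNs (fun j f hf => hdec (MvPolynomial.finSuccEquiv k r f).natDegree j f
    hf fun l hl => by
      rw [coeffZero_apply]
      exact Polynomial.coeff_eq_zero_of_natDegree_lt (by omega)) (fun j => inf_le_left) ?_
  -- What remains is that `coeffZero k r 1` maps `L` onto `K` and that its preimage of `K₀` in `L`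
  -- is `L ∩ N`.
  refine RelVanishes.of_map (coeffZero k r 1) (fun a m => coeffZero_X_succ_mul 1 a m) hL
    (M' := fun j => idealFam K (j - 1)) (N' := fun j => idealFam K₀ (j - 1)) ?_ ?_
    (fun j => inf_le_left) (RelVanishes.shift h1)
  · intro j
    ext c
    constructor
    · rintro ⟨f, hf, rfl⟩
      rw [SetLike.mem_coe, mem_L] at hf
      refine ⟨?_, hs 1 le_rfl ▸ mem_partialElim.2 ⟨f, hf.1.2, fun l hl => ?_, rfl⟩⟩
      · exact mem_homogeneousPart_iff_coeffZero.1 hf.1.1 1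
      · obtain ⟨l, rfl⟩ := Nat.exists_eq_add_of_le' hl
        exact hf.2 l
    · exact fun hc => lift hc
  · intro j m hm
    rw [mem_L] at hm
    constructor
    · intro hm1
      refine ⟨mem_L.2 hm, ?_⟩
      have hx : MvPolynomial.X 0 * MvPolynomial.rename Fin.succ (coeffZero k r 1 m) ∈
          extFam K₀ j := by
        have := isStable_extFam K₀ 0 _ _ (rename_mem_extFam hm1)
        rwa [sub_add_cancel] at this
      rw [← sub_add_cancel m (MvPolynomial.X 0 * MvPolynomial.rename Fin.succ (coeffZero k r 1 m))]
      refine Submodule.mem_sup_right (Submodule.add_mem _ ?_ hx)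
      have hsub : m - MvPolynomial.X 0 * MvPolynomial.rename Fin.succ (coeffZero k r 1 m) =
          MvPolynomial.rename Fin.succ (coeffZero k r 0 m) := by
        apply coeffZero_ext
        intro l
        rw [map_sub, coeffZero_rename_succ]
        match l with
        | 0 => simp
        | 1 => simp [coeffZero_rename_succ]
        | l + 2 => simp [coeffZero_rename_succ, hm.2]
      have hmem := Submodule.sub_mem _ hm.1 (hNM _ hx)
      rw [hsub] at hmem ⊢
      refine rename_mem_extFam ⟨?_, hK₀ ▸ mem_partialElim_zero.2 hmem.2⟩
      simpa using mem_homogeneousPart_iff_coeffZero.1 hm.1.1 0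
    · rintro ⟨-, hmN⟩
      refine ⟨mem_homogeneousPart_iff_coeffZero.1 hm.1.1 1, ?_⟩
      obtain ⟨_, ⟨f, hf, rfl⟩, g, hg, rfl⟩ := Submodule.mem_sup.1 hmN
      rw [mem_extFam] at hg
      rw [varOp_apply, smul_eq_mul, map_add, coeffZero_X_zero_mul_succ]
      refine K₀.add_mem ?_ (hg.2 1)
      -- `f + (g - g₀) / x₀` has degree zero in `x₀`
      obtain ⟨g', hg'⟩ := exists_X_zero_mul
        (f := g - MvPolynomial.rename Fin.succ (coeffZero k r 0 g)) (by simp [coeffZero_rename_succ])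
      have hg'c : ∀ l, coeffZero k r l g' = coeffZero k r (l + 1) g := by
        intro l
        rw [← coeffZero_X_zero_mul_succ, ← hg', map_sub, coeffZero_rename_succ]
        simp
      have hsum : f + g' ∈ I := I.add_mem hf.2 (hrec g' fun l => hg'c l ▸ hg.2 _)
      have : coeffZero k r 0 (f + g') ∈ K₀ := by
        refine hK₀ ▸ mem_partialElim.2 ⟨_, hsum, fun l hl => ?_, rfl⟩
        obtain ⟨l, rfl⟩ := Nat.exists_eq_add_of_le' hl
        have := hm.2 l
        rw [varOp_apply, smul_eq_mul, map_add, coeffZero_X_zero_mul_succ] at this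
        rw [map_add, hg'c]
        exact this
      rw [map_add, hg'c] at this
      exact (Submodule.add_mem_iff_left _ (hg.2 1)).1 this

/-- The algebraic statement in coordinates centred at the point. -/
lemma relVanishes_of_partialElim [CharZero k] {I : Ideal (MvPolynomial (Fin (r + 1)) k)}
    (hI : IsHomog I) (hs : ∀ l, 1 ≤ l → partialElim I l = partialElim I 1) {i : ℕ} {j : ℤ}
    (h1 : RelVanishes (varOp k r (MvPolynomial (Fin r) k)) (idealFam (partialElim I 1))
      (idealFam (partialElim I 0)) i (j - 1))
    (h0 : RelVanishes (varOp k r (MvPolynomial (Fin r) k)) (idealFam (partialElim I 0))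
      (fun _ => ⊥) i j) :
    RelVanishes (varOp k (r + 1) (MvPolynomial (Fin (r + 1)) k)) (idealFam I)
      (fun _ => ⊥) i j :=
  RelVanishes.of_sub_of_quotient varOp_comm (extFam_partialElim_zero_le I)
    (relVanishes_extFam h0) (relVanishes_idealFam_extFam hI rfl hs h1)

end XZero

end KoszulIdeals
end
end SecantBetti

namespace SecantBetti
noncomputable section

/-! ### Linear substitutions -/

section Pullback

variable {k : Type*} [Field k] {n m p : ℕ}

/-- Composition of polynomials with a linear map. -/
def pull (φ : (Fin n → k) →ₗ[k] (Fin m → k)) :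
    MvPolynomial (Fin m) k →ₐ[k] MvPolynomial (Fin n) k :=
  MvPolynomial.aeval (R := k) (fun a =>
    LinearMap.toMvPolynomial (Pi.basisFun k (Fin n)) (Pi.basisFun k (Fin m)) φ a)

@[simp] lemma eval_pull (φ : (Fin n → k) →ₗ[k] (Fin m → k)) (x : Fin n → k)
    (f : MvPolynomial (Fin m) k) :
    MvPolynomial.eval x (pull φ f) = MvPolynomial.eval (φ x) f := by
  have : (MvPolynomial.aeval (R := k) x).comp (pull φ) = MvPolynomial.aeval (φ x) := by
    apply MvPolynomial.algHom_ext
    intro a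
    have h := LinearMap.toMvPolynomial_eval_eq_apply (Pi.basisFun k (Fin n)) (Pi.basisFun k (Fin m))
      φ a (Finsupp.equivFunOnFinite.symm x)
    simp only [AlgHom.comp_apply, pull, MvPolynomial.aeval_X]
    convert! h using 2
  exact DFunLike.congr_fun this f

lemma pull_comp [Infinite k] (ψ : (Fin m → k) →ₗ[k] (Fin p → k))
    (φ : (Fin n → k) →ₗ[k] (Fin m → k)) (f : MvPolynomial (Fin p) k) :
    pull (ψ ∘ₗ φ) f = pull φ (pull ψ f) :=
  MvPolynomial.funext fun x => by simp

lemma pull_X [Infinite k] (φ : (Fin n → k) →ₗ[k] (Fin m → k)) (a : Fin m) :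
    pull φ (MvPolynomial.X a) = ∑ b, φ (Pi.single b 1) a • MvPolynomial.X b := by
  refine MvPolynomial.funext fun x => ?_
  have hx : x = ∑ b, x b • Pi.single b (1 : k) := by
    simp [← Pi.single_smul, Finset.univ_sum_single]
  rw [eval_pull, MvPolynomial.eval_X]
  conv_lhs => rw [hx]
  simp [mul_comm]

lemma pull_mem_homogeneousPart (φ : (Fin n → k) →ₗ[k] (Fin m → k)) {j : ℤ}
    {f : MvPolynomial (Fin m) k} (hf : f ∈ homogeneousPart k m j) :
    pull φ f ∈ homogeneousPart k n j := by
  cases j with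
  | ofNat d =>
    have := MvPolynomial.IsHomogeneous.aeval (φ := f) (m := d) (n := 1) hf
      (fun a => LinearMap.toMvPolynomial (Pi.basisFun k (Fin n)) (Pi.basisFun k (Fin m)) φ a)
      (fun a => LinearMap.toMvPolynomial_isHomogeneous _ _ φ a)
    rwa [one_mul] at this
  | negSucc d =>
    rw [show f = 0 from hf, map_zero]
    exact Submodule.zero_mem _

lemma pull_intComponent (φ : (Fin n → k) →ₗ[k] (Fin m → k)) (d : ℕ) (f : MvPolynomial (Fin m) k) :
    pull φ (MvPolynomial.homogeneousComponent d f) =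
      MvPolynomial.homogeneousComponent d (pull φ f) := by
  conv_rhs => rw [← MvPolynomial.sum_homogeneousComponent f, map_sum, map_sum]
  have h : ∀ e, MvPolynomial.homogeneousComponent d
      (pull φ (MvPolynomial.homogeneousComponent e f)) =
      if d = e then pull φ (MvPolynomial.homogeneousComponent e f) else 0 := fun e =>
    MvPolynomial.homogeneousComponent_of_mem (pull_mem_homogeneousPart φ (j := e)
      (MvPolynomial.homogeneousComponent_isHomogeneous e f))
  simp only [h, Finset.sum_ite_eq, Finset.mem_range]
  split_ifs with hd
  · rfl
  · rw [MvPolynomial.homogeneousComponent_eq_zero _ _ (by omega), map_zero]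

lemma inCoordinates_eq (g : (Fin n → k) ≃ₗ[k] (Fin n → k)) (I : Ideal (MvPolynomial (Fin n) k)) :
    inCoordinates g I = I.comap (pull (g : (Fin n → k) →ₗ[k] (Fin n → k))) := rfl

lemma IsHomog.comap_pull {I : Ideal (MvPolynomial (Fin n) k)} (hI : IsHomog I)
    (φ : (Fin n → k) →ₗ[k] (Fin m → k)) : IsHomog (I.comap (pull φ)) := by
  intro f hf d
  rw [Ideal.mem_comap] at *
  rw [pull_intComponent]
  exact hI _ hf d

/-- The differential is contraction with the element `∑ x_a ⊗ e_a` representing the identity, which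
does not depend on the basis. Hence it commutes with substituting `g` in the values and in the
arguments simultaneously. -/
lemma koszulD_pull [Infinite k] (g : (Fin n → k) →ₗ[k] (Fin n → k)) {i : ℕ}
    (ω : (Fin n → k) [⋀^Fin (i + 1)]→ₗ[k] MvPolynomial (Fin n) k) :
    koszulD (varOp k n _) i ((pull g).toLinearMap.compAlternatingMap (ω.compLinearMap g)) =
      (pull g).toLinearMap.compAlternatingMap ((koszulD (varOp k n _) i ω).compLinearMap g) := by
  ext1 v
  simp only [koszulD_apply, LinearMap.compAlternatingMap_apply, AlternatingMap.compLinearMap_apply,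
    map_sum, varOp_apply, smul_eq_mul, AlgHom.toLinearMap_apply, map_mul, pull_X, Finset.sum_mul]
  rw [Finset.sum_comm]
  refine Finset.sum_congr rfl fun b _ => ?_
  have hc : ∀ w : Fin n → k, (fun l => g (Matrix.vecCons w v l)) =
      Matrix.vecCons (g w) (fun l => g (v l)) := by
    intro w
    funext l
    refine Fin.cases ?_ (fun l => ?_) l <;> simp
  simp only [hc]
  have hg : g (Pi.single b 1) = ∑ a, g (Pi.single b 1) a • Pi.single a (1 : k) := by
    simp [← Pi.single_smul, Finset.univ_sum_single]
  have : ω (Matrix.vecCons (g (Pi.single b 1)) fun l => g (v l)) =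
      ∑ a, g (Pi.single b 1) a • ω (Matrix.vecCons (Pi.single a 1) fun l => g (v l)) := by
    let Λ : (Fin n → k) →ₗ[k] MvPolynomial (Fin n) k :=
      { toFun := fun w => ω (Matrix.vecCons w fun l => g (v l))
        map_add' := fun x y => ω.map_vecCons_add _ x y
        map_smul' := fun c x => ω.map_vecCons_smul _ c x }
    have h := congrArg Λ hg
    rw [map_sum] at h
    simp only [map_smul] at h
    exact h
  rw [this, map_sum, Finset.mul_sum]
  refine Finset.sum_congr rfl fun a _ => ?_
  simp [map_smul]

lemma comap_pull_comp [Infinite k] (ψ : (Fin m → k) →ₗ[k] (Fin p → k))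
    (φ : (Fin n → k) →ₗ[k] (Fin m → k)) (I : Ideal (MvPolynomial (Fin n) k)) :
    I.comap (pull (ψ ∘ₗ φ)) = (I.comap (pull φ)).comap (pull ψ) := by
  ext f
  simp only [Ideal.mem_comap, pull_comp]

lemma inCoordinates_symm_inCoordinates [Infinite k] (g : (Fin n → k) ≃ₗ[k] (Fin n → k))
    (I : Ideal (MvPolynomial (Fin n) k)) : inCoordinates g.symm (inCoordinates g I) = I := by
  rw [inCoordinates_eq, inCoordinates_eq, ← comap_pull_comp]
  ext f
  rw [Ideal.mem_comap]
  convert! Iff.rfl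
  refine MvPolynomial.funext fun x => by simp

lemma mem_inCoordinates {g : (Fin n → k) ≃ₗ[k] (Fin n → k)} {I : Ideal (MvPolynomial (Fin n) k)}
    {f} : f ∈ inCoordinates g I ↔ pull (g : (Fin n → k) →ₗ[k] (Fin n → k)) f ∈ I := Iff.rfl

lemma relVanishes_of_inCoordinates [Infinite k] (g : (Fin n → k) ≃ₗ[k] (Fin n → k))
    {I : Ideal (MvPolynomial (Fin n) k)} {i : ℕ} {j : ℤ}
    (h : RelVanishes (varOp k n (MvPolynomial (Fin n) k)) (idealFam (inCoordinates g I))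
      (fun _ => ⊥) i j) :
    RelVanishes (varOp k n (MvPolynomial (Fin n) k)) (idealFam I) (fun _ => ⊥) i j := by
  obtain ⟨G, hG⟩ : ∃ G : (Fin n → k) →ₗ[k] (Fin n → k), G = g := ⟨_, rfl⟩
  obtain ⟨H, hH⟩ : ∃ H : (Fin n → k) →ₗ[k] (Fin n → k), H = g.symm := ⟨_, rfl⟩
  have hHG : ∀ x, H (G x) = x := by simp [hG, hH]
  have hgg : ∀ f, pull G (pull H f) = f := fun f =>
    MvPolynomial.funext fun x => by rw [eval_pull, eval_pull, hHG]
  have hmem : ∀ f, f ∈ inCoordinates g I ↔ pull G f ∈ I := by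
    intro f
    rw [hG]
    exact mem_inCoordinates
  intro ω hω hc
  obtain ⟨η, hη, hη'⟩ := h ((pull H).toLinearMap.compAlternatingMap (ω.compLinearMap H)) (by
      intro v
      refine mem_idealFam.2 ⟨pull_mem_homogeneousPart H (mem_idealFam.1 (hω _)).1, ?_⟩
      rw [hmem, LinearMap.compAlternatingMap_apply, AlgHom.toLinearMap_apply, hgg]
      exact (mem_idealFam.1 (hω _)).2) (by
      cases i with
      | zero => trivial
      | succ i =>
        refine mem_koszulTerm_bot.2 ?_
        rw [koszulD_pull, mem_koszulTerm_bot.1 hc]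
        ext1 v
        simp)
  rw [mem_koszulTerm_bot, sub_eq_zero] at hη'
  refine ⟨(pull G).toLinearMap.compAlternatingMap (η.compLinearMap G), ?_, ?_⟩
  · intro v
    have := mem_idealFam.1 (hη fun l => G (v l))
    exact mem_idealFam.2 ⟨pull_mem_homogeneousPart G this.1, (hmem _).1 this.2⟩
  · rw [mem_koszulTerm_bot, koszulD_pull, ← hη', sub_eq_zero]
    ext1 v
    rw [LinearMap.compAlternatingMap_apply, AlternatingMap.compLinearMap_apply,
      LinearMap.compAlternatingMap_apply, AlternatingMap.compLinearMap_apply,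
      AlgHom.toLinearMap_apply, AlgHom.toLinearMap_apply, hgg]
    simp only [hHG]

lemma koszulVanishes_of_inCoordinates [Infinite k] (g : (Fin n → k) ≃ₗ[k] (Fin n → k))
    {I : Ideal (MvPolynomial (Fin n) k)} {i j : ℤ} (h : KoszulVanishes (inCoordinates g I) i j) :
    KoszulVanishes I i j := by
  cases i with
  | negSucc i => trivial
  | ofNat i =>
    exact (koszulVanishes_iff I i j).2
      (relVanishes_of_inCoordinates g ((koszulVanishes_iff _ i j).1 h))

lemma koszulVanishes_inCoordinates_iff [Infinite k] (g : (Fin n → k) ≃ₗ[k] (Fin n → k))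
    {I : Ideal (MvPolynomial (Fin n) k)} {i j : ℤ} :
    KoszulVanishes (inCoordinates g I) i j ↔ KoszulVanishes I i j := by
  refine ⟨koszulVanishes_of_inCoordinates g, fun h => ?_⟩
  refine koszulVanishes_of_inCoordinates g.symm ?_
  rwa [inCoordinates_symm_inCoordinates]

end Pullback

section Algebraic

variable {k : Type*} [Field k] {r : ℕ}

lemma partialElim_eq_of_stabilizationNumber {I : Ideal (MvPolynomial (Fin (r + 1)) k)}
    (h : stabilizationNumber I = 1) (l : ℕ) (hl : 1 ≤ l) : partialElim I l = partialElim I 1 := by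
  -- The infimum of the empty set of naturals is `0`, so the value `1` certifies that the chain does
  -- stabilise.
  have hne : {s | ∀ i, s ≤ i → partialElim I i = partialElim I s}.Nonempty := by
    by_contra hne
    rw [Set.not_nonempty_iff_eq_empty] at hne
    rw [stabilizationNumber, hne] at h
    simp at h
  have := Nat.sInf_mem hne
  rw [← stabilizationNumber, h] at this
  exact this l hl

/-- The algebraic part of the main theorem. -/
theorem koszulVanishes_of_partialElim [CharZero k] {I : Ideal (MvPolynomial (Fin (r + 1)) k)}
    (hI : IsHomog I) (g : (Fin (r + 1) → k) ≃ₗ[k] (Fin (r + 1) → k))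
    (hs : stabilizationNumber (inCoordinates g I) = 1) {i j : ℤ}
    (h1 : KoszulVanishes (partialElimInfty (inCoordinates g I)) i (j - 1))
    (h2 : KoszulVanishes (partialElim (inCoordinates g I) 0) (i - 1) j)
    (h3 : KoszulVanishes (partialElim (inCoordinates g I) 0) i j) : KoszulVanishes I i j := by
  refine koszulVanishes_of_inCoordinates g ?_
  have hH : IsHomog (inCoordinates g I) := hI.comap_pull _
  have hst := partialElim_eq_of_stabilizationNumber hs
  rw [partialElimInfty, hs] at h1
  set I' := inCoordinates g I
  cases i with
  | negSucc i => trivial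
  | ofNat i =>
  rw [Int.ofNat_eq_natCast, koszulVanishes_iff] at h1 h3 ⊢
  refine relVanishes_of_partialElim hH hst ?_ h3
  -- The group of `K_1/K_0` sits between `K_{i,j-1}(K_1)` and `K_{i-1,j}(K_0)`; in exterior degree
  -- zero right exactness is enough.
  cases i with
  | zero => exact h1.quotient_zero
  | succ i =>
    refine RelVanishes.quotient varOp_comm ?_ h1 ?_
    · intro j f hf
      refine ⟨hf.1, ?_⟩
      obtain ⟨f', hf', h0, rfl⟩ := mem_partialElim.1 hf.2
      refine mem_partialElim.2 ⟨MvPolynomial.X 0 * f', I'.mul_mem_left _ hf', fun l hl => ?_, ?_⟩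
      · obtain ⟨l, rfl⟩ := Nat.exists_eq_add_of_le' hl
        rw [coeffZero_X_zero_mul_succ]
        exact h0 _ (by omega)
      · exact coeffZero_X_zero_mul_succ 0 f'
    · rw [Int.ofNat_eq_natCast, Nat.cast_succ, add_sub_cancel_right, koszulVanishes_iff] at h2
      rwa [sub_add_cancel]

/-- The Koszul complex of the polynomial ring is exact in positive exterior degree. -/
lemma relVanishes_homogeneousPart [CharZero k] (n i : ℕ) (j : ℤ) :
    RelVanishes (varOp k n (MvPolynomial (Fin n) k)) (homogeneousPart k n) (fun _ => ⊥)
      (i + 1) j := by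
  induction n with
  | zero =>
    intro ω _ _
    refine ⟨0, Submodule.zero_mem _, mem_koszulTerm_bot.2 ?_⟩
    rw [map_zero, sub_zero]
    ext1 v
    exact ω.map_coord_zero 0 (Subsingleton.elim _ _)
  | succ n ih =>
    -- The polynomial ring in one more variable is the extension of the unit ideal, so induction on
    -- the variables runs through `relVanishes_extFam`.
    have h1 : idealFam (⊤ : Ideal (MvPolynomial (Fin n) k)) = homogeneousPart k n := by
      funext j
      ext f
      simp [mem_idealFam]
    have h2 : extFam (⊤ : Ideal (MvPolynomial (Fin n) k)) = homogeneousPart k (n + 1) := by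
      funext j
      ext f
      simp [mem_extFam]
    rw [← h2]
    exact relVanishes_extFam (h1 ▸ ih)

end Algebraic
end
end SecantBetti

namespace SecantBetti
noncomputable section

/-! ### Betti numbers and Koszul cohomology -/

section Betti

variable {k : Type*} [Field k] {n : ℕ}

lemma intComponent_mul_of_mem {e : ℤ} {g : MvPolynomial (Fin n) k}
    (hg : g ∈ homogeneousPart k n e) (j : ℤ) (f : MvPolynomial (Fin n) k) :
    intComponent k n j (f * g) = intComponent k n (j - e) f * g := by
  classical
  rw [mem_homogeneousPart] at hg
  ext m
  rw [coeff_intComponent, MvPolynomial.coeff_mul, MvPolynomial.coeff_mul]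
  simp only [coeff_intComponent, ite_mul, zero_mul]
  have : (if (m.degree : ℤ) = j then ∑ x ∈ Finset.HasAntidiagonal.antidiagonal m,
      f.coeff x.1 * g.coeff x.2 else 0) = ∑ x ∈ Finset.HasAntidiagonal.antidiagonal m,
      if (m.degree : ℤ) = j then f.coeff x.1 * g.coeff x.2 else 0 := by
    split_ifs <;> simp
  rw [this]
  refine Finset.sum_congr rfl fun x hx => ?_
  rw [Finset.HasAntidiagonal.mem_antidiagonal] at hx
  by_cases h : g.coeff x.2 = 0
  · simp [h]
  · have h1 := hg _ h
    have h2 : (m.degree : ℤ) = x.1.degree + x.2.degree := by rw [← hx, map_add, Nat.cast_add]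
    congr 1
    rw [eq_iff_iff]
    omega

lemma exists_eq_sum_X_mul {j : ℤ} {f : MvPolynomial (Fin n) k}
    (hf : f ∈ homogeneousPart k n (j + 1)) (h0 : MvPolynomial.constantCoeff f = 0) :
    ∃ c : Fin n → MvPolynomial (Fin n) k, (∀ a, c a ∈ homogeneousPart k n j) ∧
      f = ∑ a, MvPolynomial.X a * c a := by
  have hmem : f ∈ Ideal.span (Set.range (MvPolynomial.X : Fin n → MvPolynomial (Fin n) k)) := by
    rw [← Set.image_univ, MvPolynomial.mem_ideal_span_X_image]
    intro m hm
    by_contra hcon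
    push Not at hcon
    have : m = 0 := by
      ext a
      simpa using hcon a (Set.mem_univ a)
    rw [this, MvPolynomial.mem_support_iff] at hm
    exact hm h0
  obtain ⟨c, hc⟩ := (Ideal.mem_span_range_iff_exists_fun).1 hmem
  refine ⟨fun a => intComponent k n j (c a), fun a => intComponent_mem _ _, ?_⟩
  rw [← intComponent_eq_self hf, ← hc, map_sum]
  refine Finset.sum_congr rfl fun a _ => ?_
  rw [intComponent_mul_of_mem (X_mem_homogeneousPart a), add_sub_cancel_right, mul_comm]

/-- The graded pieces of a graded free module with generators in degrees `deg`. -/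
def freeFam {s : ℕ} (deg : Fin s → ℤ) (j : ℤ) : Submodule k (Fin s → MvPolynomial (Fin n) k) :=
  Submodule.pi Set.univ fun a => homogeneousPart k n (j - deg a)

lemma mem_freeFam {s : ℕ} {deg : Fin s → ℤ} {j : ℤ} {v : Fin s → MvPolynomial (Fin n) k} :
    v ∈ freeFam deg j ↔ ∀ a, v a ∈ homogeneousPart k n (j - deg a) := by
  simp [freeFam, Submodule.mem_pi]

lemma isStable_freeFam {s : ℕ} (deg : Fin s → ℤ) :
    IsStable (varOp k n (Fin s → MvPolynomial (Fin n) k)) (freeFam deg) := by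
  intro a j m hm
  rw [mem_freeFam] at *
  intro b
  rw [add_sub_right_comm]
  exact X_mul_mem_homogeneousPart (hm b) a

lemma relVanishes_freeFam [CharZero k] {s : ℕ} (deg : Fin s → ℤ) (i : ℕ) (j : ℤ) :
    RelVanishes (varOp k n (Fin s → MvPolynomial (Fin n) k)) (freeFam deg) (fun _ => ⊥)
      (i + 1) j := by
  intro ω hω hc
  have hd : ∀ (i : ℕ) (a : Fin s)
      (ω : (Fin n → k) [⋀^Fin (i + 1)]→ₗ[k] (Fin s → MvPolynomial (Fin n) k)),
      koszulD (varOp k n (MvPolynomial (Fin n) k)) i ((LinearMap.proj a).compAlternatingMap ω) =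
        (LinearMap.proj a).compAlternatingMap
          (koszulD (varOp k n (Fin s → MvPolynomial (Fin n) k)) i ω) := fun i a ω =>
    koszulD_comp (X := varOp k n (Fin s → MvPolynomial (Fin n) k))
      (X' := varOp k n (MvPolynomial (Fin n) k)) (LinearMap.proj a) (fun _ _ => rfl) ω
  have h := fun a => relVanishes_homogeneousPart n i (j - deg a)
    ((LinearMap.proj a).compAlternatingMap ω) (fun v => mem_freeFam.1 (hω v) a)
    (mem_koszulTerm_bot.2 (by
      rw [hd, mem_koszulTerm_bot.1 hc]
      ext1 v
      simp))
  choose η hη hη' using h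
  refine ⟨AlternatingMap.pi η, fun v => mem_freeFam.2 fun a => ?_, mem_koszulTerm_bot.2 ?_⟩
  · rw [sub_right_comm]
    exact hη a v
  · ext1 v
    funext a
    have h1 := AlternatingMap.congr_fun (mem_koszulTerm_bot.1 (hη' a)) v
    have h2 := AlternatingMap.congr_fun (hd _ a (AlternatingMap.pi η)) v
    have h3 : (LinearMap.proj a).compAlternatingMap (AlternatingMap.pi η) = η a := by
      ext1 v
      rfl
    rw [h3] at h2
    rw [AlternatingMap.sub_apply, h2] at h1
    exact h1

section ZeroForms

variable {E : Type*} [AddCommGroup E] [Module k E]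

lemma koszulD_zero_apply (X : Fin n → Module.End k E)
    (ω : (Fin n → k) [⋀^Fin 1]→ₗ[k] E) (v) :
    koszulD X 0 ω v = ∑ a, X a (ω fun _ => Pi.single a 1) := by
  rw [koszulD_apply]
  refine Finset.sum_congr rfl fun a _ => ?_
  congr 2
  funext m
  rw [Subsingleton.elim m 0]
  rfl

lemma exists_oneForm (M : Submodule k E) (c : Fin n → E) (hc : ∀ a, c a ∈ M) :
    ∃ ω : (Fin n → k) [⋀^Fin 1]→ₗ[k] E, (∀ v, ω v ∈ M) ∧ ∀ a, ω (fun _ => Pi.single a 1) = c a := by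
  refine ⟨AlternatingMap.ofSubsingleton k (Fin n → k) E (0 : Fin 1)
    ((Pi.basisFun k (Fin n)).constr k c), fun v => ?_, fun a => ?_⟩
  · rw [AlternatingMap.ofSubsingleton_apply_apply, Module.Basis.constr_apply_fintype]
    exact Submodule.sum_mem _ fun a _ => M.smul_mem _ (hc a)
  · rw [AlternatingMap.ofSubsingleton_apply_apply]
    have := (Pi.basisFun k (Fin n)).constr_basis k c a
    rwa [Pi.basisFun_apply] at this

/-- A `0`-form with the given value. -/
lemma zeroForm_ext {ω η : (Fin n → k) [⋀^Fin 0]→ₗ[k] E} (h : ω 0 = η 0) : ω = η := by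
  ext v
  rw [Subsingleton.elim v 0, h]

lemma exists_zeroForm (e : E) : ∃ ω : (Fin n → k) [⋀^Fin 0]→ₗ[k] E, ∀ v, ω v = e :=
  ⟨AlternatingMap.constOfIsEmpty k (Fin n → k) (Fin 0) e, fun _ => rfl⟩

end ZeroForms

/-! ### Dimension shifting along graded free modules. -/

lemma exists_koszulD_freeFam {s : ℕ} {deg : Fin s → ℤ} {j : ℤ}
    (ζ : (Fin n → k) [⋀^Fin 0]→ₗ[k] (Fin s → MvPolynomial (Fin n) k))
    (hζ : ζ ∈ koszulTerm (k := k) n (freeFam deg) 0 (j + 1))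
    (h0 : ∀ v a, MvPolynomial.constantCoeff (ζ v a) = 0) :
    ∃ ω ∈ koszulTerm (k := k) n (freeFam deg) 1 j,
      koszulD (varOp k n (Fin s → MvPolynomial (Fin n) k)) 0 ω = ζ := by
  have := fun b => exists_eq_sum_X_mul (j := j - deg b)
    (by rw [← add_sub_right_comm]; exact mem_freeFam.1 (hζ 0) b) (h0 0 b)
  choose c hc hc' using this
  obtain ⟨ω, hω, hω'⟩ := exists_oneForm (freeFam deg j) (fun a b => c b a)
    (fun a => mem_freeFam.2 fun b => hc b a)
  refine ⟨ω, hω, zeroForm_ext ?_⟩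
  rw [koszulD_zero_apply]
  funext b
  rw [hc' b, Finset.sum_apply]
  refine Finset.sum_congr rfl fun a _ => ?_
  rw [hω']
  rfl

/-- The connecting map of `0 → Z → F → F/Z → 0`. Acyclicity of `F` settles positive exterior degree;
at the bottom, `Z ⊆ (x₁, …, x_n) F` makes every element of `Z` a boundary in `F`. This is where
minimality of a resolution enters. -/
lemma relVanishes_freeFam_iff [CharZero k] {s : ℕ} {deg : Fin s → ℤ}
    {Z : ℤ → Submodule k (Fin s → MvPolynomial (Fin n) k)} (hZ : ∀ j, Z j ≤ freeFam deg j)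
    (h0 : ∀ j, ∀ v ∈ Z j, ∀ a, MvPolynomial.constantCoeff (v a) = 0) {i : ℕ} {j : ℤ} :
    RelVanishes (varOp k n (Fin s → MvPolynomial (Fin n) k)) (freeFam deg) Z (i + 1) j ↔
      RelVanishes (varOp k n (Fin s → MvPolynomial (Fin n) k)) Z (fun _ => ⊥) i (j + 1) := by
  constructor
  · refine RelVanishes.sub varOp_comm fun ζ hζ hc => ?_
    cases i with
    | zero => exact exists_koszulD_freeFam ζ (koszulTerm_mono (hZ _) hζ) fun v => h0 _ _ (hζ v)
    | succ i =>
      obtain ⟨ω, hω, hω'⟩ := relVanishes_freeFam deg i (j + 1) ζ (koszulTerm_mono (hZ _) hζ) hc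
      rw [add_sub_cancel_right] at hω
      exact ⟨ω, hω, (sub_eq_zero.1 (mem_koszulTerm_bot.1 hω')).symm⟩
  · exact RelVanishes.quotient varOp_comm hZ (relVanishes_freeFam deg i j)

/-- The zeroth group of `F/Z` is `F/(Z + (x₁, …, x_n) F)`. As `Z` lies in the second summand this is
`F/(x₁, …, x_n) F`, which has the basis elements of degree `j` as a basis in degree `j`. -/
lemma relVanishes_freeFam_zero_iff {s : ℕ} {deg : Fin s → ℤ}
    {Z : ℤ → Submodule k (Fin s → MvPolynomial (Fin n) k)}
    (h0 : ∀ j, ∀ v ∈ Z j, ∀ a, MvPolynomial.constantCoeff (v a) = 0) {j : ℤ} :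
    RelVanishes (varOp k n (Fin s → MvPolynomial (Fin n) k)) (freeFam deg) Z 0 j ↔
      ∀ a, deg a ≠ j := by
  classical
  constructor
  · rintro h a rfl
    obtain ⟨ω, hω⟩ := exists_zeroForm (k := k) (n := n)
      (Pi.single a 1 : Fin s → MvPolynomial (Fin n) k)
    obtain ⟨η, hη, hη'⟩ := h ω (fun v => mem_freeFam.2 fun b => by
      rw [hω]
      by_cases hb : b = a
      · subst hb
        rw [Pi.single_eq_same, sub_self]
        exact MvPolynomial.isHomogeneous_one _ _
      · rw [Pi.single_eq_of_ne hb]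
        exact Submodule.zero_mem _) trivial
    have := h0 _ _ (hη' 0) a
    rw [AlternatingMap.sub_apply, koszulD_zero_apply, hω] at this
    simp at this
  · intro h ω hω _
    have hc : ∀ v a, MvPolynomial.constantCoeff (ω v a) = 0 := by
      intro v a
      by_contra hne
      have := mem_homogeneousPart.1 (mem_freeFam.1 (hω v) a) 0 hne
      simp only [map_zero, Nat.cast_zero] at this
      exact h a (by omega)
    obtain ⟨η, hη, rfl⟩ := exists_koszulD_freeFam (j := j - 1) ω
      (by rwa [sub_add_cancel]) hc
    exact ⟨η, hη, by rw [sub_self]; exact Submodule.zero_mem _⟩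

variable {I : Ideal (MvPolynomial (Fin n) k)}

namespace MinimalFreeResolution

/-- The graded pieces of the image of `F_{i+1} → F_i`. -/
def syzFam (F : MinimalFreeResolution (n := n) (quotientGrading I)) (i : ℕ) (j : ℤ) :
    Submodule k (Fin (F.rank i) → MvPolynomial (Fin n) k) :=
  freeFam (F.deg i) j ⊓ (LinearMap.range (F.d i)).restrictScalars k

variable (F : MinimalFreeResolution (n := n) (quotientGrading I))

/-- Homogeneous components of an element of a graded free module. -/
def freeComponent {s : ℕ} (deg : Fin s → ℤ) (j : ℤ) (v : Fin s → MvPolynomial (Fin n) k) :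
    Fin s → MvPolynomial (Fin n) k :=
  fun a => intComponent k n (j - deg a) (v a)

lemma freeComponent_mem {s : ℕ} (deg : Fin s → ℤ) (j : ℤ) (v : Fin s → MvPolynomial (Fin n) k) :
    freeComponent deg j v ∈ freeFam deg j := mem_freeFam.2 fun _ => intComponent_mem _ _

lemma freeComponent_eq_self {s : ℕ} {deg : Fin s → ℤ} {j : ℤ}
    {v : Fin s → MvPolynomial (Fin n) k} (hv : v ∈ freeFam deg j) : freeComponent deg j v = v :=
  funext fun a => intComponent_eq_self (mem_freeFam.1 hv a)

lemma map_eq_sum {s : ℕ} {N : Type*} [AddCommGroup N] [Module (MvPolynomial (Fin n) k) N]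
    (f : (Fin s → MvPolynomial (Fin n) k) →ₗ[MvPolynomial (Fin n) k] N)
    (v : Fin s → MvPolynomial (Fin n) k) : f v = ∑ a, v a • f (Pi.single a 1) := by
  conv_lhs => rw [← Finset.univ_sum_single v]
  rw [map_sum]
  refine Finset.sum_congr rfl fun a _ => ?_
  rw [← map_smul, ← Pi.single_smul, smul_eq_mul, mul_one]

lemma d_freeComponent (i : ℕ) (j : ℤ) (v) :
    F.d i (freeComponent (F.deg (i + 1)) j v) = freeComponent (F.deg i) j (F.d i v) := by
  funext b
  rw [freeComponent, map_eq_sum, map_eq_sum (F.d i) v, Finset.sum_apply, Finset.sum_apply, map_sum]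
  refine Finset.sum_congr rfl fun a _ => ?_
  simp only [Pi.smul_apply, smul_eq_mul, freeComponent]
  rw [intComponent_mul_of_mem (F.d_graded i a b)]
  congr 3
  ring

lemma constantCoeff_syzFam (i : ℕ) (j : ℤ) (v) (hv : v ∈ F.syzFam i j) (b) :
    MvPolynomial.constantCoeff (v b) = 0 := by
  obtain ⟨w, rfl⟩ := hv.2
  rw [map_eq_sum, Finset.sum_apply, map_sum]
  refine Finset.sum_eq_zero fun a _ => ?_
  rw [Pi.smul_apply, smul_eq_mul, map_mul, F.minimal, mul_zero]

lemma map_d_freeFam (i : ℕ) (j : ℤ) :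
    (freeFam (F.deg (i + 1)) j).map ((F.d i).restrictScalars k) = F.syzFam i j := by
  ext w
  constructor
  · rintro ⟨v, hv, rfl⟩
    refine ⟨?_, v, rfl⟩
    change F.d i v ∈ _
    rw [← freeComponent_eq_self hv, d_freeComponent]
    exact freeComponent_mem _ _ _
  · rintro ⟨hw, v, rfl⟩
    refine ⟨_, freeComponent_mem _ j v, ?_⟩
    change F.d i _ = _
    rw [d_freeComponent, freeComponent_eq_self hw]

/-- By exactness the differential identifies `F_{i+1}` modulo the next syzygies with the `i`-th
syzygies. -/
lemma relVanishes_step (i p : ℕ) (j : ℤ) :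
    RelVanishes (varOp k n _) (freeFam (F.deg (i + 1))) (F.syzFam (i + 1)) p j ↔
      RelVanishes (varOp k n _) (F.syzFam i) (fun _ => ⊥) p j := by
  have hker : ∀ j, ∀ m ∈ freeFam (F.deg (i + 1)) j,
      (F.d i).restrictScalars k m ∈ (⊥ : Submodule k _) ↔ m ∈ F.syzFam (i + 1) j := by
    intro j m hm
    rw [Submodule.mem_bot, LinearMap.coe_restrictScalars, ← LinearMap.mem_ker, F.exact_succ]
    exact ⟨fun h => ⟨hm, h⟩, fun h => h.2⟩
  have hlin : ∀ (a : Fin n) (m), (F.d i).restrictScalars k (varOp k n _ a m) =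
      varOp k n _ a ((F.d i).restrictScalars k m) := fun a m => map_smul (F.d i) _ m
  exact ⟨RelVanishes.map _ hlin (isStable_freeFam _) (F.map_d_freeFam i) hker,
    RelVanishes.of_map _ hlin (isStable_freeFam _) (F.map_d_freeFam i) hker fun _ => inf_le_left⟩

/-- Each step down the resolution trades one unit of internal degree for one unit of exterior
degree, so that `i` steps connect the generators of `F_i` with the `i`-th Koszul group of the
resolved module. -/
lemma relVanishes_shift [CharZero k] (i p : ℕ) (j : ℤ) :
    RelVanishes (varOp k n _) (freeFam (F.deg i)) (F.syzFam i) p (j + i) ↔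
      RelVanishes (varOp k n _) (freeFam (F.deg 0)) (F.syzFam 0) (p + i) j := by
  induction i generalizing p with
  | zero => simp
  | succ i ih =>
    rw [relVanishes_step, show p + (i + 1) = (p + 1) + i by ring, ← ih,
      relVanishes_freeFam_iff (Z := F.syzFam i) (fun _ => inf_le_left) (F.constantCoeff_syzFam i)]
    push_cast
    rw [add_assoc]

lemma map_aug_freeFam (hI : IsHomog I) (j : ℤ) :
    (freeFam (F.deg 0) j).map (F.aug.restrictScalars k) = quotientGrading I j := by
  have h := F.aug_graded
  choose f hf hf' using h
  have haug : ∀ v, F.aug v = Ideal.Quotient.mk I (∑ a, v a * f a) := by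
    intro v
    rw [map_eq_sum, map_sum]
    refine Finset.sum_congr rfl fun a _ => ?_
    rw [← hf' a, map_mul]
    rfl
  -- After lifting the images of the basis to homogeneous polynomials `f a`, the augmentation
  -- commutes with taking components. A preimage of a homogeneous class may then be replaced by its
  -- component of degree `j`.
  have hcomp : ∀ v, ∑ a, freeComponent (F.deg 0) j v a * f a =
      intComponent k n j (∑ a, v a * f a) := by
    intro v
    rw [map_sum]
    refine Finset.sum_congr rfl fun a _ => ?_
    rw [intComponent_mul_of_mem (hf a)]
    rfl
  ext q
  constructor
  · rintro ⟨v, hv, rfl⟩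
    refine ⟨∑ a, v a * f a, ?_, (haug v).symm⟩
    rw [← freeComponent_eq_self hv, hcomp]
    exact intComponent_mem _ _
  · rintro ⟨g, hg, rfl⟩
    obtain ⟨v, hv⟩ := F.aug_surjective (Ideal.Quotient.mk I g)
    refine ⟨_, freeComponent_mem _ j v, ?_⟩
    change F.aug _ = Ideal.Quotient.mk I g
    rw [haug, hcomp]
    rw [haug, Ideal.Quotient.eq] at hv
    rw [Ideal.Quotient.eq]
    have := hI.intComponent_mem hv j
    rwa [map_sub, intComponent_eq_self hg] at this

lemma relVanishes_aug (hI : IsHomog I) (p : ℕ) (j : ℤ) :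
    RelVanishes (varOp k n _) (freeFam (F.deg 0)) (F.syzFam 0) p j ↔
      RelVanishes (varOp k n _) (quotientGrading I) (fun _ => ⊥) p j := by
  have hker : ∀ j, ∀ m ∈ freeFam (F.deg 0) j,
      F.aug.restrictScalars k m ∈ (⊥ : Submodule k _) ↔ m ∈ F.syzFam 0 j := by
    intro j m hm
    rw [Submodule.mem_bot, LinearMap.coe_restrictScalars, ← LinearMap.mem_ker, F.exact_zero]
    exact ⟨fun h => ⟨hm, h⟩, fun h => h.2⟩
  have hlin : ∀ (a : Fin n) (m), F.aug.restrictScalars k (varOp k n _ a m) =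
      varOp k n _ a (F.aug.restrictScalars k m) := fun a m => map_smul F.aug _ m
  exact ⟨RelVanishes.map _ hlin (isStable_freeFam _) (F.map_aug_freeFam hI) hker,
    RelVanishes.of_map _ hlin (isStable_freeFam _) (F.map_aug_freeFam hI) hker fun _ => inf_le_left⟩

end MinimalFreeResolution

/-! ### Koszul cohomology of the quotient ring and of the ideal. -/

lemma relVanishes_quotientGrading_iff (p : ℕ) (j : ℤ) :
    RelVanishes (varOp k n _) (quotientGrading I) (fun _ => ⊥) p j ↔
      RelVanishes (varOp k n (MvPolynomial (Fin n) k)) (homogeneousPart k n) (idealFam I) p j := by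
  have hst : IsStable (varOp k n (MvPolynomial (Fin n) k)) (homogeneousPart k n) :=
    fun a _ _ hm => X_mul_mem_homogeneousPart hm a
  have hker : ∀ j, ∀ m ∈ homogeneousPart k n j,
      (Ideal.Quotient.mkₐ k I).toLinearMap m ∈ (⊥ : Submodule k _) ↔ m ∈ idealFam I j := by
    intro j m hm
    rw [Submodule.mem_bot, AlgHom.toLinearMap_apply, Ideal.Quotient.mkₐ_eq_mk,
      Ideal.Quotient.eq_zero_iff_mem]
    exact ⟨fun h => ⟨hm, h⟩, fun h => h.2⟩
  have hlin : ∀ (a : Fin n) (m), (Ideal.Quotient.mkₐ k I).toLinearMap (varOp k n _ a m) =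
      varOp k n _ a ((Ideal.Quotient.mkₐ k I).toLinearMap m) := fun a m => rfl
  exact ⟨RelVanishes.of_map _ hlin hst (fun _ => rfl) hker fun _ => inf_le_left,
    RelVanishes.map _ hlin hst (fun _ => rfl) hker⟩

lemma exists_koszulD_homogeneousPart {j : ℤ} (ζ : (Fin n → k) [⋀^Fin 0]→ₗ[k] MvPolynomial (Fin n) k)
    (hζ : ζ ∈ koszulTerm n (homogeneousPart k n) 0 (j + 1))
    (h0 : ∀ v, MvPolynomial.constantCoeff (ζ v) = 0) :
    ∃ ω ∈ koszulTerm n (homogeneousPart k n) 1 j,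
      koszulD (varOp k n (MvPolynomial (Fin n) k)) 0 ω = ζ := by
  obtain ⟨c, hc, hc'⟩ := exists_eq_sum_X_mul (hζ 0) (h0 0)
  obtain ⟨ω, hω, hω'⟩ := exists_oneForm (homogeneousPart k n j) c hc
  refine ⟨ω, hω, zeroForm_ext ?_⟩
  rw [koszulD_zero_apply, hc']
  simp [hω']

/-- Dimension shift for `0 → I → S → S/I → 0`. The condition on constant coefficients is what makes
elements of `I` boundaries in `S` at the bottom of the complex. -/
lemma relVanishes_homogeneousPart_idealFam_iff [CharZero k]
    (h0 : ∀ f ∈ I, MvPolynomial.constantCoeff f = 0) (p : ℕ) (j : ℤ) :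
    RelVanishes (varOp k n (MvPolynomial (Fin n) k)) (homogeneousPart k n) (idealFam I) (p + 1) j ↔
      RelVanishes (varOp k n (MvPolynomial (Fin n) k)) (idealFam I) (fun _ => ⊥) p (j + 1) := by
  constructor
  · refine RelVanishes.sub varOp_comm fun ζ hζ hc => ?_
    cases p with
    | zero =>
      exact exists_koszulD_homogeneousPart ζ (koszulTerm_mono inf_le_left hζ)
        fun v => h0 _ (hζ v).2
    | succ p =>
      obtain ⟨ω, hω, hω'⟩ := relVanishes_homogeneousPart n p (j + 1) ζ
        (koszulTerm_mono inf_le_left hζ) hc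
      rw [add_sub_cancel_right] at hω
      exact ⟨ω, hω, (sub_eq_zero.1 (mem_koszulTerm_bot.1 hω')).symm⟩
  · exact RelVanishes.quotient varOp_comm (fun _ => inf_le_left) (relVanishes_homogeneousPart n p j)

lemma relVanishes_homogeneousPart_idealFam_zero_iff
    (h0 : ∀ f ∈ I, MvPolynomial.constantCoeff f = 0) (j : ℤ) :
    RelVanishes (varOp k n (MvPolynomial (Fin n) k)) (homogeneousPart k n) (idealFam I) 0 j ↔
      j ≠ 0 := by
  constructor
  · rintro h rfl
    obtain ⟨ω, hω⟩ := exists_zeroForm (k := k) (n := n) (1 : MvPolynomial (Fin n) k)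
    obtain ⟨η, hη, hη'⟩ := h ω (fun v => by
      rw [hω]
      exact MvPolynomial.isHomogeneous_one _ _) trivial
    have := h0 _ (hη' 0).2
    rw [AlternatingMap.sub_apply, koszulD_zero_apply, hω] at this
    simp at this
  · intro h ω hω _
    have hc : ∀ v, MvPolynomial.constantCoeff (ω v) = 0 := by
      intro v
      by_contra hne
      have := mem_homogeneousPart.1 (hω v) 0 hne
      simp only [map_zero, Nat.cast_zero] at this
      exact h this.symm
    obtain ⟨η, hη, rfl⟩ := exists_koszulD_homogeneousPart (j := j - 1) ω
      (by rwa [sub_add_cancel]) hc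
    exact ⟨η, hη, by rw [sub_self]; exact Submodule.zero_mem _⟩

/-- Both sides detect `Tor_i(S/I, k)` in degree `i + j`: on the left through the minimal resolution
of `S/I`, on the right through the Koszul resolution of `k`. -/
lemma betti_natCast_eq_zero_iff [CharZero k] (hI : IsHomog I)
    (F : MinimalFreeResolution (n := n) (quotientGrading I)) (i : ℕ) (j : ℤ) :
    F.betti i j = 0 ↔
      RelVanishes (varOp k n (MvPolynomial (Fin n) k)) (homogeneousPart k n) (idealFam I) i j := by
  have h1 : F.betti i j = Fintype.card {a : Fin (F.rank i) // F.deg i a = i + j} := rfl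
  rw [h1, Fintype.card_eq_zero_iff, isEmpty_subtype, ← relVanishes_quotientGrading_iff,
    ← F.relVanishes_aug hI]
  have h2 := F.relVanishes_shift i 0 j
  rw [zero_add] at h2
  rw [← h2, relVanishes_freeFam_zero_iff (F.constantCoeff_syzFam i), add_comm j]

/-- `β_{0,j}` vanishes exactly for `j ≠ 0`. -/
lemma betti_zero_eq_zero_iff [CharZero k] (hI : IsHomog I)
    (h0 : ∀ f ∈ I, MvPolynomial.constantCoeff f = 0)
    (F : MinimalFreeResolution (n := n) (quotientGrading I)) (j : ℤ) :
    F.betti 0 j = 0 ↔ j ≠ 0 := by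
  rw [← relVanishes_homogeneousPart_idealFam_zero_iff h0 j]
  exact betti_natCast_eq_zero_iff hI F 0 j

/-- `β_{i+1,j}(S / I)` vanishes if and only if `K_{i,j+1}(I)` does. -/
lemma betti_succ_eq_zero_iff [CharZero k] (hI : IsHomog I)
    (h0 : ∀ f ∈ I, MvPolynomial.constantCoeff f = 0)
    (F : MinimalFreeResolution (n := n) (quotientGrading I)) (i : ℕ) (j : ℤ) :
    F.betti (i + 1) j = 0 ↔ KoszulVanishes I i (j + 1) := by
  rw [koszulVanishes_iff, ← relVanishes_homogeneousPart_idealFam_iff h0]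
  exact betti_natCast_eq_zero_iff hI F (i + 1) j

/-- Transfer of the vanishing of Betti numbers from the vanishing of Koszul cohomology. -/
lemma betti_eq_zero_of_koszulVanishes [CharZero k] {m p : ℕ}
    {J : Ideal (MvPolynomial (Fin m) k)} {K : Ideal (MvPolynomial (Fin p) k)}
    (hI : IsHomog I) (hI0 : ∀ f ∈ I, MvPolynomial.constantCoeff f = 0)
    (hJ : IsHomog J) (hJ0 : ∀ f ∈ J, MvPolynomial.constantCoeff f = 0)
    (hK : IsHomog K) (hK0 : ∀ f ∈ K, MvPolynomial.constantCoeff f = 0)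
    (H : ∀ i j : ℤ, KoszulVanishes K i (j - 1) → KoszulVanishes J (i - 1) j →
      KoszulVanishes J i j → KoszulVanishes I i j)
    (F : MinimalFreeResolution (n := n) (quotientGrading I))
    (FJ : MinimalFreeResolution (n := m) (quotientGrading J))
    (FK : MinimalFreeResolution (n := p) (quotientGrading K)) (i j : ℤ)
    (h1 : FK.betti i (j - 1) = 0) (h2 : FJ.betti (i - 1) j = 0) (h3 : FJ.betti i j = 0) :
    F.betti i j = 0 := by
  rcases lt_or_ge i 0 with hi | hi
  · obtain ⟨i, rfl⟩ := Int.eq_negSucc_of_lt_zero hi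
    rfl
  obtain ⟨i, rfl⟩ := Int.eq_ofNat_of_zero_le hi
  cases i with
  -- In homological degree zero both rings have a single generator, in degree zero, so the numbers
  -- `β_{0,j}` vanish together.
  | zero => exact (betti_zero_eq_zero_iff hI hI0 F j).2 ((betti_zero_eq_zero_iff hJ hJ0 FJ j).1 h3)
  | succ i =>
    push_cast at *
    rw [betti_succ_eq_zero_iff hI hI0]
    rw [betti_succ_eq_zero_iff hJ hJ0] at h3
    rw [betti_succ_eq_zero_iff hK hK0] at h1
    refine H _ _ ?_ ?_ h3
    · rwa [add_sub_cancel_right, ← sub_add_cancel j 1]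
    · cases i with
      | zero => trivial
      | succ i =>
        rw [add_sub_cancel_right] at h2
        push_cast at *
        rw [betti_succ_eq_zero_iff hJ hJ0] at h2
        rwa [add_sub_cancel_right]

end Betti
end
end SecantBetti

namespace SecantBetti
noncomputable section

/-! ### Vanishing ideals of cones, sums of cones and secant varieties -/

section Cones

open scoped Pointwise
open MvPolynomial (vanishingIdeal eval)

variable {k : Type*} [Field k] {n m : ℕ}

lemma mem_vanishing {σ : Type*} {V : Set (σ → k)} {f : MvPolynomial σ k} :
    f ∈ vanishingIdeal k V ↔ ∀ x ∈ V, eval x f = 0 := Iff.rfl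

lemma aeval_smul_of_isHomogeneous {σ R : Type*} [Finite σ] [CommRing R] [Algebra k R]
    {f : MvPolynomial σ k} {d : ℕ} (hf : f.IsHomogeneous d) (c : R) (x : σ → R) :
    MvPolynomial.aeval (fun a => c * x a) f = c ^ d * MvPolynomial.aeval x f := by
  cases nonempty_fintype σ
  rw [MvPolynomial.aeval_def, MvPolynomial.aeval_def, MvPolynomial.eval₂_eq', MvPolynomial.eval₂_eq',
    Finset.mul_sum]
  refine Finset.sum_congr rfl fun u hu => ?_
  have hd : ∑ a, u a = d := by
    have := hf.degree_eq_sum_deg_support hu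
    rw [this, ← Finsupp.degree_apply, Finsupp.degree_eq_sum]
  simp only [mul_pow, Finset.prod_mul_distrib, Finset.prod_pow_eq_pow_sum, hd]
  ring

lemma eval_smul_of_isHomogeneous {f : MvPolynomial (Fin n) k} {d : ℕ} (hf : f.IsHomogeneous d)
    (c : k) (x : Fin n → k) : eval (c • x) f = c ^ d * eval x f :=
  aeval_smul_of_isHomogeneous hf c x

/-- Closed under scalars and nonempty. -/
def IsCone (V : Set (Fin n → k)) : Prop := 0 ∈ V ∧ ∀ (c : k), ∀ v ∈ V, c • v ∈ V

lemma mk_smul_mem_iff {X : Set (ℙ k (Fin n → k))} {w : Fin n → k} (c : k) (hc : c • w ≠ 0)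
    (hw : w ≠ 0) : Projectivization.mk k (c • w) hc ∈ X ↔ Projectivization.mk k w hw ∈ X := by
  have : Projectivization.mk k (c • w) hc = Projectivization.mk k w hw :=
    (Projectivization.mk_eq_mk_iff' k _ _ _ _).2 ⟨c, rfl⟩
  rw [this]

lemma isCone_affineCone (X : Set (ℙ k (Fin n → k))) : IsCone (affineCone X) := by
  refine ⟨fun h => absurd rfl h, fun c v hv hcv => ?_⟩
  have hv0 : v ≠ 0 := by
    rintro rfl
    simp at hcv
  rw [mk_smul_mem_iff c hcv hv0]
  exact hv hv0

lemma rep_mem_affineCone {X : Set (ℙ k (Fin n → k))} {z : ℙ k (Fin n → k)} :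
    z.rep ∈ affineCone X ↔ z ∈ X := by
  constructor
  · intro h
    have := h z.rep_nonzero
    rwa [Projectivization.mk_rep] at this
  · intro h _
    rwa [Projectivization.mk_rep]

lemma IsCone.constantCoeff_eq_zero {V : Set (Fin n → k)} (hV : IsCone V) :
    ∀ f ∈ vanishingIdeal k V, MvPolynomial.constantCoeff f = 0 := by
  intro f hf
  have := mem_vanishing.1 hf 0 hV.1
  rwa [MvPolynomial.eval_zero] at this

/-- For `x` in the cone, `f(c x)` is a polynomial in `c` with infinitely many zeros, and its
coefficients are the homogeneous components of `f` at `x`. -/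
lemma IsCone.isHomog [Infinite k] {V : Set (Fin n → k)} (hV : IsCone V) :
    IsHomog (vanishingIdeal k V) := by
  intro f hf d
  rw [mem_vanishing] at *
  intro x hx
  let p : Polynomial k := ∑ e ∈ Finset.range (f.totalDegree + 1),
    Polynomial.C (eval x (MvPolynomial.homogeneousComponent e f)) * Polynomial.X ^ e
  have hp : p = 0 := by
    refine Polynomial.funext fun c => ?_
    have h1 := hf (c • x) (hV.2 c x hx)
    rw [← MvPolynomial.sum_homogeneousComponent f, map_sum] at h1
    rw [Polynomial.eval_finsetSum, Polynomial.eval_zero, ← h1]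
    refine Finset.sum_congr rfl fun e _ => ?_
    rw [eval_smul_of_isHomogeneous (MvPolynomial.homogeneousComponent_isHomogeneous e f)]
    rw [Polynomial.eval_mul, Polynomial.eval_C, Polynomial.eval_pow, Polynomial.eval_X, mul_comm]
  by_cases hd : f.totalDegree < d
  · rw [MvPolynomial.homogeneousComponent_eq_zero _ _ hd, map_zero]
  · have h2 : p.coeff d = 0 := by rw [hp, Polynomial.coeff_zero]
    rw [Polynomial.finsetSum_coeff] at h2
    simp only [Polynomial.coeff_C_mul, Polynomial.coeff_X_pow, mul_ite, mul_one, mul_zero] at h2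
    rw [Finset.sum_ite_eq, if_pos (Finset.mem_range.2 (by omega))] at h2
    exact h2

lemma isClosed_projZeroLocus {F : Set (MvPolynomial (Fin n) k)}
    (hF : ∀ f ∈ F, ∃ d : ℕ, f.IsHomogeneous d) : IsClosed (projZeroLocus F) := by
  rw [← isOpen_compl_iff]
  change (projZeroLocus F)ᶜᶜ ∈ _
  rw [compl_compl]
  exact ⟨F, hF, rfl⟩

lemma eval_rep_eq_zero_iff {f : MvPolynomial (Fin n) k} {d : ℕ} (hf : f.IsHomogeneous d)
    {w : Fin n → k} (hw : w ≠ 0) :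
    eval (Projectivization.mk k w hw).rep f = 0 ↔ eval w f = 0 := by
  obtain ⟨a, ha⟩ := Projectivization.exists_smul_eq_mk_rep k w hw
  rw [← ha, Units.smul_def, eval_smul_of_isHomogeneous hf, mul_eq_zero, or_iff_right]
  exact pow_ne_zero _ a.ne_zero

lemma affineCone_mono {X Y : Set (ℙ k (Fin n → k))} (h : X ⊆ Y) : affineCone X ⊆ affineCone Y :=
  fun _ hw hw0 => h (hw hw0)

/-- The components of a polynomial vanishing on the cone are forms that cut out a closed set
containing `Y`. Closures can thus be dropped from secant varieties and projections once only ideals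
matter. -/
lemma vanishingIdeal_affineCone_closure [Infinite k] (Y : Set (ℙ k (Fin n → k))) :
    vanishingIdeal k (affineCone (closure Y)) = vanishingIdeal k (affineCone Y) := by
  refine le_antisymm (MvPolynomial.vanishingIdeal_anti_mono (affineCone_mono subset_closure)) ?_
  intro f hf
  have hcomp := (isCone_affineCone Y).isHomog f hf
  have hcl : closure Y ⊆
      projZeroLocus (Set.range fun d => MvPolynomial.homogeneousComponent d f) := by
    refine closure_minimal ?_ (isClosed_projZeroLocus ?_)
    · rintro z hz _ ⟨d, rfl⟩
      exact mem_vanishing.1 (hcomp d) _ (rep_mem_affineCone.2 hz)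
    · rintro _ ⟨d, rfl⟩
      exact ⟨d, MvPolynomial.homogeneousComponent_isHomogeneous d f⟩
  rw [mem_vanishing]
  intro w hw
  by_cases hw0 : w = 0
  · rw [hw0]
    exact mem_vanishing.1 hf 0 (isCone_affineCone Y).1
  · rw [← MvPolynomial.sum_homogeneousComponent f, map_sum]
    refine Finset.sum_eq_zero fun d _ => ?_
    exact (eval_rep_eq_zero_iff (MvPolynomial.homogeneousComponent_isHomogeneous d f) hw0).1
      (hcl (hw hw0) _ ⟨d, rfl⟩)

lemma isPrime_vanishingIdeal_affineCone [Infinite k] {X : Set (ℙ k (Fin n → k))}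
    (hX : IsIrreducible X) : (vanishingIdeal k (affineCone X)).IsPrime := by
  let _ := MvPolynomial.gradedAlgebra (σ := Fin n) (R := k)
  have hhom : (vanishingIdeal k (affineCone X)).IsHomogeneous
      (MvPolynomial.homogeneousSubmodule (Fin n) k) := by
    intro d f hf
    have := (isCone_affineCone X).isHomog f hf d
    rwa [← MvPolynomial.decomposition.decompose'_apply] at this
  obtain ⟨z, hz⟩ := hX.nonempty
  refine hhom.isPrime_of_homogeneous_mem_or_mem ?_ ?_
  · rw [Ideal.ne_top_iff_one]
    intro h
    simpa using mem_vanishing.1 h 0 (isCone_affineCone X).1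
  · rintro f g ⟨d, hf⟩ ⟨e, hg⟩ hfg
    have hmem : ∀ {f : MvPolynomial (Fin n) k} {d : ℕ}, f.IsHomogeneous d →
        X ⊆ projZeroLocus {f} → f ∈ vanishingIdeal k (affineCone X) := by
      intro f d hf hXf
      have hne : ∀ w ∈ affineCone X, w ≠ 0 → eval w f = 0 := fun w hw hw0 =>
        (eval_rep_eq_zero_iff hf hw0).1 (hXf (hw hw0) f rfl)
      rw [mem_vanishing]
      intro w hw
      -- The origin needs an argument of its own because the forms may have degree zero; it is
      -- reached as `0 • z.rep` for an actual point `z` of `X`.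
      by_cases hw0 : w = 0
      · have h1 := hne z.rep (rep_mem_affineCone.2 hz) z.rep_nonzero
        rw [hw0, ← zero_smul k z.rep, eval_smul_of_isHomogeneous hf, h1, mul_zero]
      · exact hne w hw hw0
    have hcl : ∀ {f : MvPolynomial (Fin n) k} {d : ℕ}, f.IsHomogeneous d →
        IsClosed (projZeroLocus {f}) := by
      intro f d hf
      refine isClosed_projZeroLocus ?_
      rintro _ rfl
      exact ⟨d, hf⟩
    rcases isPreirreducible_iff_isClosed_union_isClosed.1 hX.isPreirreducible _ _ (hcl hf) (hcl hg) (by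
      intro z hz
      have := mem_vanishing.1 hfg z.rep (rep_mem_affineCone.2 hz)
      rw [map_mul, mul_eq_zero] at this
      rcases this with h | h
      · left
        rintro _ rfl
        exact h
      · right
        rintro _ rfl
        exact h) with h | h
    · exact Or.inl (hmem hf h)
    · exact Or.inr (hmem hg h)

/-! #### Sums of sets -/

/-- The polynomial `f(x + b)`. -/
def translate (b : Fin n → k) : MvPolynomial (Fin n) k →ₐ[k] MvPolynomial (Fin n) k :=
  MvPolynomial.aeval fun a => MvPolynomial.X a + MvPolynomial.C (b a)

@[simp] lemma eval_translate (b x : Fin n → k) (f : MvPolynomial (Fin n) k) :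
    eval x (translate b f) = eval (x + b) f := by
  have : (MvPolynomial.aeval (R := k) x).comp (translate b) = MvPolynomial.aeval (x + b) := by
    apply MvPolynomial.algHom_ext
    intro a
    simp [translate]
  exact DFunLike.congr_fun this f

/-- One summand is exchanged at a time: with the other summand fixed, a translate of the polynomial
lies in the ideal of the first. -/
lemma vanishingIdeal_add_congr {A A' B B' : Set (Fin n → k)}
    (hA : vanishingIdeal k A = vanishingIdeal k A')
    (hB : vanishingIdeal k B = vanishingIdeal k B') :
    vanishingIdeal k (A + B) = vanishingIdeal k (A' + B') := by
  have key : ∀ {A A' B B' : Set (Fin n → k)}, vanishingIdeal k A = vanishingIdeal k A' →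
      vanishingIdeal k B = vanishingIdeal k B' →
      vanishingIdeal k (A + B) ≤ vanishingIdeal k (A' + B') := by
    intro A A' B B' hA hB f hf
    rw [mem_vanishing] at *
    have h1 : ∀ a ∈ A', ∀ b ∈ B, eval (a + b) f = 0 := by
      intro a ha b hb
      have : translate b f ∈ vanishingIdeal k A' := by
        rw [← hA, mem_vanishing]
        intro x hx
        rw [eval_translate]
        exact hf _ (Set.add_mem_add hx hb)
      simpa using mem_vanishing.1 this a ha
    rintro _ ⟨a, ha, b, hb, rfl⟩
    have : translate a f ∈ vanishingIdeal k B' := by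
      rw [← hB, mem_vanishing]
      intro x hx
      rw [eval_translate, add_comm]
      exact h1 a ha x hx
    have := mem_vanishing.1 this b hb
    rwa [eval_translate, add_comm] at this
  exact le_antisymm (key hA hB) (key hA.symm hB.symm)

/-- Primality in geometric form: two nonempty open subsets of `V` meet. General position choices
rest on this. -/
lemma exists_eval_ne_zero {σ : Type*} {V : Set (σ → k)} (hV : (vanishingIdeal k V).IsPrime)
    {f g : MvPolynomial σ k} {a b : σ → k} (ha : a ∈ V) (hb : b ∈ V) (hf : eval a f ≠ 0)
    (hg : eval b g ≠ 0) : ∃ c ∈ V, eval c f ≠ 0 ∧ eval c g ≠ 0 := by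
  by_contra hcon
  push Not at hcon
  have : f * g ∈ vanishingIdeal k V := by
    rw [mem_vanishing]
    intro x hx
    rw [map_mul, mul_eq_zero]
    exact or_iff_not_imp_left.2 (hcon x hx)
  rcases hV.mem_or_mem this with h | h
  · exact hf (mem_vanishing.1 h a ha)
  · exact hg (mem_vanishing.1 h b hb)

lemma isPrime_vanishingIdeal_of_exists {σ : Type*} {V : Set (σ → k)} (hne : V.Nonempty)
    (h : ∀ f g : MvPolynomial σ k, ∀ a ∈ V, ∀ b ∈ V, eval a f ≠ 0 → eval b g ≠ 0 →
      ∃ c ∈ V, eval c f ≠ 0 ∧ eval c g ≠ 0) : (vanishingIdeal k V).IsPrime := by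
  refine ⟨?_, fun {f g} hfg => ?_⟩
  · rw [Ideal.ne_top_iff_one]
    intro h1
    obtain ⟨a, ha⟩ := hne
    simpa using mem_vanishing.1 h1 a ha
  · by_contra hcon
    simp only [mem_vanishing, not_or, not_forall] at hcon
    obtain ⟨⟨a, ha, hfa⟩, b, hb, hgb⟩ := hcon
    obtain ⟨c, hc, h1, h2⟩ := h f g a ha b hb hfa hgb
    have := mem_vanishing.1 hfg c hc
    rw [map_mul] at this
    exact mul_ne_zero h1 h2 this

lemma nonempty_of_isPrime {σ : Type*} {V : Set (σ → k)} (hV : (vanishingIdeal k V).IsPrime) :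
    V.Nonempty := by
  rw [Set.nonempty_iff_ne_empty]
  rintro rfl
  exact hV.ne_top MvPolynomial.vanishingIdeal_empty

/-- Two nonvanishing conditions on `A + B` are met simultaneously by moving the first summand within
`A`, with the second summands `b`, `b'` fixed, and then the second within `B`. -/
lemma isPrime_vanishingIdeal_add {A B : Set (Fin n → k)} (hA : (vanishingIdeal k A).IsPrime)
    (hB : (vanishingIdeal k B).IsPrime) : (vanishingIdeal k (A + B)).IsPrime := by
  refine isPrime_vanishingIdeal_of_exists ((nonempty_of_isPrime hA).add (nonempty_of_isPrime hB)) ?_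
  rintro f g _ ⟨a, ha, b, hb, rfl⟩ _ ⟨a', ha', b', hb', rfl⟩ hf hg
  obtain ⟨c, hc, h1, h2⟩ := exists_eval_ne_zero hA (f := translate b f) (g := translate b' g) ha ha'
    (by simpa using hf) (by simpa using hg)
  obtain ⟨d, hd, h3, h4⟩ := exists_eval_ne_zero hB (f := translate c f) (g := translate c g) hb hb'
    (by rw [eval_translate] at *; rwa [add_comm]) (by rw [eval_translate] at *; rwa [add_comm])
  exact ⟨c + d, Set.add_mem_add hc hd, by rw [eval_translate, add_comm] at h3; exact h3,
    by rw [eval_translate, add_comm] at h4; exact h4⟩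

lemma vanishingIdeal_image (φ : (Fin n → k) →ₗ[k] (Fin m → k)) (A : Set (Fin n → k)) :
    vanishingIdeal k (φ '' A) = (vanishingIdeal k A).comap (pull φ) := by
  ext f
  rw [Ideal.mem_comap, mem_vanishing, mem_vanishing]
  simp

/-- The set of sums of `q` elements of `V`. -/
def sumSet (q : ℕ) (V : Set (Fin n → k)) : Set (Fin n → k) :=
  Nat.rec {0} (fun _ W => V + W) q

@[simp] lemma sumSet_zero (V : Set (Fin n → k)) : sumSet 0 V = {0} := rfl

@[simp] lemma sumSet_succ (q : ℕ) (V : Set (Fin n → k)) : sumSet (q + 1) V = V + sumSet q V := rfl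

lemma sum_mem_sumSet {q : ℕ} {V : Set (Fin n → k)} {x : Fin q → Fin n → k} (hx : ∀ a, x a ∈ V) :
    ∑ a, x a ∈ sumSet q V := by
  induction q with
  | zero => simp
  | succ q ih =>
    rw [Fin.sum_univ_succ]
    exact Set.add_mem_add (hx 0) (ih fun a => hx a.succ)

lemma IsCone.add {A B : Set (Fin n → k)} (hA : IsCone A) (hB : IsCone B) : IsCone (A + B) := by
  refine ⟨⟨0, hA.1, 0, hB.1, add_zero 0⟩, ?_⟩
  rintro c _ ⟨a, ha, b, hb, rfl⟩
  exact ⟨c • a, hA.2 c a ha, c • b, hB.2 c b hb, (smul_add c a b).symm⟩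

lemma IsCone.sumSet {V : Set (Fin n → k)} (hV : IsCone V) (q : ℕ) : IsCone (sumSet q V) := by
  induction q with
  | zero => exact ⟨rfl, by rintro c _ rfl; exact smul_zero c⟩
  | succ q ih => exact hV.add ih

lemma isPrime_vanishingIdeal_singleton (x : Fin n → k) : (vanishingIdeal k {x}).IsPrime := by
  infer_instance

lemma isPrime_vanishingIdeal_sumSet {V : Set (Fin n → k)} (hV : (vanishingIdeal k V).IsPrime)
    (q : ℕ) : (vanishingIdeal k (sumSet q V)).IsPrime := by
  induction q with
  | zero => exact isPrime_vanishingIdeal_singleton 0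
  | succ q ih => exact isPrime_vanishingIdeal_add hV ih

lemma vanishingIdeal_sumSet_congr {V V' : Set (Fin n → k)}
    (h : vanishingIdeal k V = vanishingIdeal k V') (q : ℕ) :
    vanishingIdeal k (sumSet q V) = vanishingIdeal k (sumSet q V') := by
  induction q with
  | zero => rfl
  | succ q ih => exact vanishingIdeal_add_congr h ih

lemma image_sumSet (φ : (Fin n → k) →ₗ[k] (Fin m → k)) (q : ℕ) (V : Set (Fin n → k)) :
    φ '' sumSet q V = sumSet q (φ '' V) := by
  induction q with
  | zero => simp
  | succ q ih => rw [sumSet_succ, sumSet_succ, Set.image_add, ih]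

/-! ### Secant varieties as sums of cones, and their projections. -/

/-- Spanning cones have full sets of sums. -/
lemma sumSet_eq_univ {V : Set (Fin n → k)} (hV : IsCone V) (hspan : Submodule.span k V = ⊤) {q : ℕ}
    (hq : n ≤ q) : sumSet q V = Set.univ := by
  obtain ⟨e, rfl⟩ := Nat.exists_eq_add_of_le' hq
  induction e with
  | zero =>
    rw [zero_add]
    obtain ⟨b, hbV, hspanb, hli⟩ := exists_linearIndependent k V
    have hb : Submodule.span k b = ⊤ := hspanb.trans hspan
    let B := Module.Basis.mk hli (by rw [Subtype.range_coe, hb])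
    have : Finite b := Module.Finite.finite_basis B
    have := Fintype.ofFinite b
    have hcard : Fintype.card b = n := by
      rw [← Module.finrank_eq_card_basis B, Module.finrank_fin_fun]
    let e : Fin n ≃ b := (Fintype.equivFinOfCardEq hcard).symm
    refine Set.eq_univ_of_forall fun w => ?_
    rw [← B.sum_repr w, ← Equiv.sum_comp e]
    refine sum_mem_sumSet fun a => hV.2 _ _ ?_
    simpa [B] using hbV (e a).2
  | succ e ih =>
    rw [show e + 1 + n = e + n + 1 by ring, sumSet_succ, ih (by omega)]
    refine Set.eq_univ_of_forall fun w => ⟨0, hV.1, w, trivial, zero_add w⟩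

/-- Because `V` spans, avoiding a proper subspace is a nonempty open condition on a point of `V`, as
is keeping `f` nonzero at the sum; irreducibility satisfies both. The subspace `U` collects the
points chosen so far and carries the induction. -/
lemma exists_linearIndependent_of_eval_ne_zero {V : Set (Fin n → k)}
    (hV : (vanishingIdeal k V).IsPrime) (hspan : Submodule.span k V = ⊤) (q : ℕ) :
    ∀ (U : Submodule k (Fin n → k)) (f : MvPolynomial (Fin n) k) (w : Fin n → k),
      Module.finrank k U + q ≤ n → w ∈ sumSet q V → eval w f ≠ 0 →
      ∃ c : Fin q → Fin n → k, (∀ a, c a ∈ V) ∧ LinearIndependent k c ∧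
        Disjoint U (Submodule.span k (Set.range c)) ∧ eval (∑ a, c a) f ≠ 0 := by
  induction q with
  | zero =>
    rintro U f w - rfl hf
    refine ⟨Fin.elim0, fun a => a.elim0, linearIndependent_empty_type, ?_, by simpa using hf⟩
    simp
  | succ q ih =>
    rintro U f _ hU ⟨a, ha, w, hw, rfl⟩ hf
    have hUtop : U < ⊤ := by
      rw [lt_top_iff_ne_top]
      rintro rfl
      rw [finrank_top, Module.finrank_fin_fun] at hU
      omega
    obtain ⟨l, hl0, hlU⟩ := U.exists_le_ker_of_lt_top hUtop
    obtain ⟨b, hb, hlb⟩ : ∃ b ∈ V, l b ≠ 0 := by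
      by_contra hcon
      push Not at hcon
      apply hl0
      have : Submodule.span k V ≤ LinearMap.ker l := Submodule.span_le.2 hcon
      rw [hspan, top_le_iff] at this
      exact LinearMap.ker_eq_top.1 this
    let lp : MvPolynomial (Fin n) k := ∑ i, MvPolynomial.C (l (Pi.single i 1)) * MvPolynomial.X i
    have hlp : ∀ x, eval x lp = l x := by
      intro x
      have hx : x = ∑ b, x b • Pi.single b (1 : k) := by
        simp [← Pi.single_smul, Finset.univ_sum_single]
      conv_rhs => rw [hx]
      simp [lp, mul_comm]
    obtain ⟨c, hc, h1, h2⟩ := exists_eval_ne_zero hV (f := translate w f) (g := lp) ha hb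
      (by simpa using hf) (by rwa [hlp])
    rw [hlp] at h2
    have hcU : c ∉ U := fun h => h2 (hlU h)
    obtain ⟨c', hc'V, hli, hdis, hne⟩ := ih (U ⊔ Submodule.span k {c}) (translate c f) w (by
      have h3 := Submodule.finrank_add_le_finrank_add_finrank U (Submodule.span k {c})
      have h4 := finrank_span_le_card (R := k) ({c} : Set (Fin n → k))
      simp at h4
      omega) hw (by rw [eval_translate] at *; rwa [add_comm])
    refine ⟨Fin.cons c c', ?_, ?_, ?_, ?_⟩
    · intro a
      refine Fin.cases hc (fun a => ?_) a
      simpa using hc'V a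
    · rw [linearIndependent_finCons]
      refine ⟨hli, fun hmem => ?_⟩
      have := Submodule.disjoint_def.1 hdis c
        (Submodule.mem_sup_right (Submodule.mem_span_singleton_self c)) hmem
      exact hcU (this ▸ U.zero_mem)
    · rw [Fin.range_cons, Submodule.span_insert, Submodule.disjoint_def]
      intro u hu hu'
      obtain ⟨y, hy, s, hs, rfl⟩ := Submodule.mem_sup.1 hu'
      obtain ⟨α, rfl⟩ := Submodule.mem_span_singleton.1 hy
      have hs0 : s = 0 := by
        refine Submodule.disjoint_def.1 hdis s ?_ hs
        have : s = (α • c + s) - α • c := by abel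
        rw [this]
        exact Submodule.sub_mem _ (Submodule.mem_sup_left hu) (Submodule.mem_sup_right hy)
      rw [hs0, add_zero] at hu ⊢
      by_cases hα : α = 0
      · rw [hα, zero_smul]
      · exact absurd ((U.smul_mem_iff hα).1 hu) hcU
    · rw [Fin.sum_univ_succ]
      rw [eval_translate, add_comm] at hne
      simpa using hne

/-- The ideal of the secant variety is the ideal of the set of sums of `q` points of the cone. -/
lemma homogeneousIdeal_secantVariety [Infinite k] {Y : Set (ℙ k (Fin n → k))}
    (hY : (vanishingIdeal k (affineCone Y)).IsPrime)
    (hspan : Submodule.span k (affineCone Y) = ⊤) {q : ℕ} (hq : q ≤ n) :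
    homogeneousIdeal (secantVariety q Y) = vanishingIdeal k (sumSet q (affineCone Y)) := by
  rw [homogeneousIdeal, secantVariety, vanishingIdeal_affineCone_closure]
  apply le_antisymm
  · intro f hf
    rw [mem_vanishing] at *
    intro w hw
    by_contra hne
    obtain ⟨c, hcV, hli, -, hc⟩ := exists_linearIndependent_of_eval_ne_zero hY hspan q ⊥ f w
      (by simpa using hq) hw hne
    refine hc (hf _ fun h0 => ?_)
    refine ⟨fun a => Projectivization.mk k (c a) (hli.ne_zero a), fun a => hcV a _, ?_, ?_⟩
    · exact Projectivization.Independent.mk _ _ hli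
    · simp only [Projectivization.submodule_mk]
      rw [Submodule.span_singleton_le_iff_mem]
      exact Submodule.sum_mem _ fun a _ => Submodule.mem_iSup_of_mem a
        (Submodule.mem_span_singleton_self _)
  · intro f hf
    rw [mem_vanishing] at *
    intro w hw
    by_cases hw0 : w = 0
    · rw [hw0]
      exact hf 0 ((isCone_affineCone Y).sumSet q).1
    · obtain ⟨z, hz, -, hle⟩ := hw hw0
      simp only [Projectivization.submodule_mk, Projectivization.submodule_eq (z _),
        Submodule.span_singleton_le_iff_mem, ← Submodule.span_range_eq_iSup] at hle
      obtain ⟨c, rfl⟩ := (Submodule.mem_span_range_iff_exists_fun k).1 hle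
      exact hf _ (sum_mem_sumSet fun a =>
        (isCone_affineCone Y).2 _ _ (rep_mem_affineCone.2 (hz a)))

/-- No tuple of more than `n` points is independent, so the secant variety is empty and its cone is
the origin. -/
lemma homogeneousIdeal_secantVariety_of_lt [Infinite k] {Y : Set (ℙ k (Fin n → k))} {q : ℕ}
    (hq : n < q) : homogeneousIdeal (secantVariety q Y) = vanishingIdeal k {(0 : Fin n → k)} := by
  rw [homogeneousIdeal, secantVariety, vanishingIdeal_affineCone_closure]
  congr 1
  ext w
  constructor
  · intro hw
    by_contra hw0
    obtain ⟨z, -, hz, -⟩ := hw hw0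
    rw [Projectivization.independent_iff] at hz
    have := hz.fintype_card_le_finrank
    simp at this
    omega
  · rintro rfl
    exact fun h => absurd rfl h

/-- Points in the centre of projection have no image in projective space, but on cones they only
contribute the origin, so the two sides agree exactly. -/
lemma affineCone_image (φ : (Fin n → k) →ₗ[k] (Fin m → k)) (X : Set (ℙ k (Fin n → k))) :
    affineCone {p | ∃ z ∈ X, ∃ h : φ z.rep ≠ 0, p = Projectivization.mk k (φ z.rep) h} =
      φ '' affineCone X := by
  ext w
  constructor
  · intro hw
    by_cases hw0 : w = 0
    · exact ⟨0, (isCone_affineCone X).1, by simp [hw0]⟩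
    · obtain ⟨z, hz, h, hzw⟩ := hw hw0
      obtain ⟨c, hc⟩ := (Projectivization.mk_eq_mk_iff' k _ _ _ _).1 hzw
      exact ⟨c • z.rep, (isCone_affineCone X).2 c _ (rep_mem_affineCone.2 hz), by simp [hc]⟩
  · rintro ⟨v, hv, rfl⟩ hne
    have hv0 : v ≠ 0 := by
      rintro rfl
      simp at hne
    obtain ⟨a, ha⟩ := Projectivization.exists_smul_eq_mk_rep k v hv0
    refine ⟨Projectivization.mk k v hv0, hv hv0, ?_, ?_⟩
    · rw [← ha, Units.smul_def, map_smul]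
      exact smul_ne_zero a.ne_zero hne
    · rw [Projectivization.mk_eq_mk_iff]
      refine ⟨a⁻¹, ?_⟩
      have : φ (Projectivization.mk k v hv0).rep = a • φ v := by
        rw [← ha, Units.smul_def, map_smul, Units.smul_def]
      rw [this, inv_smul_smul]

lemma vanishingIdeal_affineCone_projectedVariety [Infinite k] (φ : (Fin n → k) →ₗ[k] (Fin m → k))
    (X : Set (ℙ k (Fin n → k))) :
    vanishingIdeal k (affineCone (projectedVariety φ X)) = vanishingIdeal k (φ '' affineCone X) := by
  rw [projectedVariety, vanishingIdeal_affineCone_closure, affineCone_image]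

lemma homogeneousIdeal_secantVariety_projectedVariety [Infinite k]
    {φ : (Fin n → k) →ₗ[k] (Fin m → k)} (hφ : Function.Surjective φ) {X : Set (ℙ k (Fin n → k))}
    (hX : (vanishingIdeal k (affineCone X)).IsPrime)
    (hspan : Submodule.span k (affineCone X) = ⊤) {q : ℕ} (hq : q ≤ m) :
    homogeneousIdeal (secantVariety q (projectedVariety φ X)) =
      (vanishingIdeal k (sumSet q (affineCone X))).comap (pull φ) := by
  have hV := vanishingIdeal_affineCone_projectedVariety φ X
  rw [homogeneousIdeal_secantVariety _ _ hq, vanishingIdeal_sumSet_congr hV, ← image_sumSet,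
    vanishingIdeal_image]
  · rw [hV, vanishingIdeal_image]
    exact Ideal.IsPrime.comap _
  · rw [eq_top_iff, ← LinearMap.range_eq_top.2 hφ, ← Submodule.map_top, ← hspan, Submodule.map_span]
    refine Submodule.span_mono ?_
    rw [← affineCone_image]
    exact affineCone_mono subset_closure

lemma span_affineCone_of_isNondegenerate {X : Set (ℙ k (Fin n → k))} (hX : IsNondegenerate X) :
    Submodule.span k (affineCone X) = ⊤ := by
  rw [eq_top_iff, ← hX]
  refine iSup₂_le fun z hz => ?_
  rw [Projectivization.submodule_eq, Submodule.span_singleton_le_iff_mem]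
  exact Submodule.subset_span (rep_mem_affineCone.2 hz)

end Cones
end
end SecantBetti

namespace SecantBetti
noncomputable section

/-! ### Vector fields and formal arcs through a general point -/

section Arcs

open scoped Pointwise
open MvPolynomial (vanishingIdeal eval pderiv)

lemma _root_.Matrix.exists_mul_mul_eq_self {L m n : Type*} [Field L] [Fintype m] [Fintype n]
    [DecidableEq m] [DecidableEq n] (A : Matrix m n L) : ∃ G : Matrix n m L, A * G * A = A := by
  let f := Matrix.toLin' A
  obtain ⟨g, hg⟩ := f.rangeRestrict.exists_rightInverse_of_surjective f.range_rangeRestrict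
  obtain ⟨G, hG⟩ := LinearMap.exists_extend g
  refine ⟨LinearMap.toMatrix' G, ?_⟩
  apply Matrix.toLin'.injective
  rw [Matrix.toLin'_mul, Matrix.toLin'_mul, Matrix.toLin'_toMatrix']
  ext1 v
  ext1
  have h1 : ∀ y, G (f y) = g (f.rangeRestrict y) := fun y => by rw [← hG]; rfl
  have h2 : ∀ y, f (g y) = y := fun y => congrArg Subtype.val (LinearMap.congr_fun hg y)
  change f (G (f _)) = f _
  rw [h1, h2]
  rfl

variable {k : Type*} [Field k] {n r : ℕ}

/-- `v` lies in the Zariski tangent space to `V` at `z`. -/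
def IsTangentAt (V : Set (Fin n → k)) (z v : Fin n → k) : Prop :=
  ∀ f ∈ vanishingIdeal k V, ∑ a, eval z (pderiv a f) * v a = 0

/-- A generalized inverse of the matrix exists over the fraction field of the quotient by `I`; `h`
is a common denominator of its entries. It is applied to the Jacobian matrix of generators of an
ideal. -/
lemma exists_generalizedInverse {I : Ideal (MvPolynomial (Fin n) k)} (hI : I.IsPrime)
    {ι : Type*} [Fintype ι] [DecidableEq ι] (A : ι → Fin n → MvPolynomial (Fin n) k) :
    ∃ h ∉ I, ∃ G : Fin n → ι → MvPolynomial (Fin n) k, ∀ f b,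
      h * A f b - ∑ a, A f a * ∑ f', G a f' * A f' b ∈ I := by
  let R := MvPolynomial (Fin n) k ⧸ I
  let L := FractionRing R
  let θ : MvPolynomial (Fin n) k →+* L := (algebraMap R L).comp (Ideal.Quotient.mk I)
  have hθ : ∀ x, θ x = 0 ↔ x ∈ I := by
    intro x
    rw [RingHom.comp_apply, map_eq_zero_iff _ (IsFractionRing.injective R L),
      Ideal.Quotient.eq_zero_iff_mem]
  obtain ⟨G, hG⟩ := Matrix.exists_mul_mul_eq_self (Matrix.of fun f a => θ (A f a))
  obtain ⟨⟨b, hb⟩, hmul⟩ := IsLocalization.exist_integer_multiples_of_finite (nonZeroDivisors R)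
    (fun p : Fin n × ι => G p.1 p.2)
  obtain ⟨h, rfl⟩ := Ideal.Quotient.mk_surjective b
  have hmul' : ∀ a f, ∃ y, θ y = θ h * G a f := by
    intro a f
    obtain ⟨y, hy⟩ := hmul (a, f)
    obtain ⟨y, rfl⟩ := Ideal.Quotient.mk_surjective y
    exact ⟨y, hy.trans (Algebra.smul_def _ _)⟩
  choose G' hG' using hmul'
  refine ⟨h, fun hh => nonZeroDivisors.ne_zero hb (Ideal.Quotient.eq_zero_iff_mem.2 hh), G', ?_⟩
  intro f b
  rw [← hθ, map_sub, sub_eq_zero]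
  have h1 := congrFun (congrFun hG f) b
  rw [Matrix.mul_assoc] at h1
  simp only [Matrix.mul_apply, Matrix.of_apply] at h1
  simp only [map_mul, map_sum, hG']
  rw [← h1, Finset.mul_sum]
  refine Finset.sum_congr rfl fun a _ => ?_
  rw [mul_left_comm, Finset.mul_sum]
  congr 1
  exact Finset.sum_congr rfl fun _ _ => by ring

/-- The chain rule. -/
lemma _root_.Derivation.map_aeval_mvPolynomial {σ A : Type*} [Fintype σ] [CommRing A] [Algebra k A]
    (D : Derivation k A A) (y : σ → A) (f : MvPolynomial σ k) :
    D (MvPolynomial.aeval y f) = ∑ a, MvPolynomial.aeval y (pderiv a f) * D (y a) := by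
  classical
  induction f using MvPolynomial.induction_on with
  | C c => simp
  | add p q hp hq => simp only [map_add, add_mul, Finset.sum_add_distrib, hp, hq]
  | mul_X p i hp =>
    simp only [Derivation.leibniz, map_add, map_mul, add_mul, Finset.sum_add_distrib, hp,
      MvPolynomial.pderiv_X, smul_eq_mul, MvPolynomial.aeval_X, Finset.mul_sum]
    congr 1
    · rw [Finset.sum_eq_single i]
      · simp
      · intro b _ hb
        simp [Ne.symm hb]
      · simp
    · exact Finset.sum_congr rfl fun _ _ => by ring

lemma sum_mul_generalizedInverse {R α ι : Type*} [CommRing R] [Fintype α] [Fintype ι]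
    (P v : α → R) (c h : R) (G : α → ι → R) (Q : ι → α → R) :
    ∑ a, P a * (c * (h * v a - ∑ f, G a f * ∑ b, Q f b * v b)) =
      c * ∑ b, v b * (h * P b - ∑ a, P a * ∑ f, G a f * Q f b) := by
  simp only [mul_sub, Finset.mul_sum, Finset.sum_sub_distrib]
  congr 1
  · exact Finset.sum_congr rfl fun _ _ => by ring
  · conv_rhs => rw [Finset.sum_comm]
    refine Finset.sum_congr rfl fun _ _ => ?_
    rw [Finset.sum_comm]
    exact Finset.sum_congr rfl fun _ _ => Finset.sum_congr rfl fun _ _ => by ring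

/-- Through a general point, every tangent vector extends to a vector field. -/
lemma exists_vectorField {V : Set (Fin n → k)} (hV : (vanishingIdeal k V).IsPrime) :
    ∃ h ∉ vanishingIdeal k V, ∀ z, eval z h ≠ 0 → ∀ v, IsTangentAt V z v →
      ∃ D : Derivation k (MvPolynomial (Fin n) k) (MvPolynomial (Fin n) k),
        (∀ f ∈ vanishingIdeal k V, D f ∈ vanishingIdeal k V) ∧
        ∀ a, eval z (D (MvPolynomial.X a)) = v a := by
  classical
  obtain ⟨I, hI⟩ : ∃ I, I = vanishingIdeal k V := ⟨_, rfl⟩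
  obtain ⟨s, hs⟩ : I.FG := IsNoetherian.noetherian I
  obtain ⟨h, hh, G, hG⟩ := exists_generalizedInverse (hI ▸ hV)
    (fun (f : s) a => pderiv a (f : MvPolynomial (Fin n) k))
  refine ⟨h, hI ▸ hh, fun z hz v hv => ?_⟩
  -- With Jacobian matrix `J` and generalized inverse `G/h`, the matrix `h - G J` maps into the
  -- kernel of `J` modulo the ideal. Applied to the constant vector `v` it gives a vector field
  -- preserving the ideal; at `z`, where `J v = 0`, its value is `h(z) v`, whence the scaling
  -- factor.
  let w : Fin n → MvPolynomial (Fin n) k := fun a => MvPolynomial.C (eval z h)⁻¹ *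
    (h * MvPolynomial.C (v a) - ∑ f', G a f' * ∑ b, pderiv b f'.1 * MvPolynomial.C (v b))
  let D := MvPolynomial.mkDerivation k w
  have hD : ∀ f, D f = ∑ a, pderiv a f * w a := by
    intro f
    have := D.map_aeval_mvPolynomial MvPolynomial.X f
    simpa only [MvPolynomial.aeval_X_left_apply, D, MvPolynomial.mkDerivation_X] using this
  refine ⟨D, ?_, fun a => ?_⟩
  · rw [← hI]
    intro f hf
    rw [← hs] at hf
    induction hf using Submodule.span_induction with
    | mem f hf =>
      rw [hD]
      rw [sum_mul_generalizedInverse]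
      refine I.mul_mem_left _ (I.sum_mem fun b _ => I.mul_mem_left _ ?_)
      exact hG ⟨f, hf⟩ b
    | zero => rw [map_zero]; exact I.zero_mem
    | add x y _ _ hx hy => rw [map_add]; exact I.add_mem hx hy
    | smul c x hx hDx =>
      rw [smul_eq_mul, Derivation.leibniz]
      have hx' : x ∈ I := hs ▸ hx
      exact I.add_mem (I.mul_mem_left _ hDx) (I.mul_mem_right _ hx')
  · have hv' : ∀ f' : s, ∑ b, eval z (pderiv b f'.1) * v b = 0 := fun f' =>
      hv _ (hI ▸ hs ▸ Submodule.subset_span f'.2)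
    simp only [D, MvPolynomial.mkDerivation_X, w, map_mul, map_sub, map_sum, MvPolynomial.eval_C,
      hv', mul_zero, Finset.sum_const_zero, sub_zero]
    rw [inv_mul_cancel_left₀ hz]

/-- The Taylor series at `z` along the flow of the vector field `D`. -/
def flowSeries (D : Derivation k (MvPolynomial (Fin n) k) (MvPolynomial (Fin n) k))
    (z : Fin n → k) (f : MvPolynomial (Fin n) k) : PowerSeries k :=
  PowerSeries.mk fun l => eval z (D^[l] f) * ((l.factorial : k))⁻¹

/-! ### Formal integral curves of a polynomial vector field. -/

section Flow

variable (D : Derivation k (MvPolynomial (Fin n) k) (MvPolynomial (Fin n) k))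
  (z : Fin n → k)

lemma iterate_map_smul (l : ℕ) (c : k) (g : MvPolynomial (Fin n) k) :
    D^[l] (c • g) = c • D^[l] g := by
  induction l with
  | zero => rfl
  | succ l ih => simp only [Function.iterate_succ_apply', ih, Derivation.map_smul]

lemma flowSeries_add (f g : MvPolynomial (Fin n) k) :
    flowSeries D z (f + g) = flowSeries D z f + flowSeries D z g := by
  ext l
  simp [flowSeries, add_mul]

lemma flowSeries_smul (c : k) (f : MvPolynomial (Fin n) k) :
    flowSeries D z (c • f) = c • flowSeries D z f := by
  ext l
  simp [flowSeries, iterate_map_smul, mul_assoc]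

lemma derivative_flowSeries [CharZero k] (f : MvPolynomial (Fin n) k) :
    PowerSeries.derivative k (flowSeries D z f) = flowSeries D z (D f) := by
  ext l
  rw [PowerSeries.coeff_derivative, flowSeries, flowSeries, PowerSeries.coeff_mk,
    PowerSeries.coeff_mk, Function.iterate_succ_apply, Nat.factorial_succ]
  have h1 : ((l : k) + 1) ≠ 0 := Nat.cast_add_one_ne_zero l
  have h2 : (l.factorial : k) ≠ 0 := Nat.cast_ne_zero.2 l.factorial_ne_zero
  push_cast
  field_simp

/-- Both sides have the same constant term, and by the Leibniz rule their derivatives are sums of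
series of the same shape. Induction on the coefficient then works since `l + 1` is invertible. -/
lemma flowSeries_mul [CharZero k] (f g : MvPolynomial (Fin n) k) :
    flowSeries D z (f * g) = flowSeries D z f * flowSeries D z g := by
  ext l
  induction l generalizing f g with
  | zero => simp [flowSeries, PowerSeries.coeff_zero_eq_constantCoeff]
  | succ l ih =>
    have h1 : ((l : k) + 1) ≠ 0 := Nat.cast_add_one_ne_zero l
    apply mul_right_cancel₀ h1
    rw [← PowerSeries.coeff_derivative, ← PowerSeries.coeff_derivative, derivative_flowSeries,
      Derivation.leibniz, Derivation.leibniz, derivative_flowSeries, derivative_flowSeries,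
      flowSeries_add, map_add, map_add, smul_eq_mul, smul_eq_mul, smul_eq_mul, smul_eq_mul, ih, ih]

/-- The Taylor series as an algebra homomorphism. -/
def flow [CharZero k] : MvPolynomial (Fin n) k →ₐ[k] PowerSeries k :=
  AlgHom.ofLinearMap
    { toFun := flowSeries D z
      map_add' := flowSeries_add D z
      map_smul' := flowSeries_smul D z }
    (by
      ext l
      cases l with
      | zero => simp [flowSeries]
      | succ l =>
        have : D^[l] 0 = 0 := by
          induction l with
          | zero => rfl
          | succ l ih => simp [Function.iterate_succ_apply', ih]
        simp [flowSeries, PowerSeries.coeff_one, this])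
    (flowSeries_mul D z)

lemma flow_apply [CharZero k] (f : MvPolynomial (Fin n) k) : flow D z f = flowSeries D z f := rfl

end Flow

/-- A formal arc in `V` with given general starting point and given tangent vector. -/
lemma exists_arc [CharZero k] {V : Set (Fin n → k)} (hV : (vanishingIdeal k V).IsPrime) :
    ∃ h ∉ vanishingIdeal k V, ∀ z ∈ V, eval z h ≠ 0 → ∀ v, IsTangentAt V z v →
      ∃ e : MvPolynomial (Fin n) k →ₐ[k] PowerSeries k, (∀ f ∈ vanishingIdeal k V, e f = 0) ∧
        ∀ a, ∃ u : PowerSeries k, e (MvPolynomial.X a) = PowerSeries.C (z a) + PowerSeries.X * u ∧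
          PowerSeries.constantCoeff u = v a := by
  obtain ⟨h, hh, H⟩ := exists_vectorField hV
  refine ⟨h, hh, fun z hzV hz v hv => ?_⟩
  obtain ⟨D, hD, hDv⟩ := H z hz v hv
  refine ⟨flow D z, fun f hf => ?_, fun a => ?_⟩
  · have hit : ∀ l, D^[l] f ∈ vanishingIdeal k V := by
      intro l
      induction l with
      | zero => exact hf
      | succ l ih => rw [Function.iterate_succ_apply']; exact hD _ ih
    rw [flow_apply]
    ext l
    simp [flowSeries, mem_vanishing.1 (hit l) z hzV]
  · refine ⟨PowerSeries.mk fun l => PowerSeries.coeff (l + 1) (flow D z (MvPolynomial.X a)), ?_, ?_⟩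
    · ext l
      cases l with
      | zero => simp [flow_apply, flowSeries]
      | succ l => simp [PowerSeries.coeff_succ_X_mul]
    · rw [← PowerSeries.coeff_zero_eq_constantCoeff_apply, PowerSeries.coeff_mk, flow_apply,
        flowSeries, PowerSeries.coeff_mk]
      simp [hDv]

/-- For `x ∈ V` the whole line `x + t p` lies in `V + W`, so each coefficient of `f(x + t p)` as a
polynomial in `t` vanishes on `V` and is killed by the arc `e`. Substituting the series variable for
`t` gives zero. -/
lemma aeval_arc_add [Infinite k] {V W : Set (Fin n → k)} (hW : IsCone W)
    {e : MvPolynomial (Fin n) k →ₐ[k] PowerSeries k} (he : ∀ f ∈ vanishingIdeal k V, e f = 0)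
    {p : Fin n → k} (hp : p ∈ W) {f : MvPolynomial (Fin n) k}
    (hf : f ∈ vanishingIdeal k (V + W)) :
    MvPolynomial.aeval (fun a => e (MvPolynomial.X a) + PowerSeries.X * PowerSeries.C (p a)) f =
      0 := by
  let β : MvPolynomial (Fin n) k →ₐ[k] Polynomial (MvPolynomial (Fin n) k) :=
    MvPolynomial.aeval fun a => Polynomial.C (MvPolynomial.X a) +
      Polynomial.X * Polynomial.C (MvPolynomial.C (p a))
  have hβ : MvPolynomial.aeval
      (fun a => e (MvPolynomial.X a) + PowerSeries.X * PowerSeries.C (p a)) f =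
      Polynomial.eval₂ (e : MvPolynomial (Fin n) k →+* PowerSeries k) PowerSeries.X (β f) := by
    have : (MvPolynomial.aeval (R := k)
        (fun a => e (MvPolynomial.X a) + PowerSeries.X * PowerSeries.C (p a)) :
          MvPolynomial (Fin n) k →+* PowerSeries k) =
        (Polynomial.eval₂RingHom (e : MvPolynomial (Fin n) k →+* PowerSeries k)
          PowerSeries.X).comp (β : MvPolynomial (Fin n) k →+* _) := by
      apply MvPolynomial.ringHom_ext
      · intro c
        have h1 : e (MvPolynomial.C c) = PowerSeries.C c := e.commutes c
        have h2 : β (MvPolynomial.C c) = Polynomial.C (MvPolynomial.C c) := β.commutes c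
        simp [h2, h1]
      · intro a
        have h1 : e (MvPolynomial.C (p a)) = PowerSeries.C (p a) := e.commutes _
        simp [β, h1]
        exact mul_comm _ _
    exact RingHom.congr_fun this f
  have hcoeff : ∀ l, (β f).coeff l ∈ vanishingIdeal k V := by
    intro l
    rw [mem_vanishing]
    intro x hx
    have h0 : (β f).map (eval x) = 0 := by
      refine Polynomial.funext fun c => ?_
      have : (Polynomial.evalRingHom c).comp ((Polynomial.mapRingHom (eval x)).comp
          (β : MvPolynomial (Fin n) k →+* _)) = eval (x + c • p) := by
        apply MvPolynomial.ringHom_ext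
        · intro c
          have h2 : β (MvPolynomial.C c) = Polynomial.C (MvPolynomial.C c) := β.commutes c
          simp [h2]
        · intro a
          simp [β]
          exact mul_comm _ _
      have h3 := RingHom.congr_fun this f
      rw [mem_vanishing.1 hf _ (Set.add_mem_add hx (hW.2 c p hp))] at h3
      rw [Polynomial.eval_zero]
      exact h3
    rw [← Polynomial.coeff_map, h0, Polynomial.coeff_zero]
  rw [hβ, Polynomial.eval₂_eq_sum, Polynomial.sum]
  refine Finset.sum_eq_zero fun l _ => ?_
  have : (e : MvPolynomial (Fin n) k →+* PowerSeries k) ((β f).coeff l) = 0 := he _ (hcoeff l)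
  rw [this, zero_mul]

lemma eq_sum_range_coeffZero {f : MvPolynomial (Fin (r + 1)) k} {i : ℕ}
    (hf : ∀ l, i < l → coeffZero k r l f = 0) :
    f = ∑ l ∈ Finset.range (i + 1),
      MvPolynomial.X 0 ^ l * MvPolynomial.rename Fin.succ (coeffZero k r l f) := by
  conv_lhs => rw [eq_sum_coeffZero f]
  refine Finset.sum_subset_zero_on_sdiff ?_ ?_ (fun _ _ => rfl)
  · intro l hl
    by_contra hcon
    rw [Finset.mem_range] at hcon
    have := hf l (by omega)
    rw [coeffZero_apply] at this
    exact Polynomial.mem_support_iff.1 hl this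
  · intro l hl
    have := Polynomial.notMem_support_iff.1 (Finset.mem_sdiff.1 hl).2
    rw [← coeffZero_apply] at this
    rw [this, map_zero, mul_zero]

/-- The tangent cone at a general point `z` of `V` of the join of `V` and `W` contains the join of
the tangent space at `z` and `W`. -/
lemma exists_partialElim_le [CharZero k] {V : Set (Fin (r + 1) → k)}
    (hV : (vanishingIdeal k V).IsPrime) (hVc : IsCone V) :
    ∃ h ∉ vanishingIdeal k V, ∀ z ∈ V, eval z h ≠ 0 → ∀ W, IsCone W →
      ∀ (g : (Fin (r + 1) → k) ≃ₗ[k] (Fin (r + 1) → k)) (c : k), c ≠ 0 →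
        g z = c • Pi.single 0 1 → ∀ i, ∀ f ∈ partialElim (inCoordinates g (vanishingIdeal k (V + W))) i,
        ∀ v p, IsTangentAt V z v → p ∈ W → eval (dropZero k r (g (v + p))) f = 0 := by
  obtain ⟨h, hh, H⟩ := exists_arc hV
  refine ⟨h, hh, fun z hzV hz W hW g c hc hgz i f₀ hf₀ v p hv hp => ?_⟩
  obtain ⟨e, he, hu⟩ := H z hzV hz v hv
  choose u hu huv using hu
  obtain ⟨f, hf, hfi, rfl⟩ := mem_partialElim.1 hf₀
  have hI : IsHomog (inCoordinates g (vanishingIdeal k (V + W))) :=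
    (hVc.add hW).isHomog.comap_pull _
  obtain ⟨Y, hY⟩ : ∃ Y : Fin (r + 1) → PowerSeries k, ∀ a,
      Y a = ∑ b, g (Pi.single b 1) a • (u b + PowerSeries.C (p b)) := ⟨_, fun _ => rfl⟩
  have hsum : ∀ x : Fin (r + 1) → k, ∀ a, ∑ b, g (Pi.single b 1) a * x b = g x a := by
    intro x a
    have hx : x = ∑ b, x b • Pi.single b (1 : k) := by
      simp [← Pi.single_smul, Finset.univ_sum_single]
    conv_rhs => rw [hx]
    simp [mul_comm]
  have hY0 : ∀ a, PowerSeries.constantCoeff (Y a) = g (v + p) a := by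
    intro a
    rw [hY, map_sum, ← hsum]
    refine Finset.sum_congr rfl fun b _ => ?_
    rw [PowerSeries.smul_eq_C_mul, map_mul]
    simp [huv]
  -- The arc `e + X p` in the coordinates `g`. Its zeroth entry has constant term `c ≠ 0`; the other
  -- entries are divisible by the series variable, with leading direction `g (v + p)`.
  obtain ⟨y, hy⟩ : ∃ y : Fin (r + 1) → PowerSeries k, ∀ a,
      y a = PowerSeries.C (g z a) + PowerSeries.X * Y a := ⟨_, fun _ => rfl⟩
  have hα : ∀ F ∈ inCoordinates g (vanishingIdeal k (V + W)), MvPolynomial.aeval y F = 0 := by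
    intro F hF
    rw [← aeval_arc_add hW he hp (mem_inCoordinates.1 hF)]
    have : MvPolynomial.aeval (R := k) y = (MvPolynomial.aeval (R := k)
        (fun a => e (MvPolynomial.X a) + PowerSeries.X * PowerSeries.C (p a))).comp
        (pull (g : (Fin (r + 1) → k) →ₗ[k] (Fin (r + 1) → k))) := by
      apply MvPolynomial.algHom_ext
      intro a
      rw [AlgHom.comp_apply, pull_X, map_sum, MvPolynomial.aeval_X, hy, hY, ← hsum, map_sum,
        Finset.mul_sum, ← Finset.sum_add_distrib]
      refine Finset.sum_congr rfl fun b _ => ?_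
      rw [map_smul, MvPolynomial.aeval_X, hu, PowerSeries.smul_eq_C_mul, PowerSeries.smul_eq_C_mul,
        map_mul]
      simp only [LinearEquiv.coe_coe]
      ring
    rw [this]
    rfl
  have hy0 : y 0 = PowerSeries.C c + PowerSeries.X * Y 0 := by
    rw [hy, hgz]
    simp
  have hys : ∀ a : Fin r, y a.succ = PowerSeries.X * Y a.succ := by
    intro a
    rw [hy, hgz]
    simp
  rw [← MvPolynomial.sum_homogeneousComponent (coeffZero k r i f), map_sum]
  refine Finset.sum_eq_zero fun d _ => ?_
  -- The component of degree `d + i` of `f` has the degree `d` component of the given coefficient in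
  -- front of `x₀ ^ i`.
  obtain ⟨F, hF⟩ : ∃ F, F = intComponent k (r + 1) (d + i : ℕ) f := ⟨_, rfl⟩
  have hFI : F ∈ inCoordinates g (vanishingIdeal k (V + W)) := hF ▸ hI.intComponent_mem hf _
  have hFi : coeffZero k r i F = MvPolynomial.homogeneousComponent d (coeffZero k r i f) := by
    rw [hF, coeffZero_intComponent]
    have : ((d + i : ℕ) : ℤ) - i = d := by push_cast; ring
    rw [this]
    rfl
  have hFl : ∀ l, i < l → coeffZero k r l F = 0 := by
    intro l hl
    rw [hF, coeffZero_intComponent, hfi l hl, map_zero]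
  have hFh : ∀ l ≤ i, (coeffZero k r l F).IsHomogeneous (d + (i - l)) := by
    intro l hl
    have h1 := mem_homogeneousPart_iff_coeffZero.1
      (hF ▸ intComponent_mem (k := k) ((d + i : ℕ) : ℤ) f) l
    have : ((d + i : ℕ) : ℤ) - l = Int.ofNat (d + (i - l)) := by
      rw [Int.ofNat_eq_natCast]
      push_cast [hl]
      ring
    rw [this] at h1
    exact h1
  have h0 := hα F hFI
  rw [eq_sum_range_coeffZero hFl, map_sum] at h0
  -- The coefficient of `x₀ ^ l` is a form of degree `d + (i - l)` in entries divisible by the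
  -- series variable. After cancelling the `d`-th power only `l = i` survives in the constant term.
  have hterm : ∀ l ∈ Finset.range (i + 1), MvPolynomial.aeval y (MvPolynomial.X 0 ^ l *
      MvPolynomial.rename Fin.succ (coeffZero k r l F)) = PowerSeries.X ^ d * (y 0 ^ l *
        (PowerSeries.X ^ (i - l) * MvPolynomial.aeval (fun a => Y a.succ) (coeffZero k r l F))) := by
    intro l hl
    have hl' : l ≤ i := by simpa [Nat.lt_succ_iff] using hl
    rw [map_mul, map_pow, MvPolynomial.aeval_X, MvPolynomial.aeval_rename]
    have : y ∘ Fin.succ = fun a => PowerSeries.X * Y a.succ := funext hys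
    rw [this, aeval_smul_of_isHomogeneous (hFh l hl'), pow_add]
    ring
  rw [Finset.sum_congr rfl hterm, ← Finset.mul_sum, mul_eq_zero,
    or_iff_right (pow_ne_zero _ PowerSeries.X_ne_zero), Finset.sum_range_succ] at h0
  have h1 := congrArg PowerSeries.constantCoeff h0
  rw [map_add, map_sum, Finset.sum_eq_zero, zero_add] at h1
  · rw [map_mul, map_pow, hy0, Nat.sub_self, pow_zero, one_mul, hFi] at h1
    have h2 : PowerSeries.constantCoeff (PowerSeries.C c + PowerSeries.X * Y 0) = c := by simp
    rw [h2, map_zero, mul_eq_zero, or_iff_right (pow_ne_zero _ hc)] at h1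
    rw [← h1, ← MvPolynomial.aeval_eq_eval]
    have h3 : ∀ q : MvPolynomial (Fin r) k,
        PowerSeries.constantCoeff (MvPolynomial.aeval (fun a => Y a.succ) q) =
          MvPolynomial.aeval (fun a => PowerSeries.constantCoeff (Y a.succ)) q := by
      intro q
      rw [MvPolynomial.aeval_def, MvPolynomial.aeval_def, MvPolynomial.hom_eval₂]
      congr 1
    rw [h3]
    congr 2
    funext a
    rw [hY0]
    rfl
  · intro l hl
    have : i - l ≠ 0 := by
      have := Finset.mem_range.1 hl
      omega
    simp [this]

end Arcs
end
end SecantBetti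

namespace SecantBetti
noncomputable section

/-! ### Derivations of fields and the tangent spaces of a join -/

section Derivations

open Algebra

/-- For a formally étale extension the module of differentials is obtained by base change, so a
derivation on `A` determines one on `L`. -/
lemma exists_derivation_extension {k A L : Type*} [CommRing k] [CommRing A] [CommRing L]
    [Algebra k A] [Algebra k L] [Algebra A L] [IsScalarTower k A L] [FormallyEtale A L]
    (d : Derivation k A L) : ∃ D : Derivation k L L, ∀ x, D (algebraMap A L x) = d x := by
  let l : TensorProduct A L (Ω[A⁄k]) →ₗ[L] L := LinearMap.liftBaseChange L d.liftKaehlerDifferential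
  let e := KaehlerDifferential.tensorKaehlerEquivOfFormallyEtale k A L
  refine ⟨(l ∘ₗ e.symm.toLinearMap).compDer (KaehlerDifferential.D k L), fun x => ?_⟩
  have h : e.symm (KaehlerDifferential.D k L (algebraMap A L x)) = _ :=
    KaehlerDifferential.tensorKaehlerEquivOfFormallyEtale_symm_D_algebraMap k A L x
  change l (e.symm (KaehlerDifferential.D k L (algebraMap A L x))) = _
  rw [h]
  simp [l]

open scoped IntermediateField.algebraAdjoinAdjoin in
/-- Partial derivatives with respect to algebraically independent elements. -/
lemma exists_derivation_of_algebraicIndependent {k L ι : Type*} [Field k] [Field L] [CharZero k]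
    [Algebra k L] [DecidableEq ι] {s : ι → L} (hs : AlgebraicIndependent k s) (a : ι) :
    ∃ D : Derivation k L L, ∀ b, D (s b) = if b = a then 1 else 0 := by
  classical
  -- The family is completed to a transcendence basis `B`. Then `L` is formally étale over `k[B]`: a
  -- localization followed by an algebraic extension that is separable in characteristic zero. A
  -- partial derivative of `k[B]` therefore extends.
  obtain ⟨B, hsB, hB⟩ := exists_isTranscendenceBasis_superset (s := Set.range s) hs.coe_range
  have hind : AlgebraicIndependent k ((↑) : B → L) := hB.1
  let A := adjoin k (Set.range ((↑) : B → L))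
  have : FormallyEtale A (IntermediateField.adjoin k (Set.range ((↑) : B → L))) :=
    .of_isLocalization (nonZeroDivisors _)
  have : Algebra.IsAlgebraic (IntermediateField.adjoin k (Set.range ((↑) : B → L))) L :=
    hB.isAlgebraic_field
  have : FormallyEtale (IntermediateField.adjoin k (Set.range ((↑) : B → L))) L :=
    FormallyEtale.of_isSeparable _ L
  have : FormallyEtale A L := .comp _ (IntermediateField.adjoin k (Set.range ((↑) : B → L))) _
  let e : MvPolynomial B k ≃ₐ[k] A := hind.aevalEquiv
  let a' : B := ⟨s a, hsB ⟨a, rfl⟩⟩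
  let d : Derivation k A A := Derivation.mk'
    (e.toLinearMap ∘ₗ (MvPolynomial.pderiv a').toLinearMap ∘ₗ e.symm.toLinearMap) (by
      intro x y
      simp [Derivation.leibniz])
  obtain ⟨D, hD⟩ := exists_derivation_extension (L := L)
    ((Algebra.linearMap A L).compDer d)
  refine ⟨D, fun b => ?_⟩
  let b' : B := ⟨s b, hsB ⟨b, rfl⟩⟩
  have hb : s b = algebraMap A L (e (MvPolynomial.X b')) := by
    rw [hind.algebraMap_aevalEquiv, MvPolynomial.aeval_X]
  have hab : a' = b' ↔ b = a := by
    rw [Subtype.mk.injEq, hs.injective.eq_iff, eq_comm]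
  rw [hb, hD]
  change algebraMap A L (e (MvPolynomial.pderiv a' (e.symm (e (MvPolynomial.X b'))))) = _
  rw [AlgEquiv.symm_apply_apply, MvPolynomial.pderiv_X, Pi.single_apply]
  simp only [← hab, eq_comm (a := b')]
  split_ifs <;> simp
end Derivations

/-! ### Terracini's lemma for joins, in terms of independent coordinates. -/

section Terracini

open scoped Pointwise
open MvPolynomial (vanishingIdeal eval pderiv)

variable {k : Type*} [Field k] {n : ℕ}

/-- The product of two sets in affine space. -/
def prodSet (V W : Set (Fin n → k)) : Set (Fin n ⊕ Fin n → k) :=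
  {p | ∃ x ∈ V, ∃ y ∈ W, p = Sum.elim x y}

/-- The polynomial `F(x, ·)`. -/
def fixLeft (x : Fin n → k) : MvPolynomial (Fin n ⊕ Fin n) k →ₐ[k] MvPolynomial (Fin n) k :=
  MvPolynomial.aeval (Sum.elim (fun a => MvPolynomial.C (x a)) MvPolynomial.X)

/-- The polynomial `F(·, y)`. -/
def fixRight (y : Fin n → k) : MvPolynomial (Fin n ⊕ Fin n) k →ₐ[k] MvPolynomial (Fin n) k :=
  MvPolynomial.aeval (Sum.elim MvPolynomial.X (fun a => MvPolynomial.C (y a)))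

@[simp] lemma eval_fixLeft (x y : Fin n → k) (F : MvPolynomial (Fin n ⊕ Fin n) k) :
    eval y (fixLeft x F) = eval (Sum.elim x y) F := by
  have : (MvPolynomial.aeval (R := k) y).comp (fixLeft x) = MvPolynomial.aeval (Sum.elim x y) := by
    apply MvPolynomial.algHom_ext
    rintro (a | a) <;> simp [fixLeft]
  exact DFunLike.congr_fun this F

@[simp] lemma eval_fixRight (x y : Fin n → k) (F : MvPolynomial (Fin n ⊕ Fin n) k) :
    eval x (fixRight y F) = eval (Sum.elim x y) F := by
  have : (MvPolynomial.aeval (R := k) x).comp (fixRight y) = MvPolynomial.aeval (Sum.elim x y) := by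
    apply MvPolynomial.algHom_ext
    rintro (a | a) <;> simp [fixRight]
  exact DFunLike.congr_fun this F

lemma isPrime_vanishingIdeal_prodSet {A B : Set (Fin n → k)} (hA : (vanishingIdeal k A).IsPrime)
    (hB : (vanishingIdeal k B).IsPrime) : (vanishingIdeal k (prodSet A B)).IsPrime := by
  obtain ⟨a₀, ha₀⟩ := nonempty_of_isPrime hA
  obtain ⟨b₀, hb₀⟩ := nonempty_of_isPrime hB
  refine isPrime_vanishingIdeal_of_exists ⟨_, a₀, ha₀, b₀, hb₀, rfl⟩ ?_
  rintro f g _ ⟨a, ha, b, hb, rfl⟩ _ ⟨a', ha', b', hb', rfl⟩ hf hg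
  obtain ⟨c, hc, h1, h2⟩ := exists_eval_ne_zero hA (f := fixRight b f) (g := fixRight b' g) ha ha'
    (by simpa using hf) (by simpa using hg)
  obtain ⟨d, hd, h3, h4⟩ := exists_eval_ne_zero hB (f := fixLeft c f) (g := fixLeft c g) hb hb'
    (by simpa using h1) (by simpa using h2)
  exact ⟨_, ⟨c, hc, d, hd, rfl⟩, by simpa using h3, by simpa using h4⟩

/-- The tangent spaces of `V` and `W` at general points span the coordinate directions that are
independent on `V + W`. -/
lemma exists_isTangentAt_pair [CharZero k] {V W : Set (Fin n → k)}
    (hV : (vanishingIdeal k V).IsPrime) (hW : (vanishingIdeal k W).IsPrime) {ι : Type*} [Finite ι]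
    [DecidableEq ι] (τ : ι → Fin n)
    (hτ : ∀ Q : MvPolynomial ι k, MvPolynomial.rename τ Q ∈ vanishingIdeal k (V + W) → Q = 0) :
    ∃ h ∉ vanishingIdeal k (prodSet V W), ∀ z ∈ V, ∀ w ∈ W, ∀ a, ∃ u v, IsTangentAt V z u ∧
      IsTangentAt W w v ∧ ∀ b, u (τ b) + v (τ b) = if b = a then eval (Sum.elim z w) h else 0 := by
  have hP := isPrime_vanishingIdeal_prodSet hV hW
  obtain ⟨P, hPe⟩ : ∃ P, P = vanishingIdeal k (prodSet V W) := ⟨_, rfl⟩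
  rw [← hPe] at hP ⊢
  let R := MvPolynomial (Fin n ⊕ Fin n) k ⧸ P
  let L := FractionRing R
  let y : Fin n ⊕ Fin n → L := fun c => algebraMap R L (Ideal.Quotient.mk P (MvPolynomial.X c))
  let θ : MvPolynomial (Fin n ⊕ Fin n) k →ₐ[k] L := MvPolynomial.aeval y
  have hθ' : ∀ F, θ F = algebraMap R L (Ideal.Quotient.mk P F) := by
    have : θ = (IsScalarTower.toAlgHom k R L).comp (Ideal.Quotient.mkₐ k P) := by
      apply MvPolynomial.algHom_ext
      intro c
      simp only [θ, y, MvPolynomial.aeval_X]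
      rfl
    intro F
    rw [this]
    rfl
  have hθ : ∀ F, θ F = 0 ↔ ∀ z ∈ V, ∀ w ∈ W, eval (Sum.elim z w) F = 0 := by
    intro F
    rw [hθ', map_eq_zero_iff _ (IsFractionRing.injective R L), Ideal.Quotient.eq_zero_iff_mem, hPe,
      mem_vanishing]
    constructor
    · intro H z hz w hw
      exact H _ ⟨z, hz, w, hw, rfl⟩
    · rintro H _ ⟨z, hz, w, hw, rfl⟩
      exact H z hz w hw
  have hs : AlgebraicIndependent k (fun a => y (Sum.inl (τ a)) + y (Sum.inr (τ a))) := by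
    rw [algebraicIndependent_iff]
    intro Q hQ
    apply hτ
    let A : MvPolynomial (Fin n) k →ₐ[k] MvPolynomial (Fin n ⊕ Fin n) k :=
      MvPolynomial.aeval fun a => MvPolynomial.X (Sum.inl a) + MvPolynomial.X (Sum.inr a)
    have h1 : θ (A (MvPolynomial.rename τ Q)) = 0 := by
      rw [← hQ]
      have : (θ.comp A).comp (MvPolynomial.rename τ) =
          MvPolynomial.aeval (fun a => y (Sum.inl (τ a)) + y (Sum.inr (τ a))) := by
        apply MvPolynomial.algHom_ext
        intro a
        simp [A, θ]
      exact DFunLike.congr_fun this Q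
    rw [mem_vanishing]
    rintro _ ⟨z, hz, w, hw, rfl⟩
    have h2 := (hθ _).1 h1 z hz w hw
    have h3 : (MvPolynomial.aeval (R := k) (Sum.elim z w)).comp A = MvPolynomial.aeval (z + w) := by
      apply MvPolynomial.algHom_ext
      intro a
      simp [A]
    have h4 := DFunLike.congr_fun h3 (MvPolynomial.rename τ Q)
    exact h4.symm.trans h2
  -- `L` is the function field of `V × W`, and `D a` differentiates along the coordinate `a` of the
  -- sum. Its values on the coordinates of the two factors, cleared of denominators by `h`,
  -- specialise at `(z, w)` to tangent vectors of `V` and `W`.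
  choose D hD using exists_derivation_of_algebraicIndependent hs
  obtain ⟨⟨b, hb⟩, hmul⟩ := IsLocalization.exist_integer_multiples_of_finite (nonZeroDivisors R)
    (fun p : ι × (Fin n ⊕ Fin n) => D p.1 (y p.2))
  obtain ⟨h, rfl⟩ := Ideal.Quotient.mk_surjective b
  have hmul' : ∀ a c, ∃ F, θ F = θ h * D a (y c) := by
    intro a c
    obtain ⟨F, hF⟩ := hmul (a, c)
    obtain ⟨F, rfl⟩ := Ideal.Quotient.mk_surjective F
    refine ⟨F, ?_⟩
    rw [hθ', hθ']
    exact hF.trans (Algebra.smul_def _ _)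
  choose B hB using hmul'
  refine ⟨h, fun hh => nonZeroDivisors.ne_zero hb (Ideal.Quotient.eq_zero_iff_mem.2 hh), ?_⟩
  have key : ∀ (l : Fin n → Fin n ⊕ Fin n) (f : MvPolynomial (Fin n) k) (a : ι),
      θ (MvPolynomial.rename l f) = 0 →
      θ (∑ c, MvPolynomial.rename l (pderiv c f) * B a (l c)) = 0 := by
    intro l f a hf
    have hr : ∀ f : MvPolynomial (Fin n) k, θ (MvPolynomial.rename l f) =
        MvPolynomial.aeval (fun c => y (l c)) f := by
      intro f
      simp only [θ, MvPolynomial.aeval_rename]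
      rfl
    have h1 := (D a).map_aeval_mvPolynomial (fun c => y (l c)) f
    rw [← hr, hf, map_zero] at h1
    rw [map_sum, ← mul_zero (θ h), h1, Finset.mul_sum]
    refine Finset.sum_congr rfl fun c _ => ?_
    rw [map_mul, hB, hr]
    ring
  intro z hz w hw a
  refine ⟨fun c => eval (Sum.elim z w) (B a (Sum.inl c)),
    fun c => eval (Sum.elim z w) (B a (Sum.inr c)), ?_, ?_, ?_⟩
  · intro f hf
    have h1 := key Sum.inl f a ((hθ _).2 fun z' hz' w' hw' => by
      rw [MvPolynomial.eval_rename]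
      exact mem_vanishing.1 hf z' hz')
    have h2 := (hθ _).1 h1 z hz w hw
    simpa only [map_sum, map_mul, MvPolynomial.eval_rename, Sum.elim_comp_inl] using h2
  · intro f hf
    have h1 := key Sum.inr f a ((hθ _).2 fun z' hz' w' hw' => by
      rw [MvPolynomial.eval_rename]
      exact mem_vanishing.1 hf w' hw')
    have h2 := (hθ _).1 h1 z hz w hw
    simpa only [map_sum, map_mul, MvPolynomial.eval_rename, Sum.elim_comp_inr] using h2
  · intro b
    have h1 : θ (B a (Sum.inl (τ b)) + B a (Sum.inr (τ b)) - if b = a then h else 0) = 0 := by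
      rw [map_sub, map_add, hB, hB, ← mul_add, ← map_add, hD]
      split_ifs <;> simp
    have h2 := (hθ _).1 h1 z hz w hw
    rw [map_sub, map_add, sub_eq_zero] at h2
    rw [h2]
    split_ifs <;> simp

lemma IsTangentAt.add_smul {V : Set (Fin n → k)} {z u v : Fin n → k} (hu : IsTangentAt V z u)
    (hv : IsTangentAt V z v) (c : k) : IsTangentAt V z (u + c • v) := by
  intro f hf
  have : ∀ a, eval z (pderiv a f) * (u + c • v) a =
      eval z (pderiv a f) * u a + c * (eval z (pderiv a f) * v a) := by
    intro a
    simp only [Pi.add_apply, Pi.smul_apply, smul_eq_mul]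
    ring
  simp only [this, Finset.sum_add_distrib, ← Finset.mul_sum, hu f hf, hv f hf, mul_zero, add_zero]

lemma isTangentAt_of_line [Infinite k] {A : Set (Fin n → k)} {v u : Fin n → k}
    (h : ∀ c : k, v + c • u ∈ A) : IsTangentAt A v u := by
  intro f hf
  let y : Fin n → Polynomial k := fun a => Polynomial.C (v a) + Polynomial.X * Polynomial.C (u a)
  have hy : ∀ (c : k) (f : MvPolynomial (Fin n) k),
      (MvPolynomial.aeval y f).eval c = eval (v + c • u) f := by
    intro c f
    have : (Polynomial.aeval (R := k) c).comp (MvPolynomial.aeval y) =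
        MvPolynomial.aeval (v + c • u) := by
      apply MvPolynomial.algHom_ext
      intro a
      simp [y]
      exact mul_comm _ _
    have h1 := DFunLike.congr_fun this f
    simpa [Polynomial.aeval_def] using h1
  have h0 : MvPolynomial.aeval y f = 0 := by
    refine Polynomial.funext fun c => ?_
    rw [hy, mem_vanishing.1 hf _ (h c), Polynomial.eval_zero]
  have h1 := Polynomial.derivative'.map_aeval_mvPolynomial y f
  rw [h0, map_zero] at h1
  have h2 := congrArg (Polynomial.eval 0) h1
  rw [Polynomial.eval_zero, Polynomial.eval_finsetSum] at h2
  rw [h2]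
  refine Finset.sum_congr rfl fun a _ => ?_
  rw [Polynomial.eval_mul, hy, zero_smul, add_zero]
  simp [y]

lemma pderiv_translate (b : Fin n → k) (c : Fin n) (f : MvPolynomial (Fin n) k) :
    pderiv c (translate b f) = translate b (pderiv c f) := by
  have := (pderiv c).map_aeval_mvPolynomial
    (fun a => MvPolynomial.X a + MvPolynomial.C (b a)) f
  rw [translate, this, Finset.sum_eq_single c]
  · simp
  · intro d _ hd
    simp [MvPolynomial.pderiv_X, hd]
  · simp

lemma sum_eval_pderiv_rename {ι : Type*} [Fintype ι] (τ : ι → Fin n) (Q : MvPolynomial ι k)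
    (p u : Fin n → k) : ∑ c, eval p (pderiv c (MvPolynomial.rename τ Q)) * u c =
      ∑ b, eval p (MvPolynomial.rename τ (pderiv b Q)) * u (τ b) := by
  classical
  have h : ∀ c, pderiv c (MvPolynomial.rename τ Q) =
      ∑ b, MvPolynomial.rename τ (pderiv b Q) * pderiv c (MvPolynomial.X (τ b)) := by
    intro c
    have := (pderiv c).map_aeval_mvPolynomial (fun b => MvPolynomial.X (R := k) (τ b)) Q
    simp only [MvPolynomial.rename_eq_aeval]
    exact this
  simp only [h, map_sum, map_mul, Finset.sum_mul]
  rw [Finset.sum_comm]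
  refine Finset.sum_congr rfl fun b _ => ?_
  rw [Finset.sum_eq_single (τ b)]
  · simp
  · intro c _ hc
    simp [MvPolynomial.pderiv_X, hc.symm]
  · simp

lemma eq_C_of_pderiv_eq_zero [CharZero k] {ι : Type*} {Q : MvPolynomial ι k}
    (hQ : ∀ a, pderiv a Q = 0) : Q = MvPolynomial.C (MvPolynomial.constantCoeff Q) := by
  classical
  ext m
  rw [MvPolynomial.coeff_C]
  split_ifs with h
  · rw [← h]
    rfl
  · obtain ⟨a, ha⟩ : ∃ a, m a ≠ 0 := by
      by_contra hcon
      push Not at hcon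
      exact h (Finsupp.ext fun a => (hcon a).symm)
    have h1 := congrArg (MvPolynomial.coeff (m - Finsupp.single a 1)) (hQ a)
    rw [MvPolynomial.coeff_pderiv, MvPolynomial.coeff_zero, mul_eq_zero,
      or_iff_left (Nat.cast_add_one_ne_zero _), tsub_add_cancel_of_le] at h1
    · exact h1
    · exact Finsupp.single_le_iff.2 (Nat.one_le_iff_ne_zero.2 ha)

lemma totalDegree_pderiv_le {ι : Type*} {Q : MvPolynomial ι k} {d : ℕ} (hQ : Q.totalDegree ≤ d + 1)
    (a : ι) : (pderiv a Q).totalDegree ≤ d := by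
  refine Finset.sup_le fun m hm => ?_
  rw [MvPolynomial.mem_support_iff, MvPolynomial.coeff_pderiv] at hm
  have h1 := (MvPolynomial.le_totalDegree
    (MvPolynomial.mem_support_iff.2 (left_ne_zero_of_mul hm))).trans hQ
  rw [Finsupp.sum_add_index' (by simp) (by simp), Finsupp.sum_single_index rfl] at h1
  omega

/-- Coordinates independent on the join `V + W` are independent on the join of `W` and the tangent
space to `V` at a general point. -/
lemma exists_independent_tangent_join [CharZero k] {V W : Set (Fin n → k)}
    (hV : (vanishingIdeal k V).IsPrime) (hW : (vanishingIdeal k W).IsPrime) {ι : Type*} [Finite ι]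
    (τ : ι → Fin n)
    (hτ : ∀ Q : MvPolynomial ι k, MvPolynomial.rename τ Q ∈ vanishingIdeal k (V + W) → Q = 0) :
    ∃ h ∉ vanishingIdeal k V, ∀ z ∈ V, eval z h ≠ 0 → ∀ Q : MvPolynomial ι k,
      MvPolynomial.rename τ Q ∈ vanishingIdeal k ({v | IsTangentAt V z v} + W) → Q = 0 := by
  classical
  cases nonempty_fintype ι
  obtain ⟨h, hh, H⟩ := exists_isTangentAt_pair hV hW τ hτ
  obtain ⟨z₁, hz₁, w₁, hw₁, hne⟩ : ∃ z ∈ V, ∃ w ∈ W, eval (Sum.elim z w) h ≠ 0 := by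
    by_contra hcon
    push Not at hcon
    apply hh
    rw [mem_vanishing]
    rintro _ ⟨z, hz, w, hw, rfl⟩
    exact hcon z hz w hw
  -- Fixing one good `w₁` turns the open condition on pairs into one on `z` alone; for such `z` the
  -- polynomial `h(z, ·)` is not identically zero on `W`.
  refine ⟨fixRight w₁ h, fun hmem => hne ?_, fun z hz hzh => ?_⟩
  · rw [← eval_fixRight]
    exact mem_vanishing.1 hmem z₁ hz₁
  rw [eval_fixRight] at hzh
  have hzW : fixLeft z h ∉ vanishingIdeal k W := fun hmem => hzh (by
    rw [← eval_fixLeft]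
    exact mem_vanishing.1 hmem w₁ hw₁)
  -- Differentiating `Q` along tangent vectors of the linear space `T_zV` and of `W` at `w` gives
  -- zero. For the pair attached to `a` the two derivatives add up to `h(z, w)` times the `a`-th
  -- partial derivative of `Q`, and the factor cancels because the ideal of `W` is prime.
  have step : ∀ Q : MvPolynomial ι k,
      MvPolynomial.rename τ Q ∈ vanishingIdeal k ({v | IsTangentAt V z v} + W) → ∀ a,
      MvPolynomial.rename τ (pderiv a Q) ∈ vanishingIdeal k ({v | IsTangentAt V z v} + W) := by
    intro Q hQ a
    rw [mem_vanishing]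
    rintro _ ⟨v, hv, w, hw, rfl⟩
    have hprod : fixLeft z h * translate v (MvPolynomial.rename τ (pderiv a Q)) ∈
        vanishingIdeal k W := by
      rw [mem_vanishing]
      intro w hw
      obtain ⟨u, u', hu, hu', huu'⟩ := H z hz w hw a
      have h1 : ∑ c, eval (v + w) (pderiv c (MvPolynomial.rename τ Q)) * u c = 0 := by
        refine isTangentAt_of_line (fun c => ?_) _ hQ
        rw [add_right_comm]
        exact Set.add_mem_add (hv.add_smul hu c) hw
      have h2 : ∑ c, eval (v + w) (pderiv c (MvPolynomial.rename τ Q)) * u' c = 0 := by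
        have := hu' (translate v (MvPolynomial.rename τ Q)) (by
          rw [mem_vanishing]
          intro x hx
          rw [eval_translate, add_comm]
          exact mem_vanishing.1 hQ _ (Set.add_mem_add hv hx))
        simpa only [pderiv_translate, eval_translate, add_comm w v] using this
      rw [sum_eval_pderiv_rename] at h1 h2
      have h3 := congrArg₂ (· + ·) h1 h2
      simp only [← Finset.sum_add_distrib, ← mul_add, huu', mul_ite, mul_zero, add_zero] at h3
      rw [Finset.sum_ite_eq' _ a, if_pos (Finset.mem_univ a)] at h3
      rw [map_mul, eval_fixLeft, eval_translate, add_comm w v, mul_comm]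
      exact h3
    have := mem_vanishing.1 ((hW.mem_or_mem hprod).resolve_left hzW) w hw
    rwa [eval_translate, add_comm] at this
  -- All partial derivatives stay in the ideal, so induction on the degree makes them zero. Then `Q`
  -- is a constant vanishing at a point.
  have hind : ∀ (d : ℕ) (Q : MvPolynomial ι k), Q.totalDegree ≤ d →
      MvPolynomial.rename τ Q ∈ vanishingIdeal k ({v | IsTangentAt V z v} + W) → Q = 0 := by
    intro d
    have hconst : ∀ Q : MvPolynomial ι k, (∀ a, pderiv a Q = 0) →
        MvPolynomial.rename τ Q ∈ vanishingIdeal k ({v | IsTangentAt V z v} + W) → Q = 0 := by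
      intro Q hQ hmem
      rw [eq_C_of_pderiv_eq_zero hQ] at hmem ⊢
      rw [MvPolynomial.rename_C] at hmem
      have := mem_vanishing.1 hmem (0 + w₁) (Set.add_mem_add (by intro f _; simp) hw₁)
      rw [MvPolynomial.eval_C] at this
      rw [this, map_zero]
    induction d with
    | zero =>
      intro Q hQ hmem
      refine hconst Q (fun a => ?_) hmem
      rw [MvPolynomial.totalDegree_eq_zero_iff_eq_C.1 (Nat.le_zero.1 hQ), MvPolynomial.pderiv_C]
    | succ d ih =>
      intro Q hQ hmem
      refine hconst Q (fun a => ih _ ?_ (step Q hmem a)) hmem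
      exact totalDegree_pderiv_le hQ a
  exact fun Q hQ => hind _ Q le_rfl hQ

end Terracini
end
end SecantBetti

namespace SecantBetti
noncomputable section

/-! ### Transcendence degrees of coordinate rings -/

section Trdeg

open scoped Pointwise
open MvPolynomial (vanishingIdeal eval)

universe u

variable {k : Type u} [Field k]

lemma algebraicIndependent_option {κ A : Type*} [CommRing A] [Algebra k A] {x : κ → A} {a : A}
    (h : ∀ G : Polynomial (MvPolynomial κ k),
      G.eval₂ (MvPolynomial.aeval (R := k) x : MvPolynomial κ k →+* A) a = 0 → G = 0) :
    AlgebraicIndependent k (fun o : Option κ => o.elim a x) := by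
  rw [algebraicIndependent_iff]
  intro q hq
  have h1 : (Polynomial.eval₂ (MvPolynomial.aeval (R := k) x : MvPolynomial κ k →+* A) a
      (MvPolynomial.optionEquivLeft k κ q)) = 0 := by
    rw [← hq]
    have : (Polynomial.eval₂RingHom (MvPolynomial.aeval (R := k) x : MvPolynomial κ k →+* A) a).comp
        (MvPolynomial.optionEquivLeft k κ : MvPolynomial (Option κ) k →+* _) =
        (MvPolynomial.aeval (R := k) (fun o : Option κ => o.elim a x) :
          MvPolynomial (Option κ) k →+* A) := by
      apply MvPolynomial.ringHom_ext
      · intro c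
        simp
      · rintro (_ | b) <;> simp
    exact RingHom.congr_fun this q
  have h2 := h _ h1
  exact (EmbeddingLike.map_eq_zero_iff (f := MvPolynomial.optionEquivLeft k κ)).1 h2

/-- A proper quotient of a domain has smaller transcendence degree. -/
lemma trdeg_add_one_le_of_surjective {A B : Type u} [CommRing A] [IsDomain A] [CommRing B]
    [IsDomain B] [Algebra k A] [Algebra k B] (π : A →ₐ[k] B) (hπ : Function.Surjective π) {f : A}
    (hf : π f = 0) (hf0 : f ≠ 0) : Algebra.trdeg k B + 1 ≤ Algebra.trdeg k A := by
  obtain ⟨s, hs⟩ := exists_isTranscendenceBasis k B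
  choose σ hσ using hπ
  let x : s → A := fun b => σ b
  have hx : ∀ q : MvPolynomial s k, π (MvPolynomial.aeval x q) = 0 → q = 0 := by
    intro q hq
    refine (algebraicIndependent_iff.1 hs.1) q ?_
    rw [← hq, ← AlgHom.comp_apply, MvPolynomial.comp_aeval]
    simp only [x, hσ]
  have hind : AlgebraicIndependent k (fun o : Option s => o.elim f x) := by
    refine algebraicIndependent_option fun G => ?_
    -- Applying `π` to a relation in powers of `f` leaves a relation for its constant coefficient
    -- among elements independent in `B`, so that coefficient is zero. Cancelling `f` in the domain
    -- `A` gives a relation of smaller degree.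
    induction hd : G.natDegree using Nat.strong_induction_on generalizing G with
    | _ d ih =>
      intro hG
      have h0 : G.coeff 0 = 0 := by
        apply hx
        have := congrArg π hG
        rw [map_zero, ← G.divX_mul_X_add, Polynomial.eval₂_add, Polynomial.eval₂_mul,
          Polynomial.eval₂_X, Polynomial.eval₂_C, map_add, map_mul, hf, mul_zero, zero_add] at this
        exact this
      have hGX : G = G.divX * Polynomial.X := by
        conv_lhs => rw [← G.divX_mul_X_add, h0, map_zero, add_zero]
      rw [hGX, Polynomial.eval₂_mul, Polynomial.eval₂_X, mul_eq_zero, or_iff_left hf0] at hG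
      by_contra hne
      have hpos : d ≠ 0 := by
        rintro rfl
        rw [Polynomial.eq_C_of_natDegree_eq_zero hd, h0, map_zero] at hne
        exact hne rfl
      have h1 := ih G.divX.natDegree (by
        rw [Polynomial.natDegree_divX_eq_natDegree_tsub_one]
        omega) G.divX rfl hG
      rw [h1, zero_mul] at hGX
      exact hne hGX
  have := hind.cardinalMk_le_trdeg
  rwa [Cardinal.mk_option, hs.cardinalMk_eq_trdeg] at this

variable {r n : ℕ}

/-- An ideal and its partial elimination ideals. -/
lemma trdeg_add_one_le_of_partialElim_le {I : Ideal (MvPolynomial (Fin (r + 1)) k)}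
    {K : Ideal (MvPolynomial (Fin r) k)} (hK : K.IsPrime) (hIK : ∀ l, partialElim I l ≤ K) :
    Algebra.trdeg k (MvPolynomial (Fin r) k ⧸ K) + 1 ≤
      Algebra.trdeg k (MvPolynomial (Fin (r + 1)) k ⧸ I) := by
  obtain ⟨s, hs⟩ := exists_isTranscendenceBasis k (MvPolynomial (Fin r) k ⧸ K)
  choose σ hσ using Ideal.Quotient.mk_surjective (I := K)
  let x : s → MvPolynomial (Fin r) k := fun b => σ b
  have hx : ∀ q : MvPolynomial s k, MvPolynomial.aeval x q ∈ K → q = 0 := by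
    intro q hq
    refine (algebraicIndependent_iff.1 hs.1) q ?_
    rw [← Ideal.Quotient.eq_zero_iff_mem, ← Ideal.Quotient.mkₐ_eq_mk k, ← AlgHom.comp_apply,
      MvPolynomial.comp_aeval] at hq
    simpa only [x, Ideal.Quotient.mkₐ_eq_mk, hσ] using hq
  let θ := Ideal.Quotient.mkₐ k I
  let y : s → MvPolynomial (Fin (r + 1)) k ⧸ I := fun b => θ (MvPolynomial.rename Fin.succ (x b))
  have hind : AlgebraicIndependent k (fun o : Option s => o.elim (θ (MvPolynomial.X 0)) y) := by
    refine algebraicIndependent_option fun G hG => ?_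
    obtain ⟨F, hF⟩ : ∃ F : MvPolynomial (Fin (r + 1)) k, MvPolynomial.finSuccEquiv k r F =
        G.map (MvPolynomial.aeval (R := k) x : MvPolynomial s k →+* MvPolynomial (Fin r) k) :=
      ⟨(MvPolynomial.finSuccEquiv k r).symm _, AlgEquiv.apply_symm_apply _ _⟩
    have hθF : θ F = 0 := by
      rw [← hG]
      have h1 : F = (MvPolynomial.finSuccEquiv k r).symm (G.map
          (MvPolynomial.aeval (R := k) x : MvPolynomial s k →+* MvPolynomial (Fin r) k)) := by
        rw [← hF, AlgEquiv.symm_apply_apply]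
      rw [h1]
      have h2 : ((θ : _ →+* MvPolynomial (Fin (r + 1)) k ⧸ I).comp
          ((MvPolynomial.finSuccEquiv k r).symm : _ →+* MvPolynomial (Fin (r + 1)) k)).comp
          (Polynomial.mapRingHom
            (MvPolynomial.aeval (R := k) x : MvPolynomial s k →+* MvPolynomial (Fin r) k)) =
          Polynomial.eval₂RingHom
            (MvPolynomial.aeval (R := k) y : MvPolynomial s k →+* _) (θ (MvPolynomial.X 0)) := by
        have hC : ∀ c, (MvPolynomial.finSuccEquiv k r).symm (Polynomial.C c) =
            MvPolynomial.rename Fin.succ c := by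
          intro c
          rw [AlgEquiv.symm_apply_eq, finSuccEquiv_rename_succ]
        have hX : (MvPolynomial.finSuccEquiv k r).symm Polynomial.X = MvPolynomial.X 0 := by
          rw [AlgEquiv.symm_apply_eq, MvPolynomial.finSuccEquiv_X_zero]
        apply Polynomial.ringHom_ext
        · intro q
          have h3 : (θ.comp (MvPolynomial.rename Fin.succ)).comp (MvPolynomial.aeval (R := k) x) =
              MvPolynomial.aeval y := by
            apply MvPolynomial.algHom_ext
            intro b
            simp [y]
          simpa [hC] using DFunLike.congr_fun h3 q
        · simp [hX]
      exact RingHom.congr_fun h2 G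
    have hFI : F ∈ I := Ideal.Quotient.eq_zero_iff_mem.1 hθF
    -- A relation of degree `l` in `x₀` lifts to an element of `I` of degree at most `l` in `x₀`, so
    -- its leading coefficient lands in the `l`-th partial elimination ideal, hence in `K`, where
    -- the `x b` are independent.
    have hmem : MvPolynomial.aeval x G.leadingCoeff ∈ K := by
      refine hIK G.natDegree (mem_partialElim.2 ⟨F, hFI, fun l hl => ?_, ?_⟩)
      · rw [coeffZero_apply, hF, Polynomial.coeff_map, Polynomial.coeff_eq_zero_of_natDegree_lt hl,
          map_zero]
      · rw [coeffZero_apply, hF, Polynomial.coeff_map]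
        rfl
    exact Polynomial.leadingCoeff_eq_zero.1 (hx _ hmem)
  have := hind.cardinalMk_le_trdeg
  rwa [Cardinal.mk_option, hs.cardinalMk_eq_trdeg] at this

lemma quotientMapₐ_injective {m : ℕ} (φ : MvPolynomial (Fin m) k →ₐ[k] MvPolynomial (Fin n) k)
    (I : Ideal (MvPolynomial (Fin n) k)) :
    Function.Injective (Ideal.quotientMapₐ (I := I.comap φ) I φ le_rfl) := by
  rw [injective_iff_map_eq_zero]
  intro a
  obtain ⟨f, rfl⟩ := Ideal.Quotient.mk_surjective a
  intro h
  rw [Ideal.quotient_map_mkₐ, Ideal.Quotient.mkₐ_eq_mk, Ideal.Quotient.eq_zero_iff_mem] at h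
  exact Ideal.Quotient.eq_zero_iff_mem.2 h

lemma trdeg_quotient_comap_le {m : ℕ} (φ : MvPolynomial (Fin m) k →ₐ[k] MvPolynomial (Fin n) k)
    (I : Ideal (MvPolynomial (Fin n) k)) :
    Algebra.trdeg k (MvPolynomial (Fin m) k ⧸ I.comap φ) ≤
      Algebra.trdeg k (MvPolynomial (Fin n) k ⧸ I) :=
  trdeg_le_of_injective _ (quotientMapₐ_injective φ I)

/-- Adding one generator raises the transcendence degree by at most one. -/
lemma trdeg_le_trdeg_add_one {A B : Type u} [CommRing A] [IsDomain A] [CommRing B]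
    [Algebra k A] [Algebra k B] (ρ : B →ₐ[k] A) (hρ : Function.Injective ρ) (y : A)
    (hy : ∀ f, f ∈ Algebra.adjoin k (insert y (Set.range ρ))) :
    Algebra.trdeg k A ≤ Algebra.trdeg k B + 1 := by
  let _ : Algebra B A := ρ.toRingHom.toAlgebra
  have : IsScalarTower k B A := IsScalarTower.of_algebraMap_eq fun c => (ρ.commutes c).symm
  have : FaithfulSMul B A := (faithfulSMul_iff_algebraMap_injective B A).2 hρ
  have : Nontrivial B := ρ.toRingHom.domain_nontrivial
  have htop : Algebra.adjoin B {y} = ⊤ := by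
    rw [eq_top_iff]
    rintro a -
    induction hy a using Algebra.adjoin_induction with
    | mem x hx =>
      rcases hx with rfl | ⟨c, rfl⟩
      · exact Algebra.subset_adjoin rfl
      · exact Subalgebra.algebraMap_mem _ c
    | algebraMap c =>
      rw [IsScalarTower.algebraMap_apply k B A]
      exact Subalgebra.algebraMap_mem _ _
    | add x y _ _ hx hy => exact Subalgebra.add_mem _ hx hy
    | mul x y _ _ hx hy => exact Subalgebra.mul_mem _ hx hy
  have halg : Algebra.IsAlgebraic (Algebra.adjoin B {y}) A :=
    ⟨fun a => isAlgebraic_algebraMap (R := Algebra.adjoin B {y}) ⟨a, htop ▸ Algebra.mem_top⟩⟩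
  have h1 := Algebra.IsAlgebraic.trdeg_le_cardinalMk (R := B) (A := A) (s := {y})
  rw [Cardinal.mk_singleton] at h1
  rw [← trdeg_add_eq k B (A := A)]
  gcongr

/-- The coordinate functions generate the quotient ring, so a transcendence basis can be selected
among them. -/
lemma exists_variables {I : Ideal (MvPolynomial (Fin n) k)} (hI : I.IsPrime) :
    ∃ (ι : Type u) (_ : Finite ι) (τ : ι → Fin n),
      (∀ Q : MvPolynomial ι k, MvPolynomial.rename τ Q ∈ I → Q = 0) ∧
      Algebra.trdeg k (MvPolynomial (Fin n) k ⧸ I) = Cardinal.mk ι := by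
  let x : Fin n → MvPolynomial (Fin n) k ⧸ I := fun a => Ideal.Quotient.mk I (MvPolynomial.X a)
  have htop : Algebra.adjoin k (Set.range x) = ⊤ := by
    have h1 : Set.range x = Ideal.Quotient.mkₐ k I '' Set.range MvPolynomial.X := by
      rw [← Set.range_comp]
      rfl
    rw [h1, ← AlgHom.map_adjoin, MvPolynomial.adjoin_range_X, Algebra.map_top,
      AlgHom.range_eq_top]
    exact Ideal.Quotient.mkₐ_surjective k I
  have halg : Algebra.IsAlgebraic (Algebra.adjoin k (Set.range x)) (MvPolynomial (Fin n) k ⧸ I) := by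
    rw [htop]
    refine ⟨fun a => ?_⟩
    exact isAlgebraic_algebraMap (R := (⊤ : Subalgebra k _)) ⟨a, trivial⟩
  obtain ⟨t, ht, hbas⟩ := exists_isTranscendenceBasis_subset (R := k) (Set.range x)
  choose τ hτ using fun b : t => ht b.2
  refine ⟨t, (Set.finite_range x).subset ht, τ, fun Q hQ => ?_, hbas.cardinalMk_eq_trdeg.symm⟩
  refine (algebraicIndependent_iff.1 hbas.1) Q ?_
  rw [← Ideal.Quotient.eq_zero_iff_mem, ← Ideal.Quotient.mkₐ_eq_mk k, MvPolynomial.rename_eq_aeval,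
    ← AlgHom.comp_apply, MvPolynomial.comp_aeval] at hQ
  rw [← hQ]
  congr 2
  funext b
  exact (hτ b).symm

lemma mk_le_trdeg {ι : Type u} {τ : ι → Fin n} {I : Ideal (MvPolynomial (Fin n) k)}
    (hτ : ∀ Q : MvPolynomial ι k, MvPolynomial.rename τ Q ∈ I → Q = 0) :
    Cardinal.mk ι ≤ Algebra.trdeg k (MvPolynomial (Fin n) k ⧸ I) := by
  have : AlgebraicIndependent k (fun b => Ideal.Quotient.mkₐ k I (MvPolynomial.X (τ b))) := by
    rw [algebraicIndependent_iff]
    intro Q hQ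
    apply hτ
    rw [← Ideal.Quotient.eq_zero_iff_mem, ← Ideal.Quotient.mkₐ_eq_mk k,
      MvPolynomial.rename_eq_aeval, ← AlgHom.comp_apply, MvPolynomial.comp_aeval]
    exact hQ
  exact this.cardinalMk_le_trdeg

end Trdeg
end
end SecantBetti

namespace SecantBetti
noncomputable section

/-! ### The limit of the partial elimination ideals at a general point -/

section General

open scoped Pointwise
open MvPolynomial (vanishingIdeal eval pderiv)

universe u

variable {k : Type u} [Field k] {n m r : ℕ}

lemma vanishingIdeal_univ [Infinite k] : vanishingIdeal k (Set.univ : Set (Fin n → k)) = ⊥ := by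
  rw [eq_bot_iff]
  intro f hf
  exact MvPolynomial.funext fun x => by rw [mem_vanishing.1 hf x trivial, map_zero]

lemma isPrime_vanishingIdeal_submodule [Infinite k] (T : Submodule k (Fin n → k)) :
    (vanishingIdeal k (T : Set (Fin n → k))).IsPrime := by
  let b := Module.finBasis k T
  let φ : (Fin (Module.finrank k T) → k) →ₗ[k] (Fin n → k) :=
    T.subtype ∘ₗ b.equivFun.symm.toLinearMap
  have h : (T : Set (Fin n → k)) = φ '' Set.univ := by
    rw [Set.image_univ, ← LinearMap.coe_range, LinearMap.range_comp, LinearEquiv.range,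
      Submodule.map_top, Submodule.range_subtype]
  rw [h, vanishingIdeal_image, vanishingIdeal_univ]
  have : (⊥ : Ideal (MvPolynomial (Fin (Module.finrank k T)) k)).IsPrime := Ideal.isPrime_bot
  exact Ideal.IsPrime.comap _

/-- The Zariski tangent space. -/
def tangentSubmodule (V : Set (Fin n → k)) (z : Fin n → k) : Submodule k (Fin n → k) where
  carrier := {v | IsTangentAt V z v}
  zero_mem' := by
    intro f _
    simp
  add_mem' := by
    intro u v hu hv
    have := hu.add_smul hv 1
    rwa [one_smul] at this
  smul_mem' := by
    intro c v hv
    have h0 : IsTangentAt V z 0 := by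
      intro f _
      simp
    have := h0.add_smul hv c
    rwa [zero_add] at this

lemma partialElim_mono (I : Ideal (MvPolynomial (Fin (r + 1)) k)) (l : ℕ) :
    partialElim I l ≤ partialElim I (l + 1) := by
  intro c hc
  obtain ⟨f, hf, h0, rfl⟩ := mem_partialElim.1 hc
  refine mem_partialElim.2 ⟨MvPolynomial.X 0 * f, I.mul_mem_left _ hf, fun i hi => ?_, by simp⟩
  obtain ⟨i, rfl⟩ : ∃ e, i = e + 1 := ⟨i - 1, by omega⟩
  rw [coeffZero_X_zero_mul_succ]
  exact h0 i (by omega)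

lemma mem_adjoin_pull [Infinite k] (g : (Fin (r + 1) → k) ≃ₗ[k] (Fin (r + 1) → k))
    (f : MvPolynomial (Fin (r + 1)) k) :
    f ∈ Algebra.adjoin k (insert (pull g.toLinearMap (MvPolynomial.X 0))
      (Set.range (pull (dropZero k r ∘ₗ g.toLinearMap)))) := by
  have hf : f = pull g.toLinearMap (pull g.symm.toLinearMap f) :=
    MvPolynomial.funext fun x => by simp
  rw [hf]
  generalize pull g.symm.toLinearMap f = F
  induction F using MvPolynomial.induction_on with
  | C c =>
    have : pull g.toLinearMap (MvPolynomial.C c) = algebraMap k _ c :=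
      (pull g.toLinearMap).commutes c
    rw [this]
    exact Subalgebra.algebraMap_mem _ c
  | add p q hp hq =>
    rw [map_add]
    exact Subalgebra.add_mem _ hp hq
  | mul_X p a hp =>
    rw [map_mul]
    refine Subalgebra.mul_mem _ hp (Algebra.subset_adjoin ?_)
    refine Fin.cases (Or.inl rfl) (fun a => Or.inr ⟨MvPolynomial.X a, ?_⟩) a
    exact MvPolynomial.funext fun x => by simp

/-- At a general point of `V`, a prime limit of partial elimination ideals of the join of `V` and
`W` is the ideal of the projection of the join of `W` and the tangent space. -/
lemma exists_partialElim_eq [CharZero k] {V W : Set (Fin (r + 1) → k)}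
    (hV : (vanishingIdeal k V).IsPrime) (hVc : IsCone V) (hW : (vanishingIdeal k W).IsPrime)
    (hWc : IsCone W) :
    ∃ h ∉ vanishingIdeal k V, ∀ z ∈ V, eval z h ≠ 0 →
      ∀ (g : (Fin (r + 1) → k) ≃ₗ[k] (Fin (r + 1) → k)) (c : k), c ≠ 0 →
        g z = c • Pi.single 0 1 → ∀ K : Ideal (MvPolynomial (Fin r) k), K.IsPrime →
        (∀ l, partialElim (inCoordinates g (vanishingIdeal k (V + W))) l ≤ K) →
        (∃ l, K ≤ partialElim (inCoordinates g (vanishingIdeal k (V + W))) l) →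
        K = (vanishingIdeal k ((tangentSubmodule V z : Set (Fin (r + 1) → k)) + W)).comap
          (pull (dropZero k r ∘ₗ g.toLinearMap)) := by
  obtain ⟨h₁, hh₁, H₁⟩ := exists_partialElim_le hV hVc
  obtain ⟨ι, _, τ, hτ, hcard⟩ := exists_variables (isPrime_vanishingIdeal_add hV hW)
  obtain ⟨h₂, hh₂, H₂⟩ := exists_independent_tangent_join hV hW τ hτ
  refine ⟨h₁ * h₂, fun hmem => (hV.mem_or_mem hmem).elim hh₁ hh₂, ?_⟩
  intro z hz hzh g c hc hgz K hK hle hge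
  rw [map_mul] at hzh
  obtain ⟨J, hJ⟩ : ∃ J, J = vanishingIdeal k ((tangentSubmodule V z : Set (Fin (r + 1) → k)) + W) :=
    ⟨_, rfl⟩
  rw [← hJ]
  have hJp : J.IsPrime := hJ ▸ isPrime_vanishingIdeal_add (isPrime_vanishingIdeal_submodule _) hW
  obtain ⟨φ, hφ⟩ : ∃ φ, φ = pull (dropZero k r ∘ₗ g.toLinearMap) := ⟨_, rfl⟩
  rw [← hφ]
  have hKP : K ≤ J.comap φ := by
    intro f hf
    obtain ⟨l, hl⟩ := hge
    rw [Ideal.mem_comap, hJ, hφ, mem_vanishing]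
    rintro _ ⟨v, hv, p, hp, rfl⟩
    rw [eval_pull]
    exact H₁ z hz (left_ne_zero_of_mul hzh) W hWc g c hc hgz l f (hl hf) v p hv hp
  refine le_antisymm hKP fun f hf => ?_
  by_contra hfK
  have hPp : (J.comap φ).IsPrime := Ideal.IsPrime.comap _
  have e1 : Algebra.trdeg k (MvPolynomial (Fin r) k ⧸ J.comap φ) + 1 ≤
      Algebra.trdeg k (MvPolynomial (Fin r) k ⧸ K) :=
    trdeg_add_one_le_of_surjective (Ideal.Quotient.factorₐ k hKP)
      (Ideal.Quotient.factor_surjective hKP) (f := Ideal.Quotient.mk K f)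
      (by
        change Ideal.Quotient.mk _ f = 0
        exact Ideal.Quotient.eq_zero_iff_mem.2 hf)
      (fun h => hfK (Ideal.Quotient.eq_zero_iff_mem.1 h))
  have e2 := trdeg_add_one_le_of_partialElim_le hK hle
  have e3 := trdeg_quotient_comap_le (pull g.toLinearMap)
    (vanishingIdeal k (V + W))
  rw [hcard] at e3
  have e4 := mk_le_trdeg (I := J) (τ := τ) (by
    rw [hJ]
    exact H₂ z hz (right_ne_zero_of_mul hzh))
  have e5 := trdeg_le_trdeg_add_one _ (quotientMapₐ_injective φ J)
    (Ideal.Quotient.mkₐ k J (pull g.toLinearMap (MvPolynomial.X 0))) (by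
      intro a
      obtain ⟨F, rfl⟩ := Ideal.Quotient.mkₐ_surjective k J a
      have h1 := (Subalgebra.mem_map (f := Ideal.Quotient.mkₐ k J)).2 ⟨F, mem_adjoin_pull g F, rfl⟩
      rw [AlgHom.map_adjoin (Ideal.Quotient.mkₐ k J), Set.image_insert_eq, ← hφ] at h1
      refine Algebra.adjoin_mono (Set.insert_subset_insert ?_) h1
      rintro _ ⟨_, ⟨y, rfl⟩, rfl⟩
      exact ⟨Ideal.Quotient.mkₐ k _ y, rfl⟩)
  have hfin : Algebra.trdeg k (MvPolynomial (Fin r) k ⧸ J.comap φ) < Cardinal.aleph0 :=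
    trdeg_lt_aleph0_of_finiteType
  obtain ⟨d, hd⟩ := Cardinal.lt_aleph0.1 hfin
  -- Write `t` for the degree of the projected tangent join. A strict inclusion of primes would give
  -- `t + 2 ≤ trdeg(S_z/K) + 1 ≤ trdeg(S/I) ≤ trdeg(S/J) ≤ t + 1`, impossible as `t` is finite.
  have e6 : Algebra.trdeg k (MvPolynomial (Fin r) k ⧸ J.comap φ) + 1 + 1 ≤
      Algebra.trdeg k (MvPolynomial (Fin r) k ⧸ J.comap φ) + 1 :=
    (add_le_add_left e1 1).trans (e2.trans (e3.trans (e4.trans e5)))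
  rw [hd] at e6
  have : d + 1 + 1 ≤ d + 1 := by exact_mod_cast e6
  omega

/-- Scaling preserves the ideal of the cone, and the chain rule only contributes the factor `c`.
Genericity is given by a polynomial that need not be homogeneous, so it can hold at a multiple of a
chosen representative only. -/
lemma IsTangentAt.smul_point {V : Set (Fin n → k)} (hV : IsCone V) {z v : Fin n → k}
    (h : IsTangentAt V z v) {c : k} (hc : c ≠ 0) : IsTangentAt V (c • z) v := by
  intro f hf
  let y : Fin n → MvPolynomial (Fin n) k := fun a => MvPolynomial.C c * MvPolynomial.X a
  have hy : ∀ x F, eval x (MvPolynomial.aeval y F) = eval (c • x) F := by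
    intro x F
    have : (MvPolynomial.aeval (R := k) x).comp (MvPolynomial.aeval y) =
        MvPolynomial.aeval (c • x) := by
      apply MvPolynomial.algHom_ext
      intro a
      simp [y]
    exact DFunLike.congr_fun this F
  have h1 := h (MvPolynomial.aeval y f) (by
    rw [mem_vanishing]
    intro x hx
    rw [hy]
    exact mem_vanishing.1 hf _ (hV.2 c x hx))
  have h2 : ∀ b, pderiv b (MvPolynomial.aeval y f) =
      MvPolynomial.C c * MvPolynomial.aeval y (pderiv b f) := by
    intro b
    rw [(pderiv b).map_aeval_mvPolynomial, Finset.sum_eq_single b]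
    · simp only [y, MvPolynomial.pderiv_C_mul, MvPolynomial.pderiv_X_self, mul_one]
      exact mul_comm _ _
    · intro a _ ha
      simp [y, MvPolynomial.pderiv_X, ha]
    · simp
  simp only [h2, map_mul, MvPolynomial.eval_C, hy, mul_assoc, ← Finset.mul_sum] at h1
  exact (mul_eq_zero.1 h1).resolve_left hc

lemma tangentSubmodule_smul {V : Set (Fin n → k)} (hV : IsCone V) (z : Fin n → k) {c : k}
    (hc : c ≠ 0) : tangentSubmodule V (c • z) = tangentSubmodule V z := by
  ext v
  constructor
  · intro h
    have := IsTangentAt.smul_point hV h (inv_ne_zero hc)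
    rwa [inv_smul_smul₀ hc] at this
  · intro h
    exact IsTangentAt.smul_point hV h hc

/-! ### Linear maps with the same kernel and cylinders -/

lemma exists_comp_eq_of_ker_le {E F G : Type*} [AddCommGroup E] [Module k E] [AddCommGroup F]
    [Module k F] [AddCommGroup G] [Module k G] {p : E →ₗ[k] F} (hp : Function.Surjective p)
    {q : E →ₗ[k] G} (h : LinearMap.ker p ≤ LinearMap.ker q) : ∃ χ : F →ₗ[k] G, χ ∘ₗ p = q := by
  obtain ⟨s, hs⟩ := p.exists_rightInverse_of_surjective (LinearMap.range_eq_top.2 hp)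
  refine ⟨q ∘ₗ s, ?_⟩
  ext x
  have h1 : s (p x) - x ∈ LinearMap.ker p := by
    have : p (s (p x)) = p x := LinearMap.congr_fun hs (p x)
    rw [LinearMap.mem_ker, map_sub, this, sub_self]
  have h2 := LinearMap.mem_ker.1 (h h1)
  rw [map_sub, sub_eq_zero] at h2
  exact h2

lemma dropZero_surjective : Function.Surjective (dropZero k r) := fun x =>
  ⟨consZero k r x, dropZero_consZero x⟩

lemma ker_dropZero : LinearMap.ker (dropZero k r) = Submodule.span k {Pi.single 0 1} := by
  ext x
  rw [LinearMap.mem_ker, Submodule.mem_span_singleton]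
  constructor
  · intro h
    refine ⟨x 0, ?_⟩
    ext a
    refine Fin.cases (by simp) (fun a => ?_) a
    have := congrFun h a
    rw [dropZero_apply] at this
    simp [this]
  · rintro ⟨c, rfl⟩
    rw [map_smul, dropZero_single_zero, smul_zero]

lemma exists_linearEquiv_apply_eq_single {v : Fin (r + 1) → k} (hv : v ≠ 0) :
    ∃ g : (Fin (r + 1) → k) ≃ₗ[k] (Fin (r + 1) → k), g v = Pi.single 0 1 := by
  obtain ⟨i, hi⟩ := Function.ne_iff.1 hv
  rw [Pi.zero_apply] at hi
  have hfr : Module.finrank k ((Fin (r + 1) → k) ⧸ Submodule.span k {v}) = Module.finrank k (Fin r → k) := by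
    have := Submodule.finrank_quotient_add_finrank (Submodule.span k {v})
    rw [finrank_span_singleton hv, Module.finrank_fin_fun] at this
    rw [Module.finrank_fin_fun]
    omega
  let e := LinearEquiv.ofFinrankEq _ _ hfr
  let φ : (Fin (r + 1) → k) →ₗ[k] (Fin r → k) := e.toLinearMap ∘ₗ (Submodule.span k {v}).mkQ
  have hφ : ∀ x, φ x = 0 ↔ x ∈ Submodule.span k {v} := by
    intro x
    simp [φ]
  -- The zeroth new coordinate is `x i / v i`, equal to one at `v`; the others are coordinates on
  -- the quotient by the line through `v`.
  let G : (Fin (r + 1) → k) →ₗ[k] (Fin (r + 1) → k) :=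
    (LinearMap.proj i).smulRight ((v i)⁻¹ • Pi.single 0 1) + consZero k r ∘ₗ φ
  have hG0 : ∀ x, G x 0 = x i * (v i)⁻¹ := by
    intro x
    simp [G]
  have hGs : ∀ x a, G x (Fin.succ a) = φ x a := by
    intro x a
    simp [G]
  have hinj : Function.Injective G := by
    rw [← LinearMap.ker_eq_bot, LinearMap.ker_eq_bot']
    intro x hx
    have h1 : φ x = 0 := by
      ext a
      rw [← hGs, hx]
      rfl
    obtain ⟨c, rfl⟩ := Submodule.mem_span_singleton.1 ((hφ x).1 h1)
    have h2 := hG0 (c • v)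
    rw [hx, Pi.smul_apply, smul_eq_mul, mul_inv_cancel_right₀ hi] at h2
    rw [← h2]
    exact zero_smul _ _
  refine ⟨LinearEquiv.ofInjectiveEndo G hinj, ?_⟩
  have h1 : φ v = 0 := (hφ v).2 (Submodule.mem_span_singleton_self v)
  change G v = _
  ext a
  refine Fin.cases ?_ (fun a => ?_) a
  · rw [hG0, mul_inv_cancel₀ hi, Pi.single_eq_same]
  · rw [hGs, h1]
    simp

/-- Over a point of `C` the coordinate `x₀` is free, and a polynomial in `x₀` vanishing everywhere
has zero coefficients. So the ideal of the cylinder is the extension of the ideal of `C`. -/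
lemma mem_vanishingIdeal_dropZero_preimage [Infinite k] {C : Set (Fin r → k)}
    {f : MvPolynomial (Fin (r + 1)) k} :
    f ∈ vanishingIdeal k (dropZero k r ⁻¹' C) ↔ ∀ l, coeffZero k r l f ∈ vanishingIdeal k C := by
  have hev : ∀ (t : k) (x : Fin r → k), eval (Fin.cons t x) f =
      ((MvPolynomial.finSuccEquiv k r f).map (eval x)).eval t := fun t x =>
    MvPolynomial.eval_eq_eval_mv_eval' x t f
  constructor
  · intro hf l
    rw [mem_vanishing]
    intro x hx
    have : (MvPolynomial.finSuccEquiv k r f).map (eval x) = 0 := by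
      refine Polynomial.funext fun t => ?_
      rw [← hev, Polynomial.eval_zero]
      refine mem_vanishing.1 hf _ ?_
      have : dropZero k r (Fin.cons t x) = x := by
        ext a
        simp
      rw [Set.mem_preimage, this]
      exact hx
    rw [coeffZero_apply, ← Polynomial.coeff_map, this, Polynomial.coeff_zero]
  · intro hf
    rw [mem_vanishing]
    intro x hx
    rw [eq_sum_coeffZero f, map_sum]
    refine Finset.sum_eq_zero fun l _ => ?_
    rw [map_mul, MvPolynomial.eval_rename]
    have := mem_vanishing.1 (hf l) (dropZero k r x) hx
    have h2 : (x ∘ Fin.succ) = dropZero k r x := rfl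
    rw [h2, this, mul_zero]

lemma vanishingIdeal_image_equiv (g : (Fin n → k) ≃ₗ[k] (Fin n → k)) (A : Set (Fin n → k)) :
    vanishingIdeal k (g.symm ⁻¹' A) = inCoordinates g (vanishingIdeal k A) := by
  rw [inCoordinates_eq, ← vanishingIdeal_image]
  congr 1
  exact (g.toEquiv.image_eq_preimage_symm A).symm

/-- Koszul cohomology of the ideal of a cylinder. -/
lemma koszulVanishes_preimage [CharZero k] {χ : (Fin r → k) →ₗ[k] (Fin m → k)}
    (hχ : Function.Surjective χ) (B : Set (Fin m → k)) {i j : ℤ}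
    (h : KoszulVanishes (vanishingIdeal k B) i j) :
    KoszulVanishes (vanishingIdeal k (χ ⁻¹' B)) i j := by
  have hinj_case : ∀ {r : ℕ} {χ : (Fin r → k) →ₗ[k] (Fin m → k)}, Function.Surjective χ →
      Function.Injective χ → KoszulVanishes (vanishingIdeal k (χ ⁻¹' B)) i j := by
    intro r χ hχ hinj
    let e := LinearEquiv.ofBijective χ ⟨hinj, hχ⟩
    obtain rfl : r = m := by simpa using e.finrank_eq
    have := vanishingIdeal_image_equiv e.symm B
    rw [LinearEquiv.symm_symm] at this
    change KoszulVanishes (vanishingIdeal k (e ⁻¹' B)) i j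
    rw [this, koszulVanishes_inCoordinates_iff]
    exact h
  induction r with
  | zero => exact hinj_case hχ (Function.injective_of_subsingleton χ)
  | succ r ih =>
    by_cases hinj : Function.Injective χ
    · exact hinj_case hχ hinj
    rw [← LinearMap.ker_eq_bot, Submodule.eq_bot_iff] at hinj
    push Not at hinj
    -- A kernel vector is moved to `e₀`; the set becomes a cylinder in the direction `x₀`, which
    -- `relVanishes_extFam` handles, over a cylinder in one dimension less.
    obtain ⟨v, hv, hv0⟩ := hinj
    obtain ⟨g, hg⟩ := exists_linearEquiv_apply_eq_single hv0
    obtain ⟨χ', hχ'⟩ := exists_comp_eq_of_ker_le (p := dropZero k r) dropZero_surjective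
      (q := χ ∘ₗ g.symm.toLinearMap) (by
        rw [ker_dropZero, Submodule.span_singleton_le_iff_mem, LinearMap.mem_ker, ← hg]
        simpa using hv)
    have hsurj : Function.Surjective χ' := by
      intro y
      obtain ⟨x, rfl⟩ := hχ y
      refine ⟨dropZero k r (g x), ?_⟩
      have := LinearMap.congr_fun hχ' (g x)
      simpa using this
    rw [← koszulVanishes_inCoordinates_iff g, ← vanishingIdeal_image_equiv]
    have hset : g.symm ⁻¹' (χ ⁻¹' B) = dropZero k r ⁻¹' (χ' ⁻¹' B) := by
      ext x
      have := LinearMap.congr_fun hχ' x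
      simp only [LinearMap.comp_apply] at this
      rw [Set.mem_preimage, Set.mem_preimage, Set.mem_preimage, Set.mem_preimage, this]
      rfl
    rw [hset]
    have h1 := ih hsurj
    cases i with
    | negSucc i => trivial
    | ofNat i =>
      refine (koszulVanishes_iff _ i j).2 ?_
      have h2 := relVanishes_extFam ((koszulVanishes_iff _ i j).1 h1)
      have h3 : extFam (vanishingIdeal k (χ' ⁻¹' B)) =
          idealFam (vanishingIdeal k (dropZero k r ⁻¹' (χ' ⁻¹' B))) := by
        funext j
        ext f
        rw [mem_extFam, ← mem_vanishingIdeal_dropZero_preimage]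
        rfl
      rwa [h3] at h2

end General
end
end SecantBetti

namespace SecantBetti
noncomputable section

/-! ### Betti numbers of secant varieties -/

section Secant

open scoped Pointwise
open MvPolynomial (vanishingIdeal eval)

universe u

variable {k : Type u} [Field k] {n m r : ℕ}

lemma stabilizationNumber_ne_one {I : Ideal (MvPolynomial (Fin (r + 1)) k)}
    (h : ∀ i, partialElim I i = ⊥) : stabilizationNumber I ≠ 1 := by
  have : stabilizationNumber I ≤ 0 := Nat.sInf_le fun i _ => by rw [h, h]
  omega

lemma inCoordinates_bot [Infinite k] (g : (Fin n → k) ≃ₗ[k] (Fin n → k)) :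
    inCoordinates g (⊥ : Ideal (MvPolynomial (Fin n) k)) = ⊥ := by
  rw [← vanishingIdeal_univ, ← vanishingIdeal_image_equiv, Set.preimage_univ]

lemma partialElim_bot (i : ℕ) : partialElim (⊥ : Ideal (MvPolynomial (Fin (r + 1)) k)) i = ⊥ := by
  rw [eq_bot_iff]
  intro c hc
  obtain ⟨f, hf, -, rfl⟩ := mem_partialElim.1 hc
  rw [(Submodule.mem_bot _).1 hf, map_zero]
  exact Submodule.zero_mem _

lemma partialElim_one_vanishingIdeal_zero (g : (Fin (r + 1) → k) ≃ₗ[k] (Fin (r + 1) → k)) :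
    partialElim (inCoordinates g (vanishingIdeal k {(0 : Fin (r + 1) → k)})) 1 = ⊤ := by
  rw [Ideal.eq_top_iff_one]
  refine mem_partialElim.2 ⟨MvPolynomial.X 0, ?_, fun l hl => ?_, ?_⟩
  · rw [mem_inCoordinates, mem_vanishing]
    rintro _ rfl
    rw [eval_pull, map_zero, MvPolynomial.eval_X, Pi.zero_apply]
  · rw [coeffZero_apply, MvPolynomial.finSuccEquiv_X_zero, Polynomial.coeff_X, if_neg (by omega)]
  · rw [coeffZero_apply, MvPolynomial.finSuccEquiv_X_zero, Polynomial.coeff_X_one]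

lemma partialElim_zero_inCoordinates [Infinite k] (g : (Fin (r + 1) → k) ≃ₗ[k] (Fin (r + 1) → k))
    (I : Ideal (MvPolynomial (Fin (r + 1)) k)) :
    partialElim (inCoordinates g I) 0 = I.comap (pull (dropZero k r ∘ₗ g.toLinearMap)) := by
  ext c
  have h : pull g.toLinearMap (MvPolynomial.rename Fin.succ c) =
      pull (dropZero k r ∘ₗ g.toLinearMap) c :=
    MvPolynomial.funext fun x => by
      rw [eval_pull, eval_pull, MvPolynomial.eval_rename]
      rfl
  rw [mem_partialElim_zero, mem_inCoordinates, Ideal.mem_comap, h]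

/-- A polynomial not vanishing on `X` is nonzero at general points, up to scaling. -/
lemma exists_isOpen_of_notMem [Infinite k] {X : Set (ℙ k (Fin n → k))} (hX : IsIrreducible X)
    {h : MvPolynomial (Fin n) k} (hh : h ∉ vanishingIdeal k (affineCone X)) :
    ∃ U : Set (ℙ k (Fin n → k)), IsOpen U ∧ (X ∩ U).Nonempty ∧
      ∀ z ∈ U, ∃ c : k, c ≠ 0 ∧ eval (c • z.rep) h ≠ 0 := by
  have hV := isPrime_vanishingIdeal_affineCone hX
  refine ⟨(projZeroLocus (Set.range fun d => MvPolynomial.homogeneousComponent d h))ᶜ, ?_, ?_, ?_⟩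
  · rw [isOpen_compl_iff]
    refine isClosed_projZeroLocus ?_
    rintro _ ⟨d, rfl⟩
    exact ⟨d, MvPolynomial.homogeneousComponent_isHomogeneous d h⟩
  · obtain ⟨z, hz⟩ := hX.nonempty
    obtain ⟨a, ha⟩ := Function.ne_iff.1 z.rep_nonzero
    obtain ⟨w, hw, hwh⟩ : ∃ w ∈ affineCone X, eval w h ≠ 0 := by
      by_contra hcon
      push Not at hcon
      exact hh (mem_vanishing.2 hcon)
    -- The second polynomial, a coordinate not identically zero on the cone, keeps the point away
    -- from the origin, where `h` might be nonzero.
    obtain ⟨x, hx, hxh, hxa⟩ := exists_eval_ne_zero hV (g := MvPolynomial.X a) hw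
      (rep_mem_affineCone.2 hz) hwh (by simpa using ha)
    have hx0 : x ≠ 0 := by
      rintro rfl
      simp at hxa
    refine ⟨Projectivization.mk k x hx0, hx hx0, fun hmem => hxh ?_⟩
    rw [← MvPolynomial.sum_homogeneousComponent h, map_sum]
    refine Finset.sum_eq_zero fun d _ => ?_
    exact (eval_rep_eq_zero_iff (MvPolynomial.homogeneousComponent_isHomogeneous d h) hx0).1
      (hmem _ ⟨d, rfl⟩)
  · intro z hz
    by_contra hcon
    push Not at hcon
    refine hz ?_
    rintro _ ⟨d, rfl⟩
    let C : Set (Fin n → k) := {x | ∃ c : k, x = c • z.rep}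
    have hC : IsCone C := by
      refine ⟨⟨0, by simp⟩, ?_⟩
      rintro c _ ⟨c', rfl⟩
      exact ⟨c * c', by rw [smul_smul]⟩
    let p : Polynomial k :=
      MvPolynomial.aeval (fun a => Polynomial.C (z.rep a) * Polynomial.X) h
    have hp : ∀ c, p.eval c = eval (c • z.rep) h := by
      intro c
      have : (Polynomial.aeval (R := k) c).comp
          (MvPolynomial.aeval (fun a => Polynomial.C (z.rep a) * Polynomial.X)) =
          MvPolynomial.aeval (c • z.rep) := by
        apply MvPolynomial.algHom_ext
        intro a
        simp
        exact mul_comm _ _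
      have h1 := DFunLike.congr_fun this h
      simpa [p, Polynomial.aeval_def] using h1
    -- Only nonzero scalars are known to be roots of `p`; the factor `X` absorbs the value at zero.
    have h0 : Polynomial.X * p = 0 := by
      refine Polynomial.funext fun c => ?_
      rw [Polynomial.eval_mul, Polynomial.eval_X, hp, Polynomial.eval_zero, mul_eq_zero]
      exact or_iff_not_imp_left.2 (hcon c)
    rw [mul_eq_zero, or_iff_right Polynomial.X_ne_zero] at h0
    have hmem : h ∈ vanishingIdeal k C := by
      rw [mem_vanishing]
      rintro _ ⟨c, rfl⟩
      rw [← hp, h0, Polynomial.eval_zero]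
    exact mem_vanishing.1 (hC.isHomog h hmem d) _ ⟨1, (one_smul k _).symm⟩

lemma mem_tangentSpace_iff {X : Set (ℙ k (Fin n → k))} {z : ℙ k (Fin n → k)} {v : Fin n → k} :
    v ∈ tangentSpace X z ↔ IsTangentAt (affineCone X) z.rep v := Iff.rfl

lemma exists_apply_rep_eq {g : (Fin (r + 1) → k) ≃ₗ[k] (Fin (r + 1) → k)}
    {z : ℙ k (Fin (r + 1) → k)} (hg : IsCoordinateSystemAt g z) :
    ∃ c : k, c ≠ 0 ∧ g z.rep = c • Pi.single 0 1 := by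
  have h1 : g z.rep ∈ Submodule.span k {Pi.single (0 : Fin (r + 1)) (1 : k)} := by
    rw [← hg]
    refine Submodule.mem_map_of_mem (f := g.toLinearMap) ?_
    rw [Projectivization.submodule_eq]
    exact Submodule.mem_span_singleton_self _
  obtain ⟨c, hc⟩ := Submodule.mem_span_singleton.1 h1
  refine ⟨c, ?_, hc.symm⟩
  rintro rfl
  rw [zero_smul, eq_comm, LinearEquiv.map_eq_zero_iff] at hc
  exact z.rep_nonzero hc

lemma ker_dropZero_comp {g : (Fin (r + 1) → k) ≃ₗ[k] (Fin (r + 1) → k)}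
    {z : ℙ k (Fin (r + 1) → k)} (hg : IsCoordinateSystemAt g z) :
    LinearMap.ker (dropZero k r ∘ₗ g.toLinearMap) = z.submodule := by
  rw [LinearMap.ker_comp, ker_dropZero, ← hg]
  exact Submodule.comap_map_eq_of_injective g.injective _

lemma dropZero_comp_surjective (g : (Fin (r + 1) → k) ≃ₗ[k] (Fin (r + 1) → k)) :
    Function.Surjective (dropZero k r ∘ₗ g.toLinearMap) :=
  dropZero_surjective.comp g.surjective

/-- The projection from `z` gives the zeroth partial elimination ideal, up to coordinates. -/
lemma koszulVanishes_partialElim_zero [Infinite k]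
    {g : (Fin (r + 1) → k) ≃ₗ[k] (Fin (r + 1) → k)} {z : ℙ k (Fin (r + 1) → k)}
    (hg : IsCoordinateSystemAt g z) {φ : (Fin (r + 1) → k) →ₗ[k] (Fin r → k)}
    (hφ : IsProjectionFrom φ z.submodule) (I : Ideal (MvPolynomial (Fin (r + 1)) k)) {i j : ℤ}
    (h : KoszulVanishes (I.comap (pull φ)) i j) :
    KoszulVanishes (partialElim (inCoordinates g I) 0) i j := by
  -- The two projections have the same kernel, hence differ by an automorphism of the target.
  obtain ⟨e, he⟩ := exists_comp_eq_of_ker_le (dropZero_comp_surjective g) (q := φ)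
    (by rw [ker_dropZero_comp hg, hφ.2])
  have hsurj : Function.Surjective e := by
    intro y
    obtain ⟨x, rfl⟩ := hφ.1 y
    exact ⟨_, LinearMap.congr_fun he x⟩
  have hinj : Function.Injective e := LinearMap.injective_iff_surjective.2 hsurj
  let e' : (Fin r → k) ≃ₗ[k] (Fin r → k) := LinearEquiv.ofBijective e ⟨hinj, hsurj⟩
  rw [← koszulVanishes_inCoordinates_iff e', partialElim_zero_inCoordinates, inCoordinates_eq,
    ← comap_pull_comp]
  have : e'.toLinearMap ∘ₗ (dropZero k r ∘ₗ g.toLinearMap) = φ := he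
  rw [this]
  exact h

/-- Adding the kernel of `q` makes the set saturated for `q`, so its image under the intermediate
map `p` is the cylinder over `q '' W`. Here `p` projects from the point and `q` from the tangent
space. -/
lemma image_add_ker_eq_preimage {E F G : Type*} [AddCommGroup E] [Module k E] [AddCommGroup F]
    [Module k F] [AddCommGroup G] [Module k G] {p : E →ₗ[k] F} (hp : Function.Surjective p)
    {χ : F →ₗ[k] G} {q : E →ₗ[k] G} (h : χ ∘ₗ p = q) (W : Set E) :
    p '' ((LinearMap.ker q : Set E) + W) = χ ⁻¹' (q '' W) := by
  have h' : ∀ x, χ (p x) = q x := LinearMap.congr_fun h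
  ext y
  constructor
  · rintro ⟨_, ⟨t, ht, w, hw, rfl⟩, rfl⟩
    refine ⟨w, hw, ?_⟩
    rw [h', map_add, LinearMap.mem_ker.1 ht, zero_add]
  · rintro ⟨w, hw, hwy⟩
    obtain ⟨x, rfl⟩ := hp y
    refine ⟨x, ⟨x - w, ?_, w, hw, sub_add_cancel x w⟩, rfl⟩
    rw [SetLike.mem_coe, LinearMap.mem_ker, map_sub, ← h', hwy, sub_self]

/-- Vanishing of Betti numbers of a secant variety, from those of the secant varieties of the
projections from a general point and from the tangent space there. -/
theorem exists_isOpen_betti_secantVariety_eq_zero [CharZero k] {X : Set (ℙ k (Fin (r + 1) → k))}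
    (hX : IsIrreducible X) (hnd : IsNondegenerate X) {q : ℕ} (hq : 1 ≤ q) :
    ∃ U : Set (ℙ k (Fin (r + 1) → k)), IsOpen U ∧ (X ∩ U).Nonempty ∧ ∀ z ∈ X ∩ U,
      HasSimpleTangentCone (secantVariety q X) z →
      ∀ φ : (Fin (r + 1) → k) →ₗ[k] (Fin r → k), IsProjectionFrom φ z.submodule →
      ∀ (m : ℕ) (ψ : (Fin (r + 1) → k) →ₗ[k] (Fin m → k)),
        IsProjectionFrom ψ (tangentSpace X z) →
      ∀ (F : ResolutionOf (secantVariety q X))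
        (Fz : ResolutionOf (secantVariety q (projectedVariety φ X)))
        (FT : ResolutionOf (secantVariety (q - 1) (projectedVariety ψ X)))
        (i j : ℤ),
        FT.betti i (j - 1) = 0 → Fz.betti (i - 1) j = 0 → Fz.betti i j = 0 →
        F.betti i j = 0 := by
  obtain ⟨p, rfl⟩ : ∃ p, q = p + 1 := ⟨q - 1, by omega⟩
  rw [Nat.add_sub_cancel]
  have hV := isPrime_vanishingIdeal_affineCone hX
  have hVc := isCone_affineCone X
  have hspan := span_affineCone_of_isNondegenerate hnd
  have hW := isPrime_vanishingIdeal_sumSet hV p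
  have hWc := hVc.sumSet p
  obtain ⟨h, hh, H⟩ := exists_partialElim_eq hV hVc hW hWc
  obtain ⟨U, hU, hUX, hUh⟩ := exists_isOpen_of_notMem hX hh
  refine ⟨U, hU, hUX, ?_⟩
  rintro z ⟨hzX, hzU⟩ ⟨g, hg, hs, hprime⟩ φ hφ m ψ hψ F Fz FT i j
  have hInf : ∀ I : Ideal (MvPolynomial (Fin (r + 1)) k), stabilizationNumber I = 1 →
      partialElimInfty I = partialElim I 1 := by
    intro I hI
    rw [partialElimInfty, hI]
  -- With more than `r + 1` points the secant variety is empty; the irrelevant ideal contains `x₀`,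
  -- so its first partial elimination ideal is the unit ideal, which is not prime.
  have hle1 : p + 1 ≤ r + 1 := by
    by_contra hcon
    rw [hInf _ hs, homogeneousIdeal_secantVariety_of_lt (by omega),
      partialElim_one_vanishingIdeal_zero] at hprime
    exact hprime.ne_top rfl
  have hI : homogeneousIdeal (secantVariety (p + 1) X) =
      vanishingIdeal k (affineCone X + sumSet p (affineCone X)) :=
    homogeneousIdeal_secantVariety hV hspan hle1
  rw [hI] at hs hprime
  -- With `r + 1` points the sums fill the space, the ideal is zero and the chain is constant from
  -- index `0`.
  have hler : p + 1 ≤ r := by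
    by_contra hcon
    obtain rfl : p = r := by omega
    refine stabilizationNumber_ne_one (fun i => ?_) hs
    have : affineCone X + sumSet p (affineCone X) = Set.univ :=
      sumSet_eq_univ hVc hspan (q := p + 1) le_rfl
    rw [this, vanishingIdeal_univ, inCoordinates_bot, partialElim_bot]
  obtain ⟨c, hc, hch⟩ := hUh z hzU
  obtain ⟨c', hc', hgz⟩ := exists_apply_rep_eq hg
  have hzV := rep_mem_affineCone.2 hzX
  have hstab := partialElim_eq_of_stabilizationNumber hs
  rw [hInf _ hs] at hprime
  -- The genericity polynomial is nonzero at the multiple `c • z.rep` of the representative. The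
  -- prime in question is the first partial elimination ideal, the largest of the chain.
  have hK := H (c • z.rep) (hVc.2 c _ hzV) hch g (c * c') (mul_ne_zero hc hc')
    (by rw [map_smul, hgz, smul_smul]) _ hprime
    (by
      intro l
      cases l with
      | zero => exact partialElim_mono _ 0
      | succ l => exact (hstab (l + 1) (by omega)).le)
    ⟨1, le_rfl⟩
  have hT : tangentSubmodule (affineCone X) (c • z.rep) = LinearMap.ker ψ := by
    rw [tangentSubmodule_smul hVc _ hc, hψ.2]
    rfl
  -- Projection from the tangent space factors through projection from `z`, since the line through
  -- `z` lies in the cone and so its direction is tangent.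
  obtain ⟨χ, hχ⟩ := exists_comp_eq_of_ker_le (dropZero_comp_surjective g) (q := ψ) (by
    rw [ker_dropZero_comp hg, hψ.2, Projectivization.submodule_eq,
      Submodule.span_singleton_le_iff_mem, mem_tangentSpace_iff]
    refine isTangentAt_of_line fun c => ?_
    have : z.rep + c • z.rep = (1 + c) • z.rep := by rw [add_smul, one_smul]
    rw [this]
    exact hVc.2 _ _ hzV)
  have hχs : Function.Surjective χ := by
    intro y
    obtain ⟨x, rfl⟩ := hψ.1 y
    exact ⟨_, LinearMap.congr_fun hχ x⟩
  rw [hT, ← vanishingIdeal_image, image_add_ker_eq_preimage (dropZero_comp_surjective g) hχ] at hK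
  -- Otherwise the sums of `p` points fill the target of `ψ`, so the first partial elimination
  -- ideal, and with it the entire chain, is zero, contradicting stabilization number one.
  have hpm : p ≤ m := by
    by_contra hcon
    have hspanψ : Submodule.span k (ψ '' affineCone X) = ⊤ := by
      rw [← Submodule.map_span, hspan, Submodule.map_top, LinearMap.range_eq_top]
      exact hψ.1
    have hcone : IsCone (ψ '' affineCone X) := by
      refine ⟨⟨0, hVc.1, map_zero ψ⟩, ?_⟩
      rintro c _ ⟨v, hv, rfl⟩
      exact ⟨c • v, hVc.2 c v hv, map_smul ψ c v⟩
    rw [image_sumSet, sumSet_eq_univ hcone hspanψ (by omega), Set.preimage_univ,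
      vanishingIdeal_univ] at hK
    refine stabilizationNumber_ne_one (fun i => ?_) hs
    cases i with
    | zero => exact eq_bot_iff.2 (hK ▸ partialElim_mono _ 0)
    | succ l => rw [hstab (l + 1) (by omega), hK]
  have hIz := homogeneousIdeal_secantVariety_projectedVariety hφ.1 hV hspan hler
  have hIT := homogeneousIdeal_secantVariety_projectedVariety hψ.1 hV hspan hpm
  have hcone : ∀ {n : ℕ} (Z : Set (ℙ k (Fin n → k))), IsHomog (homogeneousIdeal Z) ∧
      ∀ f ∈ homogeneousIdeal Z, MvPolynomial.constantCoeff f = 0 := fun Z =>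
    ⟨(isCone_affineCone Z).isHomog, (isCone_affineCone Z).constantCoeff_eq_zero⟩
  refine betti_eq_zero_of_koszulVanishes (hcone _).1 (hcone _).2 (hcone _).1 (hcone _).2
    (hcone _).1 (hcone _).2 (fun i j h1 h2 h3 => ?_) F Fz FT i j
  rw [hIT, ← vanishingIdeal_image] at h1
  rw [hIz] at h2 h3
  rw [hI]
  refine koszulVanishes_of_partialElim (hVc.add hWc).isHomog g hs ?_
    (koszulVanishes_partialElim_zero hg hφ _ h2) (koszulVanishes_partialElim_zero hg hφ _ h3)
  rw [hInf _ hs, hK]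
  exact koszulVanishes_preimage hχs _ h1

end Secant
end
end SecantBetti

open SecantBetti in
theorem mainTheorem12 {k : Type*} [Field k] [IsAlgClosed k] [CharZero k] (r : ℕ) :
    -- the geometric statement
    (∀ X : Set (ℙ k (Fin (r + 1) → k)), IsClosed X → IsIrreducible X → IsNondegenerate X →
      ∀ q : ℕ, 1 ≤ q →
      -- `z` is a general point of `X`
      ∃ U : Set (ℙ k (Fin (r + 1) → k)), IsOpen U ∧ (X ∩ U).Nonempty ∧ ∀ z ∈ X ∩ U,
        HasSimpleTangentCone (secantVariety q X) z →
        -- `φ` is the projection from `z`, and `ψ` the projection from the tangent space at `z`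
        ∀ φ : (Fin (r + 1) → k) →ₗ[k] (Fin r → k), IsProjectionFrom φ z.submodule →
        ∀ (m : ℕ) (ψ : (Fin (r + 1) → k) →ₗ[k] (Fin m → k)),
          IsProjectionFrom ψ (tangentSpace X z) →
        ∀ (F : ResolutionOf (secantVariety q X))
          (Fz : ResolutionOf (secantVariety q (projectedVariety φ X)))
          (FT : ResolutionOf (secantVariety (q - 1) (projectedVariety ψ X)))
          (i j : ℤ),
          FT.betti i (j - 1) = 0 → Fz.betti (i - 1) j = 0 → Fz.betti i j = 0 →
          F.betti i j = 0) ∧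
    -- the algebraic statement
    (∀ I : Ideal (MvPolynomial (Fin (r + 1)) k),
      (∀ f ∈ I, ∀ d : ℕ, MvPolynomial.homogeneousComponent d f ∈ I) →
      ∀ (z : ℙ k (Fin (r + 1) → k)) (g : (Fin (r + 1) → k) ≃ₗ[k] (Fin (r + 1) → k)),
        IsCoordinateSystemAt g z →
        stabilizationNumber (inCoordinates g I) = 1 →
        ∀ i j : ℤ,
          KoszulVanishes (partialElimInfty (inCoordinates g I)) i (j - 1) →
          KoszulVanishes (partialElim (inCoordinates g I) 0) (i - 1) j →
          KoszulVanishes (partialElim (inCoordinates g I) 0) i j →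
          KoszulVanishes I i j) := by
  refine ⟨fun X _ hX hnd q hq => exists_isOpen_betti_secantVariety_eq_zero hX hnd hq, ?_⟩
  intro I hI z g _ hs i j h1 h2 h3
  exact koszulVanishes_of_partialElim hI g hs h1 h2 h3
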